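/- **Setting.** All spaces are real. Let $\mathcal D$ be the set of dyadic intervals $I=[\frac{i}{2^j},\frac{i+1}{2^j})$, $j\ge 0$, $0\le i<2^j$, and let $h_I=\chi_{I^+}-\chi_{I^-}$, where $I^+$, $I^-$ are the left and right halves of $I$. Put $h_\varnothing=\chi_{[0,1)}$, $\mathcal D^+=\mathcal D\cup\{\varnothing\}$, $H=\operatorname{span}\{h_I: I\in\mathcal D^+\}$. A *Haar system space* $X$ is the completion of $H$ under a norm $\|\cdot\|_X$ such that $\|f\|_X=\|g\|_X$ whenever $f,g\in H$ and $|f|,|g|$ have the same distribution, and $\|\chi_{[0,1)}\|_X=1$. Let $r_m=\sum_{|I|=2^{-m}}h_I$ be the Rademacher functions, let $\iota:\mathcal D^+\to\mathbb N_0$ be the bijection $\iota(\varnothing)=0$, $\iota([\frac{i}{2^j},\frac{i+1}{2^j}))=2^j+i$, and let $\mathbf r=(r_I)_{I\in\mathcal D^+}$ be one of the two families $(r_{\iota(I)})_{I\in\mathcal D^+}$ (independent) or $(r_0)_{I\in\mathcal D^+}$ (constant). Let $X(\mathbf r)$ be the completion of $H$ under $$\Bigl\|\sum_{I\in\mathcal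 D^+}a_Ih_I\Bigr\|_{X(\mathbf r)}=\Bigl\|\,s\mapsto\int_0^1\Bigl|\sum_{I\in\mathcal D^+}r_I(u)a_Ih_I(s)\Bigr|\,du\,\Bigr\|_X .$$ A *Haar system Hardy space* is the closure $Y=X_0(\mathbf r)$ of $\operatorname{span}\{h_I:I\in\mathcal D\}$ in $X(\mathbf r)$. Put $Y_n=\operatorname{span}\{h_I: I\in\mathcal D,\ |I|\ge 2^{-n}\}\subset Y$. The Haar system is *$K$-unconditional in $Y$* if $\|\sum_{I\in\mathcal D}\sigma_Ia_Ih_I\|_Y\le K\|\sum_{I\in\mathcal D}a_Ih_I\|_Y$ for all finitely supported scalars $(a_I)$ and all signs $\sigma_I\in\{\pm1\}$. An operator $T:Y_N\to Y_N$ has *$\delta$-large positive diagonal* if $\langle h_I,Th_I\rangle=\int_0^1 h_I\cdot Th_I\ge\delta|I|$ for all $I\in\mathcal D$ with $|I|\ge2^{-N}$. The identity $I_{Y_n}$ *factors through $S:Y_N\to Y_N$ with constant $C$* if there are linear operators $B:Y_n\to Y_N$, $A:Y_N\to Y_n$ with $\|A\|\|B\|\le C$ and $I_{Y_n}=ASB$.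 **Theorem.** Let $Y$ be a Haar system Hardy space, let $\Gamma,\delta,\varepsilon>0$, and put $\eta=\frac{\varepsilon}{6(1+\varepsilon)}$. Let $n,N\in\mathbb N_0$ satisfy $$N\ge 42n(n+1)\Bigl\lceil\frac{\Gamma}{\eta\delta}\Bigr\rceil+42+\Bigl\lfloor4\log_2\Bigl(\frac{\Gamma}{\eta\delta}\Bigr)\Bigr\rfloor. \tag{1}$$ Then for every linear operator $T:Y_N\to Y_N$ with $\|T\|\le\Gamma$ the following holds. (i) If $\delta=1$ in (1), and if $n\le N$, then $I_{Y_n}$ factors through $T$ or through $I_{Y_N}-T$ with constant $2(1+\varepsilon)$. (ii) If $T$ has $\delta$-large positive diagonal, then $I_{Y_n}$ factors through $T$ with constant $\frac{1+\varepsilon}{\delta}$. If the Haar system is $K$-unconditional in $Y$ for some $K\ge1$, then (1) can be replaced by $$N\ge 42n\Bigl\lceil\frac{K\Gamma}{\eta\delta}\Bigr\rceil+42+\Bigl\lfloor4\log_2\Bigl(\frac{\Gamma}{\eta\delta}\Bigr)\Bigr\rfloor .$$ -/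

import Mathlib

open MeasureTheory ProbabilityTheory Set

noncomputable section

namespace HaarHardy

/-! ### Dyadic intervals and the Haar system on `[0,1)` -/

/-- The pair `(level, index) = (j, i)` stands for the dyadic interval `[i/2^j, (i+1)/2^j)`. -/
structure DyadicInterval where
  level : ℕ
  index : Fin (2 ^ level)

namespace DyadicInterval

/-- The subset of `ℝ` that a dyadic interval stands for. -/
def toSet (I : DyadicInterval) : Set ℝ :=
  Ico ((I.index : ℝ) / 2 ^ I.level) (((I.index : ℝ) + 1) / 2 ^ I.level)

/-- The length `|I| = 2^(-j)`. -/
def length (I : DyadicInterval) : ℝ := 1 / 2 ^ I.level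

/-- The left half `I⁺`. -/
def left (I : DyadicInterval) : DyadicInterval where
  level := I.level + 1
  index := ⟨2 * I.index, by have := I.index.2; rw [pow_succ]; omega⟩

/-- The right half `I⁻`. -/
def right (I : DyadicInterval) : DyadicInterval where
  level := I.level + 1
  index := ⟨2 * I.index + 1, by have := I.index.2; rw [pow_succ]; omega⟩

end DyadicInterval

/-- Lebesgue measure on `[0,1)`. Functions on `[0,1)` are treated as functions on `ℝ` that vanish
outside `[0,1)`. -/
def unitMeasure : Measure ℝ := volume.restrict (Ico 0 1)

/-- The characteristic function of a dyadic interval. -/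
def chi (I : DyadicInterval) : ℝ → ℝ := indicator I.toSet 1

/-- The Haar function `h_I = χ_{I⁺} - χ_{I⁻}`. -/
def haar (I : DyadicInterval) : ℝ → ℝ := chi I.left - chi I.right

/-- The index set `𝓓⁺ = 𝓓 ∪ {∅}`; the value `none` stands for `∅`. -/
abbrev DyadicPlus : Type := Option DyadicInterval

/-- The full Haar system `(h_I)`, `I ∈ 𝓓⁺`, where `h_∅ = χ_{[0,1)}`. -/
def haarPlus : DyadicPlus → ℝ → ℝ
  | none => indicator (Ico 0 1) 1
  | some I => haar I

/-- `H = span {h_I : I ∈ 𝓓⁺}`. -/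
def haarSpan : Submodule ℝ (ℝ → ℝ) := Submodule.span ℝ (range haarPlus)

/-- `χ_{[0,1)}` as an element of `H`. -/
def one01 : haarSpan := ⟨haarPlus none, Submodule.subset_span ⟨none, rfl⟩⟩

/-- A Haar system space `X` is the completion of `H` under a norm with the following properties;
the space is given here by its norm on `H`. -/
structure HaarSystemSpace where
  /-- the norm of `X` on `H` -/
  norm : Seminorm ℝ haarSpan
  /-- it is a norm -/
  eq_zero_of_norm_eq_zero : ∀ f : haarSpan, norm f = 0 → f = 0
  /-- if `|f|` and `|g|` have the same distribution, then `‖f‖ = ‖g‖` -/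
  norm_eq_of_identDistrib : ∀ f g : haarSpan,
    IdentDistrib (fun s => |(f : ℝ → ℝ) s|) (fun s => |(g : ℝ → ℝ) s|) unitMeasure unitMeasure →
      norm f = norm g
  /-- `‖χ_{[0,1)}‖ = 1` -/
  norm_one01 : norm one01 = 1

/-! ### Rademacher functions -/

/-- The Rademacher function `r_n`, the sum of the `h_I` with `|I| = 2^(-n)`. -/
def rademacher (n : ℕ) : ℝ → ℝ := ∑ i : Fin (2 ^ n), haar ⟨n, i⟩

/-- The bijection `ι : 𝓓⁺ → ℕ₀`, `ι(∅) = 0`, `ι([i/2^j, (i+1)/2^j)) = 2^j + i`. -/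
def iota : DyadicPlus → ℕ
  | none => 0
  | some I => 2 ^ I.level + I.index

/-- The two-element set `𝓡` that consists of the independent family `(r_{ι(I)})` and the constant
family `(r_0)`. -/
def rademacherFamilies : Set (DyadicPlus → ℝ → ℝ) :=
  {fun I => rademacher (iota I), fun _ => rademacher 0}

/-! ### Step functions (auxiliary facts for the definition of the Hardy norm) -/

/-- `f` vanishes outside `[0,1)` and is constant on all dyadic intervals of level `n`. -/
def IsStep (n : ℕ) (f : ℝ → ℝ) : Prop :=
  (∀ s, s ∉ Ico (0 : ℝ) 1 → f s = 0) ∧ ∀ s t : ℝ, ⌊s * 2 ^ n⌋ = ⌊t * 2 ^ n⌋ → f s = f t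

lemma floor_eq_of_le {m n : ℕ} (h : n ≤ m) {s t : ℝ} (hst : ⌊s * 2 ^ m⌋ = ⌊t * 2 ^ m⌋) :
    ⌊s * 2 ^ n⌋ = ⌊t * 2 ^ n⌋ := by
  obtain ⟨k, rfl⟩ := Nat.exists_eq_add_of_le h
  have key : ∀ x : ℝ, ⌊x * 2 ^ n⌋ = ⌊x * 2 ^ (n + k)⌋ / ((2 ^ k : ℕ) : ℤ) := by
    intro x
    rw [← Int.floor_div_natCast]
    congr 1
    push_cast
    field_simp
    ring
  rw [key, key, hst]

lemma IsStep.mono {m n : ℕ} (h : n ≤ m) {f : ℝ → ℝ} (hf : IsStep n f) : IsStep m f :=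
  ⟨hf.1, fun s t hst => hf.2 s t (floor_eq_of_le h hst)⟩

lemma mem_toSet_iff (I : DyadicInterval) (s : ℝ) :
    s ∈ I.toSet ↔ ⌊s * 2 ^ I.level⌋ = (I.index : ℤ) := by
  rw [Int.floor_eq_iff, DyadicInterval.toSet, mem_Ico, div_le_iff₀ (by positivity),
    lt_div_iff₀ (by positivity)]
  push_cast
  rfl

lemma toSet_subset (I : DyadicInterval) : I.toSet ⊆ Ico (0 : ℝ) 1 := by
  intro s hs
  rw [DyadicInterval.toSet, mem_Ico, div_le_iff₀ (by positivity),
    lt_div_iff₀ (by positivity)] at hs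
  have h2 : (0 : ℝ) < 2 ^ I.level := by positivity
  have h1 : ((I.index : ℕ) : ℝ) + 1 ≤ 2 ^ I.level := by exact_mod_cast I.index.2
  have h0 : (0 : ℝ) ≤ ((I.index : ℕ) : ℝ) := Nat.cast_nonneg _
  constructor
  · by_contra hneg
    nlinarith
  · by_contra hneg
    nlinarith

lemma isStep_chi (I : DyadicInterval) : IsStep I.level (chi I) := by
  classical
  refine ⟨fun s hs => indicator_of_notMem (fun h => hs (toSet_subset I h)) _, fun s t hst => ?_⟩
  simp only [chi, indicator_apply, mem_toSet_iff, hst, Pi.one_apply]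

lemma IsStep.add {n : ℕ} {f g : ℝ → ℝ} (hf : IsStep n f) (hg : IsStep n g) :
    IsStep n (f + g) :=
  ⟨fun s hs => by simp [hf.1 s hs, hg.1 s hs],
    fun s t h => by simp [hf.2 s t h, hg.2 s t h]⟩

lemma IsStep.smul {n : ℕ} {f : ℝ → ℝ} (c : ℝ) (hf : IsStep n f) : IsStep n (c • f) :=
  ⟨fun s hs => by simp [hf.1 s hs], fun s t h => by simp [hf.2 s t h]⟩

lemma IsStep.sub {n : ℕ} {f g : ℝ → ℝ} (hf : IsStep n f) (hg : IsStep n g) :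
    IsStep n (f - g) :=
  ⟨fun s hs => by simp [hf.1 s hs, hg.1 s hs],
    fun s t h => by simp [hf.2 s t h, hg.2 s t h]⟩

lemma isStep_haar (I : DyadicInterval) : IsStep (I.level + 1) (haar I) :=
  (isStep_chi I.left).sub (isStep_chi I.right)

/-- The level from which on `h_I` is a step function. -/
def stepLevel : DyadicPlus → ℕ
  | none => 0
  | some I => I.level + 1

lemma chi_zero : chi ⟨0, ⟨0, by norm_num⟩⟩ = haarPlus none := by
  simp [chi, DyadicInterval.toSet, haarPlus]

lemma isStep_haarPlus (I : DyadicPlus) : IsStep (stepLevel I) (haarPlus I) := by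
  cases I with
  | none => rw [← chi_zero]; exact isStep_chi _
  | some I => exact isStep_haar I

lemma exists_isStep_of_mem {f : ℝ → ℝ} (hf : f ∈ haarSpan) : ∃ n, IsStep n f := by
  induction hf using Submodule.span_induction with
  | mem x hx => obtain ⟨I, rfl⟩ := hx; exact ⟨_, isStep_haarPlus I⟩
  | zero => exact ⟨0, fun _ _ => rfl, fun _ _ _ => rfl⟩
  | add x y _ _ hx hy =>
    obtain ⟨m, hm⟩ := hx
    obtain ⟨n, hn⟩ := hy
    exact ⟨max m n, (hm.mono (le_max_left _ _)).add (hn.mono (le_max_right _ _))⟩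
  | smul c x _ hx => obtain ⟨m, hm⟩ := hx; exact ⟨m, hm.smul c⟩

lemma chi_left_add_chi_right (I : DyadicInterval) : chi I.left + chi I.right = chi I := by
  classical
  funext s
  have hk : ⌊s * 2 ^ I.level⌋ = ⌊s * 2 ^ (I.level + 1)⌋ / ((2 : ℕ) : ℤ) := by
    rw [← Int.floor_div_natCast]
    congr 1
    push_cast
    field_simp
    ring
  simp only [Pi.add_apply, chi, indicator_apply, mem_toSet_iff, hk, Pi.one_apply]
  simp only [DyadicInterval.left, DyadicInterval.right]
  push_cast
  generalize ⌊s * 2 ^ (I.level + 1)⌋ = z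
  split_ifs <;> first | omega | norm_num

lemma chi_mem (I : DyadicInterval) : chi I ∈ haarSpan := by
  obtain ⟨j, i⟩ := I
  induction j with
  | zero =>
    have : i = ⟨0, by norm_num⟩ := Subsingleton.elim (α := Fin 1) _ _
    rw [this, chi_zero]
    exact Submodule.subset_span ⟨none, rfl⟩
  | succ j ih =>
    have hi : (i : ℕ) < 2 ^ j * 2 := lt_of_lt_of_eq i.2 (pow_succ 2 j)
    let p : DyadicInterval := ⟨j, ⟨i / 2, by omega⟩⟩
    have hp : chi p ∈ haarSpan := ih _
    have hh : haar p ∈ haarSpan := Submodule.subset_span ⟨some p, rfl⟩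
    have hsum := chi_left_add_chi_right p
    have hdiff : chi p.left - chi p.right = haar p := rfl
    have hl : chi p.left = (1 / 2 : ℝ) • (chi p + haar p) := by
      rw [← hsum, ← hdiff]; funext s; simp; ring
    have hr : chi p.right = (1 / 2 : ℝ) • (chi p - haar p) := by
      rw [← hsum, ← hdiff]; funext s; simp; ring
    rcases Nat.even_or_odd' (i : ℕ) with ⟨q, hq | hq⟩
    · have : (⟨j + 1, i⟩ : DyadicInterval) = p.left := by
        simp only [DyadicInterval.left, p, DyadicInterval.mk.injEq, heq_eq_eq, true_and]
        ext; simp; omega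
      rw [this, hl]
      exact haarSpan.smul_mem _ (haarSpan.add_mem hp hh)
    · have : (⟨j + 1, i⟩ : DyadicInterval) = p.right := by
        simp only [DyadicInterval.right, p, DyadicInterval.mk.injEq, heq_eq_eq, true_and]
        ext; simp; omega
      rw [this, hr]
      exact haarSpan.smul_mem _ (haarSpan.sub_mem hp hh)

lemma IsStep.mem {n : ℕ} {f : ℝ → ℝ} (hf : IsStep n f) : f ∈ haarSpan := by
  classical
  have h2 : (0 : ℝ) < 2 ^ n := by positivity
  have : f = ∑ i : Fin (2 ^ n), f ((i : ℝ) / 2 ^ n) • chi ⟨n, i⟩ := by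
    funext s
    simp only [Finset.sum_apply, Pi.smul_apply, smul_eq_mul, chi, indicator_apply, Pi.one_apply,
      mem_toSet_iff, mul_ite, mul_one, mul_zero]
    by_cases hs : s ∈ Ico (0 : ℝ) 1
    · have h0 : 0 ≤ ⌊s * 2 ^ n⌋ := Int.floor_nonneg.2 (mul_nonneg hs.1 h2.le)
      obtain ⟨k, hk⟩ := Int.eq_ofNat_of_zero_le h0
      have hlt : k < 2 ^ n := by
        have : ⌊s * 2 ^ n⌋ < ((2 ^ n : ℕ) : ℤ) := by
          rw [Int.floor_lt]
          push_cast
          nlinarith [hs.2]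
        rw [hk] at this
        exact_mod_cast this
      rw [Finset.sum_eq_single ⟨k, hlt⟩]
      · rw [if_pos hk]
        apply hf.2
        rw [hk, div_mul_cancel₀ _ h2.ne']
        simp
      · intro b _ hb
        rw [if_neg]
        intro hbk
        apply hb
        ext
        rw [hk] at hbk
        simpa using hbk.symm
      · simp
    · rw [hf.1 s hs, Finset.sum_eq_zero]
      intro i _
      rw [if_neg]
      intro hi
      exact hs (toSet_subset ⟨n, i⟩ ((mem_toSet_iff ⟨n, i⟩ s).2 hi))
  rw [this]
  exact Submodule.sum_mem _ fun i _ => haarSpan.smul_mem _ (chi_mem _)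

lemma measurable_chi (I : DyadicInterval) : Measurable (chi I) :=
  measurable_one.indicator measurableSet_Ico

lemma measurable_haarPlus (I : DyadicPlus) : Measurable (haarPlus I) := by
  cases I with
  | none => exact measurable_one.indicator measurableSet_Ico
  | some I => exact (measurable_chi _).sub (measurable_chi _)

lemma measurable_of_mem {f : ℝ → ℝ} (hf : f ∈ haarSpan) : Measurable f := by
  induction hf using Submodule.span_induction with
  | mem x hx => obtain ⟨I, rfl⟩ := hx; exact measurable_haarPlus I
  | zero => exact measurable_zero
  | add x y _ _ hx hy => exact hx.add hy
  | smul c x _ hx => exact hx.const_smul c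

namespace HaarSystemSpace

variable (X : HaarSystemSpace)

lemma norm_eq_of_abs_eq (f g : haarSpan)
    (h : ∀ s, |(f : ℝ → ℝ) s| = |(g : ℝ → ℝ) s|) : X.norm f = X.norm g := by
  apply X.norm_eq_of_identDistrib
  have : (fun s => |(f : ℝ → ℝ) s|) = fun s => |(g : ℝ → ℝ) s| := funext h
  rw [this]
  exact IdentDistrib.refl (measurable_of_mem g.2).abs.aemeasurable

/-- The norm of a Haar system space is monotone. -/
lemma norm_mono (f g : haarSpan)
    (h : ∀ s, |(f : ℝ → ℝ) s| ≤ |(g : ℝ → ℝ) s|) : X.norm f ≤ X.norm g := by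
  obtain ⟨n₁, hf₁⟩ := exists_isStep_of_mem f.2
  obtain ⟨n₂, hg₂⟩ := exists_isStep_of_mem g.2
  obtain ⟨n, hf, hg⟩ : ∃ n, IsStep n (f : ℝ → ℝ) ∧ IsStep n (g : ℝ → ℝ) :=
    ⟨max n₁ n₂, hf₁.mono (le_max_left _ _), hg₂.mono (le_max_right _ _)⟩
  -- replace `g` by `f` on one dyadic interval of level `n` after the other
  have hw : ∀ j : ℕ, IsStep n
      (fun s => if ⌊s * 2 ^ n⌋ < (j : ℤ) then (f : ℝ → ℝ) s else (g : ℝ → ℝ) s) := by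
    intro j
    refine ⟨fun s hs => ?_, fun s t hst => ?_⟩
    · simp [hf.1 s hs, hg.1 s hs]
    · simp only [hst, hf.2 s t hst, hg.2 s t hst]
  have hv : ∀ j : ℕ, IsStep n
      (fun s => if ⌊s * 2 ^ n⌋ < (j : ℤ) then (f : ℝ → ℝ) s else
        if ⌊s * 2 ^ n⌋ = (j : ℤ) then - (g : ℝ → ℝ) s else (g : ℝ → ℝ) s) := by
    intro j
    refine ⟨fun s hs => ?_, fun s t hst => ?_⟩
    · simp [hf.1 s hs, hg.1 s hs]
    · simp only [hst, hf.2 s t hst, hg.2 s t hst]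
  have claim : ∀ j : ℕ, X.norm ⟨_, (hw j).mem⟩ ≤ X.norm g := by
    intro j
    induction j with
    | zero =>
      apply le_of_eq
      apply X.norm_eq_of_abs_eq
      intro s
      by_cases hs : s ∈ Ico (0 : ℝ) 1
      · have : ¬ (⌊s * 2 ^ n⌋ < ((0 : ℕ) : ℤ)) := by
          have : 0 ≤ ⌊s * 2 ^ n⌋ := Int.floor_nonneg.2 (mul_nonneg hs.1 (by positivity))
          simpa using this
        simp only [if_neg this]
      · simp [hf.1 s hs, hg.1 s hs]
    | succ j ih =>
      have hvw : X.norm ⟨_, (hv j).mem⟩ = X.norm ⟨_, (hw j).mem⟩ := by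
        apply X.norm_eq_of_abs_eq
        intro s
        simp only
        split_ifs <;> simp
      set x : ℝ := (j : ℝ) / 2 ^ n with hx
      have hxs : ∀ s : ℝ, ⌊s * 2 ^ n⌋ = (j : ℤ) → ⌊s * 2 ^ n⌋ = ⌊x * 2 ^ n⌋ := by
        intro s hs
        rw [hs, hx, div_mul_cancel₀ _ (by positivity)]
        simp
      obtain ⟨c, hc1, hc⟩ : ∃ c : ℝ, |c| ≤ 1 ∧ (f : ℝ → ℝ) x = c * (g : ℝ → ℝ) x := by
        by_cases h0 : (g : ℝ → ℝ) x = 0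
        · have := h x
          rw [h0, abs_zero] at this
          exact ⟨0, by simp, by simpa using this⟩
        · refine ⟨(f : ℝ → ℝ) x / (g : ℝ → ℝ) x, ?_, by field_simp⟩
          rw [abs_div]
          exact div_le_one_of_le₀ (h x) (abs_nonneg _)
      have hcl := (abs_le.1 hc1).1
      have hcu := (abs_le.1 hc1).2
      have hcomb : (⟨_, (hw (j + 1)).mem⟩ : haarSpan) =
          ((1 + c) / 2) • (⟨_, (hw j).mem⟩ : haarSpan) +
            ((1 - c) / 2) • (⟨_, (hv j).mem⟩ : haarSpan) := by
        apply Subtype.ext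
        funext s
        simp only [Submodule.coe_add, Submodule.coe_smul, Pi.add_apply, Pi.smul_apply,
          smul_eq_mul]
        rcases lt_trichotomy ⌊s * 2 ^ n⌋ (j : ℤ) with hlt | heq | hgt
        · rw [if_pos (by push_cast; omega), if_pos hlt, if_pos hlt]
          ring
        · rw [if_pos (by push_cast; omega), if_neg (by omega), if_neg (by omega), if_pos heq,
            hf.2 s x (hxs s heq), hg.2 s x (hxs s heq), hc]
          ring
        · rw [if_neg (by push_cast; omega), if_neg (by omega), if_neg (by omega),
            if_neg (by omega)]
          ring
      rw [hcomb]
      refine (map_add_le_add X.norm _ _).trans ?_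
      rw [map_smul_eq_mul, map_smul_eq_mul, hvw, Real.norm_of_nonneg (by linarith),
        Real.norm_of_nonneg (by linarith)]
      linarith
  refine le_trans (le_of_eq ?_) (claim (2 ^ n))
  apply X.norm_eq_of_abs_eq
  intro s
  by_cases hs : s ∈ Ico (0 : ℝ) 1
  · have : ⌊s * 2 ^ n⌋ < ((2 ^ n : ℕ) : ℤ) := by
      have h2 : (0 : ℝ) < 2 ^ n := by positivity
      rw [Int.floor_lt]
      push_cast
      nlinarith [hs.2]
    simp only [if_pos this]
  · simp [hf.1 s hs, hg.1 s hs]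

end HaarSystemSpace

/-! ### Haar system Hardy spaces -/

/-- For a finitely supported family `a = (a_I)`, `I ∈ 𝓓⁺`, the function `∑ a_I h_I` on `[0,1)`. -/
def haarSum (a : DyadicPlus →₀ ℝ) (s : ℝ) : ℝ := a.sum fun I c => c * haarPlus I s

/-- The function `s ↦ ∫₀¹ |∑ r_I(u) a_I h_I(s)| du`. -/
def randomizedAverage (r : rademacherFamilies) (a : DyadicPlus →₀ ℝ) (s : ℝ) : ℝ :=
  ∫ u, |a.sum fun I c => r.1 I u * c * haarPlus I s| ∂unitMeasure

lemma randomizedAverage_mem (r : rademacherFamilies) (a : DyadicPlus →₀ ℝ) :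
    randomizedAverage r a ∈ haarSpan := by
  have h : ∀ I ∈ a.support, IsStep (a.support.sup stepLevel) (haarPlus I) :=
    fun I hI => (isStep_haarPlus I).mono (Finset.le_sup (f := stepLevel) hI)
  refine IsStep.mem (n := a.support.sup stepLevel) ⟨fun s hs => ?_, fun s t hst => ?_⟩
  · have : ∀ u, (a.sum fun I c => r.1 I u * c * haarPlus I s) = 0 := fun u =>
      Finset.sum_eq_zero fun I hI => by simp [(h I hI).1 s hs]
    simp [randomizedAverage, this]
  · have : ∀ u, (a.sum fun I c => r.1 I u * c * haarPlus I s) =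
        a.sum fun I c => r.1 I u * c * haarPlus I t := fun u =>
      Finset.sum_congr rfl fun I hI => by simp only [(h I hI).2 s t hst]
    simp only [randomizedAverage, this]

lemma integrable_rademacher (n : ℕ) : Integrable (rademacher n) unitMeasure := by
  have hchi : ∀ I, Integrable (chi I) unitMeasure := fun I =>
    (integrable_indicator_iff measurableSet_Ico).2
      ((integrableOn_const (C := (1 : ℝ)) (by
        have : unitMeasure I.toSet ≤ volume I.toSet := Measure.restrict_apply_le _ _
        exact (this.trans_lt (by simp [DyadicInterval.toSet])).ne)))
  exact integrable_finsetSum' _ fun i _ => (hchi _).sub (hchi _)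

lemma integrable_family (r : rademacherFamilies) (I : DyadicPlus) :
    Integrable (r.1 I) unitMeasure := by
  obtain ⟨r, hr | hr⟩ := r
  · subst hr; exact integrable_rademacher _
  · rw [mem_singleton_iff] at hr
    subst hr; exact integrable_rademacher _

lemma integrable_inner (r : rademacherFamilies) (a : DyadicPlus →₀ ℝ) (s : ℝ) :
    Integrable (fun u => a.sum fun I c => r.1 I u * c * haarPlus I s) unitMeasure :=
  integrable_finsetSum _ fun I _ => ((integrable_family r I).mul_const _).mul_const _

/-- The norm `‖∑ a_I h_I‖_{X(𝐫)} = ‖s ↦ ∫₀¹ |∑ r_I(u) a_I h_I(s)| du‖_X`. -/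
def hardyNorm (X : HaarSystemSpace) (r : rademacherFamilies) : Seminorm ℝ (DyadicPlus →₀ ℝ) :=
  Seminorm.of (fun a => X.norm ⟨randomizedAverage r a, randomizedAverage_mem r a⟩)
    (by
      intro a b
      refine le_trans (X.norm_mono _ (⟨randomizedAverage r a, randomizedAverage_mem r a⟩ +
        ⟨randomizedAverage r b, randomizedAverage_mem r b⟩) fun s => ?_)
        (map_add_le_add X.norm _ _)
      have hn : ∀ a : DyadicPlus →₀ ℝ, 0 ≤ randomizedAverage r a s := fun a =>
        integral_nonneg fun _ => abs_nonneg _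
      simp only [Submodule.coe_add, Pi.add_apply]
      rw [abs_of_nonneg (hn _), abs_of_nonneg (add_nonneg (hn _) (hn _))]
      unfold randomizedAverage
      rw [← integral_add (integrable_inner r a s).abs (integrable_inner r b s).abs]
      refine integral_mono (integrable_inner r (a + b) s).abs
        ((integrable_inner r a s).abs.add (integrable_inner r b s).abs) fun u => ?_
      simp only
      rw [Finsupp.sum_add_index' (by simp) (by intros; ring)]
      exact abs_add_le _ _)
    (by
      intro c a
      rw [← map_smul_eq_mul]
      apply X.norm_eq_of_abs_eq
      intro s
      have : randomizedAverage r (c • a) s = |c| * randomizedAverage r a s := by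
        unfold randomizedAverage
        rw [← integral_const_mul]
        refine integral_congr_ae (Filter.Eventually.of_forall fun u => ?_)
        simp only
        rw [Finsupp.sum_smul_index (by simp), ← abs_mul, Finsupp.mul_sum]
        congr 1
        exact Finset.sum_congr rfl fun I _ => by ring
      simp [this, abs_mul])

/-- The space `H` with the norm of `X(𝐫)`; the element `∑ a_I h_I` of `H` is represented by its
(unique) family of Haar coefficients `(a_I)`. -/
def HaarPolynomial (_ : HaarSystemSpace) (_ : rademacherFamilies) : Type := DyadicPlus →₀ ℝ

variable (X : HaarSystemSpace) (r : rademacherFamilies)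

instance : AddCommGroup (HaarPolynomial X r) := inferInstanceAs (AddCommGroup (DyadicPlus →₀ ℝ))

instance : Module ℝ (HaarPolynomial X r) := inferInstanceAs (Module ℝ (DyadicPlus →₀ ℝ))

instance : SeminormedAddCommGroup (HaarPolynomial X r) :=
  AddGroupSeminorm.toSeminormedAddCommGroup (hardyNorm X r).toAddGroupSeminorm

instance : NormedSpace ℝ (HaarPolynomial X r) where
  norm_smul_le c a := (map_smul_eq_mul (hardyNorm X r) c a).le

/-- The Haar system Hardy space `X(𝐫)`, the completion of `H` under the norm of `X(𝐫)`. -/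
def HardySpace : Type := UniformSpace.Completion (HaarPolynomial X r)

instance : NormedAddCommGroup (HardySpace X r) :=
  inferInstanceAs (NormedAddCommGroup (UniformSpace.Completion (HaarPolynomial X r)))

instance : NormedSpace ℝ (HardySpace X r) :=
  inferInstanceAs (NormedSpace ℝ (UniformSpace.Completion (HaarPolynomial X r)))

/-- The element `∑ a_I h_I` of `X(𝐫)`. -/
def toHardySpace (a : DyadicPlus →₀ ℝ) : HardySpace X r :=
  UniformSpace.Completion.toComplₗᵢ (𝕜 := ℝ) (E := HaarPolynomial X r) a

/-- The Haar system Hardy space `Y = X₀(𝐫)`, the closure of `H₀ = span {h_I : I ∈ 𝓓}` in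
`X(𝐫)`. -/
def hardySpaceZero : Submodule ℝ (HardySpace X r) :=
  (Submodule.span ℝ
    (range fun I : DyadicInterval =>
      toHardySpace X r (Finsupp.single (some I) 1))).topologicalClosure

/-- The Haar function `h_I`, `I ∈ 𝓓`, as an element of `Y`. -/
def haarVec (I : DyadicInterval) : hardySpaceZero X r :=
  ⟨toHardySpace X r (Finsupp.single (some I) 1),
    Submodule.le_topologicalClosure _ (Submodule.subset_span ⟨I, rfl⟩)⟩

/-- `Y_n = span {h_I : |I| ≥ 2^(-n)}`, a subspace of `Y`. -/
def levelSpace (n : ℕ) : Submodule ℝ (hardySpaceZero X r) :=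
  Submodule.span ℝ (haarVec X r '' {I | I.level ≤ n})

/-- The Haar function `h_I` as an element of `Y_n`. -/
def levelHaarVec (n : ℕ) (I : DyadicInterval) (hI : I.level ≤ n) : levelSpace X r n :=
  ⟨haarVec X r I, Submodule.subset_span ⟨I, hI, rfl⟩⟩

/-- The Haar system `(h_I)`, `I ∈ 𝓓`, is `K`-unconditional in `Y`. -/
def IsUnconditional (K : ℝ) : Prop :=
  ∀ (a : DyadicInterval →₀ ℝ) (σ : DyadicInterval → ℝ), (∀ I, σ I = 1 ∨ σ I = -1) →
    ‖a.sum fun I c => (σ I * c) • haarVec X r I‖ ≤ K * ‖a.sum fun I c => c • haarVec X r I‖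

/-- `T : Y_N → Y_N` has `δ`-large positive diagonal with respect to the Haar system:
`⟨h_I, T h_I⟩ ≥ δ |I|` for all `I` with `|I| ≥ 2^(-N)`. Here `⟨f, g⟩ = ∫ f g`, where the element
`T h_I` of the completion is identified with the (unique) function `∑ a_J h_J` in `H` that
represents it. -/
def HasLargePositiveDiagonal {N : ℕ} (δ : ℝ)
    (T : levelSpace X r N →L[ℝ] levelSpace X r N) : Prop :=
  ∀ (I : DyadicInterval) (hI : I.level ≤ N), ∃ a : DyadicPlus →₀ ℝ,
    ((T (levelHaarVec X r N I hI) : hardySpaceZero X r) : HardySpace X r) = toHardySpace X r a ∧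
      δ * I.length ≤ ∫ s, haar I s * haarSum a s ∂unitMeasure

/-- `S` factors through `T` with constant `C` (and error `0`). -/
def FactorsThrough {E F : Type} [NormedAddCommGroup E] [NormedSpace ℝ E]
    [NormedAddCommGroup F] [NormedSpace ℝ F] (S : E →L[ℝ] E) (T : F →L[ℝ] F) (C : ℝ) : Prop :=
  ∃ (B : E →L[ℝ] F) (A : F →L[ℝ] E), ‖A‖ * ‖B‖ ≤ C ∧ S = A.comp (T.comp B)

end HaarHardy

end

noncomputable section

namespace HaarHardy

open Finset
open scoped BigOperators

/-! Binary digits identify dyadic intervals of level k with cells given by the first k coordinates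
of a sign cube. Under this identification `Y_N` is the space of mean-zero functions on `Cube (N +
1)`, and its norm becomes a seminorm `ν` with the few properties listed in `IsHardyNorm`. Both
Rademacher families are covered (`exists_isHardyNorm`), and the analytic part uses only these
properties.

It suffices to find contractions B : Y_n → Y_N and A : Y_N → Y_n such that ATB is close to a scalar
multiple c of the identity. Then ATB is bounded below, hence invertible in finite dimension
(`factorsThrough_of_near_smul`). Since AB is the identity, A(I - T)B is equally close to 1 - c, and
one of |c|, |1 - c| is at least 1/2; this gives (i). For (ii), c is close to a weighted average of
normalized diagonal entries of T, so it cannot be much smaller than δ.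

The pair (B, A) comes from a copy of the first n + 1 levels inside the cube: level i is moved to
level σ i, and each coordinate is multiplied by a sign θ that depends on the earlier coordinates.
`pull` turns Walsh functions into twisted Walsh functions, and `push` inverts it up to a conditional
expectation. As σ is increasing on the levels used, the top level of each Walsh set is respected.
Level multipliers are therefore intertwined, and both maps are contractive also for the independent
family.

For random θ the Walsh matrix of the compression is nearly diagonal. An entry is a random sum whose
terms are almost orthogonal, so its second moment is governed by the Hilbert-Schmidt norm of a block
of T between two levels. If all levels are at least k₀, the square of that norm is at most Γ²
2^(-k₀/2) (`sum_sq_matrix_le`), because the norm of a level-k₀ cell and the matching dual bound have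
product 2^(-k₀). What remains on the diagonal is `levelTrace` at the top level
(`expect_sq_entry_le`). There are at most 4^(n+1) entries, so one θ makes the total error small
(`exists_twist_near_levelMul`).

The compression is now close to a multiplier depending on levels only, with values in [-Γ, Γ]. Among
nq + 1 levels the pigeonhole principle finds n + 1 whose values lie within Γ/q of one number c
(`exists_cluster`). Replacing the multiplier by c costs Γ/q times the norm of level multipliers,
which is at most 2(n + 1) in general and K under unconditionality. This is the only difference
between the two conditions on N. -/

section SignCube

/-! ### The sign cube -/

/-- The sign cube, a model for the dyadic intervals of level `M`. -/
abbrev Cube (M : ℕ) : Type := Fin M → ℤˣ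

/-- The real number `±1` given by a sign. -/
def sgn (x : ℤˣ) : ℝ := ((x : ℤ) : ℝ)

@[simp] lemma sgn_one : sgn 1 = 1 := by simp [sgn]

@[simp] lemma sgn_mul (x y : ℤˣ) : sgn (x * y) = sgn x * sgn y := by simp [sgn]

@[simp] lemma sgn_neg (x : ℤˣ) : sgn (-x) = -sgn x := by simp [sgn]

@[simp] lemma sgn_mul_self (x : ℤˣ) : sgn x * sgn x = 1 := by
  rcases Int.units_eq_one_or x with rfl | rfl <;> simp

@[simp] lemma abs_sgn (x : ℤˣ) : |sgn x| = 1 := by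
  rcases Int.units_eq_one_or x with rfl | rfl <;> simp

lemma exists_sgn_mul_eq_abs (x : ℝ) : ∃ e : ℤˣ, sgn e * x = |x| := by
  rcases abs_cases x with ⟨h, _⟩ | ⟨h, _⟩
  · exact ⟨1, by simp [h]⟩
  · exact ⟨-1, by simp [h]⟩

/-! ### Uniform averages over finite sets. -/

section Averages

variable {α β : Type*} [Fintype α]

lemma expect_equiv_self (e : α ≃ α) (f : α → ℝ) : 𝔼 x, f (e x) = 𝔼 x, f x :=
  Fintype.expect_equiv e _ _ fun _ => rfl

/-- A bijection that reverses the sign of `f` makes its average equal to its own negative. Every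
orthogonality relation below is obtained in this way, by flipping one sign. -/
lemma expect_eq_zero_of_neg (e : α ≃ α) {f : α → ℝ} (h : ∀ x, f (e x) = -f x) :
    𝔼 x, f x = 0 := by
  have h1 := expect_equiv_self e f
  simp only [h, expect_neg_distrib] at h1
  linarith

lemma seminorm_expect_le (ρ : Seminorm ℝ (β → ℝ)) (F : α → β → ℝ) :
    ρ (fun s => 𝔼 t, F t s) ≤ 𝔼 t, ρ (F t) := by
  have h1 : (fun s => 𝔼 t, F t s) = ((Fintype.card α : ℝ)⁻¹) • ∑ t, F t := by
    funext s
    simp [Fintype.expect_eq_sum_div_card, div_eq_inv_mul]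
  rw [h1, map_smul_eq_mul, Fintype.expect_eq_sum_div_card, div_eq_inv_mul,
    Real.norm_of_nonneg (by positivity)]
  exact mul_le_mul_of_nonneg_left (map_sum_le_sum ρ _ _) (by positivity)
where
  map_sum_le_sum (ρ : Seminorm ℝ (β → ℝ)) (s : Finset α) (F : α → β → ℝ) :
      ρ (∑ t ∈ s, F t) ≤ ∑ t ∈ s, ρ (F t) :=
    Finset.le_sum_of_subadditive ρ (map_zero ρ).le (fun a b => map_add_le_add ρ a b) s F

lemma abs_expect_le_of_forall [Nonempty α] {f : α → ℝ} {c : ℝ} (h : ∀ x, |f x| ≤ c) :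
    |𝔼 x, f x| ≤ c :=
  (abs_expect_le _ _).trans (expect_le univ_nonempty fun x _ => h x)

end Averages

variable {M : ℕ}

lemma expect_mul_right (f : Cube M → ℝ) (a : Cube M) : 𝔼 t, f (t * a) = 𝔼 t, f t :=
  expect_equiv_self (Equiv.mulRight a) f

lemma expect_mul_left (f : Cube M → ℝ) (a : Cube M) : 𝔼 t, f (a * t) = 𝔼 t, f t :=
  expect_equiv_self (Equiv.mulLeft a) f

/-- The first `k` coordinates, the others being replaced by `1`. -/
def trunc (k : ℕ) (s : Cube M) : Cube M := fun i => if (i : ℕ) < k then s i else 1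

/-- The coordinates from `k` on, the others being replaced by `1`. -/
def tail (k : ℕ) (s : Cube M) : Cube M := fun i => if (i : ℕ) < k then 1 else s i

lemma trunc_mul (k : ℕ) (s t : Cube M) : trunc k (s * t) = trunc k s * trunc k t := by
  funext i; simp only [trunc, Pi.mul_apply]; split_ifs <;> simp

lemma tail_mul (k : ℕ) (s t : Cube M) : tail k (s * t) = tail k s * tail k t := by
  funext i; simp only [tail, Pi.mul_apply]; split_ifs <;> simp

lemma trunc_mul_tail_self (k : ℕ) (s : Cube M) : trunc k s * tail k s = s := by
  funext i; simp only [trunc, tail, Pi.mul_apply]; split_ifs <;> simp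

lemma trunc_trunc {j k : ℕ} (h : j ≤ k) (s : Cube M) : trunc j (trunc k s) = trunc j s := by
  funext i; simp only [trunc]; split_ifs <;> first | rfl | omega

lemma tail_tail {j k : ℕ} (h : j ≤ k) (s : Cube M) : tail j (tail k s) = tail k s := by
  funext i; simp only [tail]; split_ifs <;> first | rfl | omega

lemma trunc_tail {j k : ℕ} (h : j ≤ k) (s : Cube M) : trunc j (tail k s) = 1 := by
  funext i; simp only [trunc, tail, Pi.one_apply]; split_ifs <;> first | rfl | omega

lemma trunc_mul_tail {j k : ℕ} (h : j ≤ k) (s t : Cube M) :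
    trunc j (s * tail k t) = trunc j s := by
  rw [trunc_mul, trunc_tail h, mul_one]

lemma trunc_eq_trunc_iff {k : ℕ} {s t : Cube M} :
    trunc k s = trunc k t ↔ ∀ i : Fin M, (i : ℕ) < k → s i = t i := by
  constructor
  · intro h i hi
    have := congrFun h i
    simpa [trunc, hi] using this
  · intro h
    funext i
    simp only [trunc]
    split_ifs with hi
    · exact h i hi
    · rfl

lemma trunc_eq_of_le {j k : ℕ} (h : j ≤ k) {s t : Cube M} (hst : trunc k s = trunc k t) :
    trunc j s = trunc j t := by
  rw [← trunc_trunc h s, hst, trunc_trunc h]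

lemma trunc_of_le {k : ℕ} (h : M ≤ k) (s : Cube M) : trunc k s = s := by
  funext i; simp only [trunc]; rw [if_pos (by omega)]

lemma tail_of_le {k : ℕ} (h : M ≤ k) (s : Cube M) : tail k s = 1 := by
  funext i; simp only [tail]; rw [if_pos (by omega)]; rfl

lemma tail_zero (s : Cube M) : tail 0 s = s := by funext i; simp [tail]

lemma trunc_zero (s : Cube M) : trunc 0 s = 1 := by funext i; simp [trunc]

lemma mul_tail_eq {k : ℕ} {s t : Cube M} (h : trunc k s = trunc k t) :
    s * tail k (s⁻¹ * t) = t := by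
  funext i
  simp only [Pi.mul_apply, tail]
  split_ifs with hi
  · simpa using trunc_eq_trunc_iff.1 h i hi
  · exact mul_inv_cancel_left (s i) (t i)

/-- The sign vector with `-1` at position `m` and `1` elsewhere. -/
def flip (m : Fin M) : Cube M := Pi.mulSingle m (-1)

lemma flip_same (m : Fin M) : flip m m = -1 := by simp [flip]

lemma flip_of_ne {m i : Fin M} (h : i ≠ m) : flip m i = 1 := by simp [flip, h]

lemma trunc_flip {k : ℕ} {m : Fin M} (h : k ≤ m) : trunc k (flip m) = 1 := by
  funext i
  simp only [trunc, Pi.one_apply]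
  split_ifs with hi
  · exact flip_of_ne (by rintro rfl; omega)
  · rfl

lemma tail_flip {k : ℕ} {m : Fin M} (h : k ≤ m) : tail k (flip m) = flip m := by
  have := trunc_mul_tail_self k (flip m)
  rwa [trunc_flip h, one_mul] at this

/-! ### Conditional expectations and the inner product -/

/-- The conditional expectation with respect to the first `k` coordinates. -/
def condE (k : ℕ) : (Cube M → ℝ) →ₗ[ℝ] (Cube M → ℝ) where
  toFun f s := 𝔼 t, f (s * tail k t)
  map_add' f g := by funext s; simp [expect_add_distrib]
  map_smul' c f := by funext s; simp [mul_expect]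

lemma condE_apply (k : ℕ) (f : Cube M → ℝ) (s : Cube M) :
    condE k f s = 𝔼 t, f (s * tail k t) := rfl

/-- The normalized inner product on the cube. -/
def dot : (Cube M → ℝ) →ₗ[ℝ] (Cube M → ℝ) →ₗ[ℝ] ℝ :=
  LinearMap.mk₂ ℝ (fun f g => 𝔼 s, f s * g s)
    (fun f g h => by simp [add_mul, expect_add_distrib])
    (fun c f g => by
      rw [smul_eq_mul, mul_expect]
      exact expect_congr rfl fun s _ => mul_assoc _ _ _)
    (fun f g h => by simp [mul_add, expect_add_distrib])
    (fun c f g => by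
      rw [smul_eq_mul, mul_expect]
      exact expect_congr rfl fun s _ => by simp only [Pi.smul_apply, smul_eq_mul]; ring)

lemma dot_apply (f g : Cube M → ℝ) : dot f g = 𝔼 s, f s * g s := rfl

lemma condE_mul_tail (k : ℕ) (f : Cube M → ℝ) (s t : Cube M) :
    condE k f (s * tail k t) = condE k f s := by
  simp only [condE_apply, mul_assoc, ← tail_mul]
  exact expect_mul_left (fun u => f (s * tail k u)) t

lemma condE_congr {k : ℕ} (f : Cube M → ℝ) {s t : Cube M} (h : trunc k s = trunc k t) :
    condE k f s = condE k f t := by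
  rw [← mul_tail_eq h, condE_mul_tail]

lemma condE_eq_self {k : ℕ} {f : Cube M → ℝ} (h : ∀ s t, f (s * tail k t) = f s) :
    condE k f = f := by
  funext s
  simp [condE_apply, h]

lemma condE_zero (f : Cube M → ℝ) (s : Cube M) : condE 0 f s = 𝔼 t, f t := by
  simp only [condE_apply, tail_zero]
  exact expect_mul_left f s

lemma condE_of_le {k : ℕ} (h : M ≤ k) (f : Cube M → ℝ) : condE k f = f :=
  condE_eq_self fun s t => by rw [tail_of_le h, mul_one]

lemma condE_condE_of_le {j k : ℕ} (h : j ≤ k) (f : Cube M → ℝ) :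
    condE j (condE k f) = condE j f := by
  funext s
  simp only [condE_apply]
  rw [expect_comm]
  have : ∀ t : Cube M, 𝔼 u, f (s * tail j u * tail k t) = 𝔼 u, f (s * tail j u) := by
    intro t
    rw [← expect_mul_right (fun u => f (s * tail j u)) (tail k t)]
    refine expect_congr rfl fun u _ => ?_
    rw [tail_mul, tail_tail h, mul_assoc]
  simp [this]

lemma condE_condE_of_ge {j k : ℕ} (h : k ≤ j) (f : Cube M → ℝ) :
    condE j (condE k f) = condE k f :=
  condE_eq_self fun s t => by rw [← tail_tail h t, condE_mul_tail]

lemma condE_comm (j k : ℕ) (f : Cube M → ℝ) : condE j (condE k f) = condE k (condE j f) := by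
  rcases le_total j k with h | h
  · rw [condE_condE_of_le h, condE_condE_of_ge h]
  · rw [condE_condE_of_le h, condE_condE_of_ge h]

lemma units_mul_self_cube (t : Cube M) : t * t = 1 := by
  funext i; exact Int.units_mul_self _

lemma dot_condE (k : ℕ) (f g : Cube M → ℝ) : dot (condE k f) g = dot f (condE k g) := by
  simp only [dot_apply, condE_apply, expect_mul, mul_expect]
  rw [expect_comm]
  conv_rhs => rw [expect_comm]
  refine expect_congr rfl fun t _ => ?_
  rw [← expect_mul_right (fun s => f (s * tail k t) * g s) (tail k t)]
  simp only [mul_assoc, units_mul_self_cube, mul_one]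

/-- Flipping coordinate `m` is a symmetry of the average over the coordinates from `k` on, and it
changes the sign of `f`. -/
lemma condE_eq_zero_of_flip {k : ℕ} {m : Fin M} (h : k ≤ m) {f : Cube M → ℝ}
    (hf : ∀ s, f (s * flip m) = -f s) : condE k f = 0 := by
  funext s
  refine expect_eq_zero_of_neg (Equiv.mulRight (flip m)) fun t => ?_
  simp only [Equiv.coe_mulRight, tail_mul, tail_flip h, ← mul_assoc, hf]

lemma expect_condE (k : ℕ) (f : Cube M → ℝ) : 𝔼 s, condE k f s = 𝔼 s, f s := by
  rw [← condE_zero (condE k f) 1, condE_condE_of_le (Nat.zero_le _), condE_zero]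

/-- Martingale differences. -/
def mdiff (k : ℕ) : (Cube M → ℝ) →ₗ[ℝ] (Cube M → ℝ) := condE (k + 1) - condE k

lemma mdiff_apply (k : ℕ) (f : Cube M → ℝ) : mdiff k f = condE (k + 1) f - condE k f := rfl

lemma dot_mdiff (k : ℕ) (f g : Cube M → ℝ) : dot (mdiff k f) g = dot f (mdiff k g) := by
  simp [mdiff_apply, dot_condE]

lemma sum_mdiff (n : ℕ) (f : Cube M → ℝ) :
    ∑ k ∈ range n, mdiff k f = condE n f - condE 0 f := by
  simp only [mdiff_apply]
  exact Finset.sum_range_sub (fun k => condE k f) n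

/-! ### The Haar system of the cube -/

lemma expect_trunc_eq_one {k : ℕ} (hk : k ≤ M) :
    𝔼 s : Cube M, (if trunc k s = 1 then (1 : ℝ) else 0) = 1 / 2 ^ k := by
  induction k with
  | zero => simp [trunc_zero]
  | succ k ih =>
    have ih := ih (by omega)
    let m : Fin M := ⟨k, hk⟩
    -- A cell of level k is the disjoint union of its two halves, which are exchanged by flipping
    -- coordinate k and so have equal measure.
    have key : ∀ s : Cube M, (if trunc k s = 1 then (1 : ℝ) else 0) =
        (if trunc (k + 1) s = 1 then 1 else 0) +
          (if trunc (k + 1) (s * flip m) = 1 then 1 else 0) := by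
      intro s
      have e1 : ∀ (j : ℕ) (t : Cube M), trunc j t = 1 ↔ ∀ i : Fin M, (i : ℕ) < j → t i = 1 := by
        intro j t
        have := @trunc_eq_trunc_iff M j t 1
        rwa [show trunc j (1 : Cube M) = 1 by funext i; simp [trunc]] at this
      have e2 : ∀ t : Cube M, trunc (k + 1) t = 1 ↔ trunc k t = 1 ∧ t m = 1 := by
        intro t
        rw [e1, e1]
        constructor
        · intro h
          exact ⟨fun i hi => h i (by omega), h m (Nat.lt_succ_self k)⟩
        · rintro ⟨h, h'⟩ i hi
          rcases Nat.lt_succ_iff_lt_or_eq.1 hi with hi | hi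
          · exact h i hi
          · have : i = m := Fin.ext hi
            rwa [this]
      have e3 : trunc k (s * flip m) = trunc k s := by
        rw [trunc_mul, trunc_flip (show k ≤ (m : ℕ) from le_rfl), mul_one]
      simp only [e2, e3, Pi.mul_apply, flip_same]
      rcases Int.units_eq_one_or (s m) with h | h <;> simp [h]
    simp only [key, expect_add_distrib] at ih
    rw [expect_mul_right (fun s => if trunc (k + 1) s = 1 then (1 : ℝ) else 0)] at ih
    rw [pow_succ]
    field_simp at ih ⊢
    linarith

lemma expect_trunc_eq {k : ℕ} (hk : k ≤ M) (t : Cube M) :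
    𝔼 s : Cube M, (if trunc k s = trunc k t then (1 : ℝ) else 0) = 1 / 2 ^ k := by
  rw [← expect_trunc_eq_one hk, ← expect_mul_right _ t]
  congr 1
  funext s
  rw [trunc_mul]
  simp

lemma condE_kernel {k : ℕ} (hk : k ≤ M) (f : Cube M → ℝ) (s : Cube M) :
    condE k f s = 2 ^ k * 𝔼 t, (if trunc k t = trunc k s then f t else 0) := by
  have h1 : 𝔼 t, (if trunc k t = trunc k s then f t else 0) =
      (𝔼 t : Cube M, if trunc k t = trunc k s then (1 : ℝ) else 0) * condE k f s := by
    rw [← expect_condE k, expect_mul]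
    refine expect_congr rfl fun t _ => ?_
    simp only [condE_apply, trunc_mul_tail le_rfl]
    split_ifs with h
    · rw [one_mul]; exact condE_congr f h
    · simp
  rw [h1, expect_trunc_eq hk]
  field_simp

/-- The Haar function of level `k` on the cell of `p`; it vanishes unless `trunc k p = p`. -/
def haarC (k : Fin M) (p : Cube M) : Cube M → ℝ := fun s => if trunc k s = p then sgn (s k) else 0

/-- The two conditional expectations are averages over a cell and over one of its halves. Their
difference is half the difference between the averages over the half containing `s` and the other
half, that is, the Haar term at `s`. -/
lemma mdiff_eq (k : Fin M) (f : Cube M → ℝ) (s : Cube M) :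
    mdiff k f s = 2 ^ (k : ℕ) * dot (haarC k (trunc k s)) f * sgn (s k) := by
  rw [mdiff_apply, Pi.sub_apply, condE_kernel (by omega), condE_kernel (by omega), dot_apply,
    pow_succ, mul_assoc, mul_assoc, ← mul_sub, expect_mul, mul_expect, ← expect_sub_distrib]
  congr 2
  funext t
  have e2 : trunc (k + 1) t = trunc (k + 1) s ↔ trunc k t = trunc k s ∧ t k = s k := by
    simp only [trunc_eq_trunc_iff]
    constructor
    · intro h
      exact ⟨fun i hi => h i (by omega), h k (Nat.lt_succ_self k)⟩
    · rintro ⟨h, h'⟩ i hi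
      rcases Nat.lt_succ_iff_lt_or_eq.1 hi with hi | hi
      · exact h i hi
      · rwa [Fin.ext hi]
  simp only [haarC, e2]
  by_cases h : trunc k t = trunc k s
  · rcases Int.units_eq_one_or (t k) with h1 | h1 <;>
      rcases Int.units_eq_one_or (s k) with h2 | h2 <;>
        simp [h, h1, h2, (by decide : (1 : ℤˣ) ≠ -1), (by decide : (-1 : ℤˣ) ≠ 1)] <;> ring
  · simp [h]

end SignCube

section Twist

variable {M : ℕ}

/-! ### Twisted Walsh functions -/

/-- Multiply the `k`-th coordinate by a sign that depends on the coordinates before it. -/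
def twist (θ : Fin M × Cube M → ℤˣ) (s : Cube M) : Cube M := fun k => s k * θ (k, trunc k s)

lemma twist_one (s : Cube M) : twist 1 s = s := by funext k; simp [twist]

lemma twist_congr (θ : Fin M × Cube M → ℤˣ) {k : ℕ} {s t : Cube M} (h : trunc k s = trunc k t)
    {i : Fin M} (hi : (i : ℕ) < k) : twist θ s i = twist θ t i := by
  simp only [twist]
  rw [trunc_eq_trunc_iff.1 h i hi, trunc_eq_of_le hi.le h]

lemma twist_mul_flip_of_lt (θ : Fin M × Cube M → ℤˣ) (s : Cube M) {i m : Fin M} (h : i < m) :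
    twist θ (s * flip m) i = twist θ s i :=
  twist_congr θ (k := m) (by rw [trunc_mul, trunc_flip le_rfl, mul_one]) h

lemma twist_mul_flip_same (θ : Fin M × Cube M → ℤˣ) (s : Cube M) (m : Fin M) :
    twist θ (s * flip m) m = -twist θ s m := by
  simp [twist, trunc_mul, trunc_flip (show (m : ℕ) ≤ m from le_rfl), flip_same]

/-- The sign on coordinate k depends only on earlier coordinates, so `s` can be recovered one
coordinate at a time. -/
lemma twist_injective (θ : Fin M × Cube M → ℤˣ) : Function.Injective (twist θ) := by
  intro s t h
  have key : ∀ (k : ℕ), trunc k s = trunc k t := by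
    intro k
    induction k with
    | zero => rw [trunc_zero, trunc_zero]
    | succ k ih =>
      refine trunc_eq_trunc_iff.2 fun i hi => ?_
      rcases Nat.lt_succ_iff_lt_or_eq.1 hi with hi | hi
      · exact trunc_eq_trunc_iff.1 ih i hi
      · have := congrFun h i
        simp only [twist, hi, ih] at this
        exact mul_right_cancel this
  simpa [trunc_of_le le_rfl] using key M

/-- `twist` as a permutation, followed by the permutation `σ` of the coordinates. -/
def twistPerm (θ : Fin M × Cube M → ℤˣ) (σ : Equiv.Perm (Fin M)) : Equiv.Perm (Cube M) :=
  (Equiv.ofBijective _ (Finite.injective_iff_bijective.1 (twist_injective θ))).trans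
    (σ.symm.arrowCongr (Equiv.refl _))

lemma twistPerm_apply (θ : Fin M × Cube M → ℤˣ) (σ : Equiv.Perm (Fin M)) (s : Cube M)
    (i : Fin M) : twistPerm θ σ s i = twist θ s (σ i) := rfl

/-- The Walsh function of `A`, composed with the twist by `θ`. -/
def walsh (θ : Fin M × Cube M → ℤˣ) (A : Finset (Fin M)) : Cube M → ℝ :=
  fun s => ∏ k ∈ A, sgn (twist θ s k)

lemma walsh_mul_self (θ : Fin M × Cube M → ℤˣ) (A : Finset (Fin M)) (s : Cube M) :
    walsh θ A s * walsh θ A s = 1 := by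
  simp [walsh, ← prod_mul_distrib]

lemma abs_walsh (θ : Fin M × Cube M → ℤˣ) (A : Finset (Fin M)) (s : Cube M) :
    |walsh θ A s| = 1 := by
  simp [walsh, abs_prod]

lemma walsh_empty (θ : Fin M × Cube M → ℤˣ) : walsh θ ∅ = 1 := by
  funext s; simp [walsh]

lemma walsh_congr (θ : Fin M × Cube M → ℤˣ) {k : ℕ} {A : Finset (Fin M)}
    (hA : ∀ i ∈ A, (i : ℕ) < k) {s t : Cube M} (h : trunc k s = trunc k t) :
    walsh θ A s = walsh θ A t :=
  prod_congr rfl fun i hi => by rw [twist_congr θ h (hA i hi)]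

lemma condE_walsh_of_lt (θ : Fin M × Cube M → ℤˣ) {k : ℕ} {A : Finset (Fin M)}
    (hA : ∀ i ∈ A, (i : ℕ) < k) : condE k (walsh θ A) = walsh θ A :=
  condE_eq_self fun s t => walsh_congr θ hA (trunc_mul_tail le_rfl s t)

/-- The largest coordinate of `A` occurs in exactly one factor, and the signs `θ` in all factors
depend on strictly smaller coordinates only. -/
lemma walsh_mul_flip (θ : Fin M × Cube M → ℤˣ) {A : Finset (Fin M)} (hA : A.Nonempty)
    (s : Cube M) : walsh θ A (s * flip (A.max' hA)) = -walsh θ A s := by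
  rw [walsh, walsh, ← mul_prod_erase A _ (A.max'_mem hA), ← mul_prod_erase A _ (A.max'_mem hA),
    twist_mul_flip_same, sgn_neg, neg_mul]
  congr 2
  refine prod_congr rfl fun i hi => ?_
  rw [twist_mul_flip_of_lt]
  exact A.lt_max'_of_mem_erase_max' hA hi

lemma condE_walsh_of_le (θ : Fin M × Cube M → ℤˣ) {k : ℕ} {A : Finset (Fin M)}
    (hA : A.Nonempty) (h : k ≤ A.max' hA) : condE k (walsh θ A) = 0 :=
  condE_eq_zero_of_flip h (walsh_mul_flip θ hA)

lemma mdiff_walsh (θ : Fin M × Cube M → ℤˣ) (k : ℕ) {A : Finset (Fin M)} (hA : A.Nonempty) :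
    mdiff k (walsh θ A) = if k = A.max' hA then walsh θ A else 0 := by
  have hlt : ∀ j : ℕ, (A.max' hA : ℕ) < j → ∀ i ∈ A, (i : ℕ) < j := fun j hj i hi =>
    lt_of_le_of_lt (A.le_max' i hi) hj
  rw [mdiff_apply]
  rcases lt_trichotomy k (A.max' hA) with h | h | h
  · rw [condE_walsh_of_le θ hA h, condE_walsh_of_le θ hA h.le, if_neg h.ne, sub_zero]
  · rw [condE_walsh_of_lt θ (hlt _ (by omega)), condE_walsh_of_le θ hA h.le, if_pos h, sub_zero]
  · rw [condE_walsh_of_lt θ (hlt _ (by omega)), condE_walsh_of_lt θ (hlt _ h), if_neg h.ne',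
      sub_self]

lemma mdiff_one (k : ℕ) : mdiff k (1 : Cube M → ℝ) = 0 := by
  have : ∀ j, condE j (1 : Cube M → ℝ) = 1 := fun j => condE_eq_self fun _ _ => rfl
  simp [mdiff_apply, this]

/-- The multiplier with coefficient `γ k` on level `k`. -/
def levelMul (γ : Fin M → ℝ) : (Cube M → ℝ) →ₗ[ℝ] (Cube M → ℝ) := ∑ k : Fin M, γ k • mdiff k

lemma levelMul_apply (γ : Fin M → ℝ) (f : Cube M → ℝ) :
    levelMul γ f = ∑ k : Fin M, γ k • mdiff k f := by simp [levelMul]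

lemma dot_levelMul (γ : Fin M → ℝ) (f g : Cube M → ℝ) :
    dot (levelMul γ f) g = dot f (levelMul γ g) := by
  simp [levelMul_apply, dot_mdiff]

/-- The value of `γ` at the largest element of `A`. -/
def atMax (γ : Fin M → ℝ) (A : Finset (Fin M)) : ℝ := if h : A.Nonempty then γ (A.max' h) else 0

lemma atMax_of_nonempty (γ : Fin M → ℝ) {A : Finset (Fin M)} (h : A.Nonempty) :
    atMax γ A = γ (A.max' h) := dif_pos h

/-- A twisted Walsh function is a single martingale difference, located at its top level, whatever
`θ` is. Hence it is an eigenvector of every level multiplier. -/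
lemma levelMul_walsh (γ : Fin M → ℝ) (θ : Fin M × Cube M → ℤˣ) (A : Finset (Fin M)) :
    levelMul γ (walsh θ A) = atMax γ A • walsh θ A := by
  rw [levelMul_apply]
  rcases A.eq_empty_or_nonempty with rfl | hA
  · simp [walsh_empty, mdiff_one, atMax]
  · rw [atMax_of_nonempty γ hA, sum_eq_single (A.max' hA)]
    · simp [mdiff_walsh θ _ hA]
    · intro k _ hk
      rw [mdiff_walsh θ _ hA, if_neg (fun h => hk (Fin.ext h)), smul_zero]
    · simp

lemma atMax_map (γ : Fin M → ℝ) (σ : Equiv.Perm (Fin M)) {A : Finset (Fin M)}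
    (hσ : ∀ i ∈ A, ∀ j ∈ A, i < j → σ i < σ j) :
    atMax γ (A.map σ.toEmbedding) = atMax (fun i => γ (σ i)) A := by
  rcases A.eq_empty_or_nonempty with rfl | hA
  · simp [atMax]
  · rw [atMax_of_nonempty _ hA, atMax_of_nonempty _ (hA.map)]
    congr 1
    refine le_antisymm (max'_le _ _ _ fun x hx => ?_) (le_max' _ _ ?_)
    · obtain ⟨i, hi, rfl⟩ := mem_map.1 hx
      rcases (A.le_max' i hi).lt_or_eq with h | h
      · exact (hσ i hi _ (A.max'_mem hA) h).le
      · exact le_of_eq (congrArg σ h)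
    · exact mem_map_of_mem _ (A.max'_mem hA)

/-- The subsets of the first `k` levels. -/
def initialSets (M k : ℕ) : Finset (Finset (Fin M)) :=
  (univ.filter fun i : Fin M => (i : ℕ) < k).powerset

lemma mem_initialSets {k : ℕ} {A : Finset (Fin M)} :
    A ∈ initialSets M k ↔ ∀ i ∈ A, (i : ℕ) < k := by
  simp [initialSets, Finset.subset_iff]

lemma card_filter_lt {k : ℕ} (hk : k ≤ M) :
    (univ.filter fun i : Fin M => (i : ℕ) < k).card = k := by
  have : (univ.filter fun i : Fin M => (i : ℕ) < k) = univ.map (Fin.castLEEmb hk) := by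
    ext i
    simp only [mem_filter, Finset.mem_univ, true_and, mem_map, Fin.castLEEmb_apply]
    constructor
    · intro h; exact ⟨⟨i, h⟩, rfl⟩
    · rintro ⟨j, rfl⟩; exact j.2
  rw [this, card_map, card_univ, Fintype.card_fin]

lemma card_initialSets {k : ℕ} (hk : k ≤ M) : (initialSets M k).card = 2 ^ k := by
  rw [initialSets, card_powerset, card_filter_lt hk]

/-- The Walsh expansion of a conditional expectation. -/
lemma condE_eq_sum_walsh {k : ℕ} (hk : k ≤ M) (f : Cube M → ℝ) :
    condE k f = ∑ A ∈ initialSets M k, dot (walsh 1 A) f • walsh 1 A := by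
  have key : ∀ s t : Cube M, ∑ A ∈ initialSets M k, walsh 1 A t * walsh 1 A s =
      if trunc k t = trunc k s then 2 ^ k else 0 := by
    intro s t
    -- Expanding the product of the factors 1 + t_i s_i gives the Walsh kernel; the product is 2^k
    -- if the first k signs agree and has a zero factor otherwise.
    have h1 : ∏ i ∈ univ.filter (fun i : Fin M => (i : ℕ) < k), (sgn (t i * s i) + 1) =
        ∑ A ∈ initialSets M k, walsh 1 A t * walsh 1 A s := by
      rw [prod_add_one]
      simp [initialSets, walsh, twist_one, prod_mul_distrib]
    rw [← h1]
    split_ifs with h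
    · rw [trunc_eq_trunc_iff] at h
      rw [prod_congr rfl (g := fun _ => (2 : ℝ)), prod_const, card_filter_lt hk]
      intro i hi
      rw [h i (by simpa using hi), sgn_mul, sgn_mul_self]
      norm_num
    · rw [trunc_eq_trunc_iff] at h
      push Not at h
      obtain ⟨i, hi, hne⟩ := h
      refine prod_eq_zero (i := i) (by simpa using hi) ?_
      rcases Int.units_eq_one_or (t i) with h1 | h1 <;>
        rcases Int.units_eq_one_or (s i) with h2 | h2 <;> simp_all
  funext s
  rw [condE_kernel hk, mul_expect, Finset.sum_apply]
  simp only [Pi.smul_apply, smul_eq_mul, dot_apply, expect_mul]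
  rw [← expect_sum_comm]
  refine expect_congr rfl fun t _ => ?_
  have := key s t
  calc _ = (if trunc k t = trunc k s then 2 ^ k else 0) * f t := by split_ifs <;> simp
    _ = _ := by rw [← this, sum_mul]; exact sum_congr rfl fun A _ => by ring

lemma walsh_one_twistPerm (θ : Fin M × Cube M → ℤˣ) (σ : Equiv.Perm (Fin M))
    (A : Finset (Fin M)) (s : Cube M) :
    walsh 1 A (twistPerm θ σ s) = walsh θ (A.map σ.toEmbedding) s := by
  simp [walsh, twist_one, twistPerm_apply]

/-! ### Embedding and projection attached to a twisted copy. -/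

/-- Composition with the twisted permutation. -/
def pull (θ : Fin M × Cube M → ℤˣ) (σ : Equiv.Perm (Fin M)) :
    (Cube M → ℝ) →ₗ[ℝ] (Cube M → ℝ) := LinearMap.funLeft ℝ ℝ (twistPerm θ σ)

/-- The inverse of `pull`, followed by a conditional expectation. -/
def push (θ : Fin M × Cube M → ℤˣ) (σ : Equiv.Perm (Fin M)) (k : ℕ) :
    (Cube M → ℝ) →ₗ[ℝ] (Cube M → ℝ) :=
  condE k ∘ₗ LinearMap.funLeft ℝ ℝ (twistPerm θ σ).symm

section

variable (θ : Fin M × Cube M → ℤˣ) (σ : Equiv.Perm (Fin M))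

lemma pull_apply (f : Cube M → ℝ) (s : Cube M) : pull θ σ f s = f (twistPerm θ σ s) := rfl

lemma push_apply (k : ℕ) (f : Cube M → ℝ) :
    push θ σ k f = condE k (fun s => f ((twistPerm θ σ).symm s)) := rfl

lemma push_pull (k : ℕ) (f : Cube M → ℝ) : push θ σ k (pull θ σ f) = condE k f := by
  rw [push_apply]
  congr 1
  funext s
  simp [pull_apply]

lemma pull_walsh (A : Finset (Fin M)) :
    pull θ σ (walsh 1 A) = walsh θ (A.map σ.toEmbedding) := by
  funext s; exact walsh_one_twistPerm θ σ A s

variable {k : ℕ}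

/-- By measure invariance, the Walsh coefficients of `push` are pairings with twisted Walsh
functions. Thus the matrix of the compression has entries `dot (walsh θ (σ A)) (T (walsh θ (σ B)))`.
-/
lemma push_eq_sum (hk : k ≤ M) (g : Cube M → ℝ) :
    push θ σ k g =
      ∑ A ∈ initialSets M k, dot (walsh θ (A.map σ.toEmbedding)) g • walsh 1 A := by
  rw [push_apply, condE_eq_sum_walsh hk]
  refine sum_congr rfl fun A _ => ?_
  congr 1
  rw [dot_apply, dot_apply, ← expect_equiv_self (twistPerm θ σ)]
  simp [walsh_one_twistPerm]

variable (hσ : ∀ i j : Fin M, i < j → (j : ℕ) < k → σ i < σ j)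
include hσ

lemma atMax_map_initial (γ : Fin M → ℝ) {A : Finset (Fin M)} (hA : A ∈ initialSets M k) :
    atMax γ (A.map σ.toEmbedding) = atMax (fun i => γ (σ i)) A :=
  atMax_map γ σ fun i _ j hj hij => hσ i j hij (mem_initialSets.1 hA j hj)

/-- Both sides are diagonal on Walsh functions, and the eigenvalues agree because σ, being
increasing on the first `k` levels, maps the maximum of a set to the maximum of its image. The norm
for the independent family needs exactly this. -/
lemma levelMul_pull (hk : k ≤ M) (γ : Fin M → ℝ) {f : Cube M → ℝ} (hf : condE k f = f) :
    levelMul γ (pull θ σ f) = pull θ σ (levelMul (fun i => γ (σ i)) f) := by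
  rw [← hf, condE_eq_sum_walsh hk]
  simp only [map_sum, map_smul, pull_walsh, levelMul_walsh]
  exact sum_congr rfl fun A hA => by rw [atMax_map_initial σ hσ γ hA]

lemma levelMul_push (hk : k ≤ M) (γ : Fin M → ℝ) (g : Cube M → ℝ) :
    levelMul (fun i => γ (σ i)) (push θ σ k g) = push θ σ k (levelMul γ g) := by
  rw [push_eq_sum _ _ hk, push_eq_sum _ _ hk]
  simp only [map_sum, map_smul, levelMul_walsh]
  refine sum_congr rfl fun A hA => ?_
  rw [← dot_levelMul, levelMul_walsh, atMax_map_initial σ hσ γ hA, map_smul,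
    LinearMap.smul_apply, smul_smul, smul_eq_mul, mul_comm]

end

end Twist

section CubeNorm

variable {M : ℕ}

/-! ### Hardy norms on the cube -/

/-- The function `∑ p, η p • haarC k p` with signs `η`. -/
def signedLevel (k : Fin M) (η : Cube M → ℤˣ) : Cube M → ℝ :=
  fun s => sgn (η (trunc k s)) * sgn (s k)

lemma signedLevel_eq_sum (k : Fin M) (η : Cube M → ℤˣ) :
    signedLevel k η = ∑ p, sgn (η p) • haarC k p := by
  funext s
  simp [signedLevel, haarC]

lemma abs_signedLevel (k : Fin M) (η : Cube M → ℤˣ) (s : Cube M) : |signedLevel k η s| = 1 := by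
  simp [signedLevel, abs_mul]

lemma mdiff_of_level {l : Fin M} {f : Cube M → ℝ}
    (h1 : ∀ s t : Cube M, trunc (l + 1) s = trunc (l + 1) t → f s = f t)
    (h2 : ∀ s, f (s * flip l) = -f s) (j : ℕ) : mdiff j f = if j = l then f else 0 := by
  have ha : ∀ i : ℕ, (l : ℕ) < i → condE i f = f := fun i hi =>
    condE_eq_self fun s t => h1 _ _ (trunc_mul_tail (by omega) s t)
  have hb : ∀ i : ℕ, i ≤ l → condE i f = 0 := fun i hi => condE_eq_zero_of_flip hi h2
  rw [mdiff_apply]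
  rcases lt_trichotomy j l with h | h | h
  · rw [hb _ h, hb _ h.le, if_neg h.ne, sub_zero]
  · rw [ha _ (by omega), hb _ h.le, if_pos h, sub_zero]
  · rw [ha _ (by omega), ha _ h, if_neg h.ne', sub_self]

lemma levelMul_of_level {l : Fin M} {f : Cube M → ℝ}
    (h : ∀ j : ℕ, mdiff j f = if j = l then f else 0) (γ : Fin M → ℝ) :
    levelMul γ f = γ l • f := by
  rw [levelMul_apply, sum_eq_single l]
  · simp [h]
  · intro k _ hk
    rw [h, if_neg (fun h => hk (Fin.ext h)), smul_zero]
  · simp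

lemma mdiff_haarC (l : Fin M) (p : Cube M) (j : ℕ) :
    mdiff j (haarC l p) = if j = l then haarC l p else 0 := by
  refine mdiff_of_level (fun s t h => ?_) (fun s => ?_) j
  · simp only [haarC]
    rw [trunc_eq_of_le (Nat.le_succ _) h, trunc_eq_trunc_iff.1 h l (Nat.lt_succ_self _)]
  · simp only [haarC, trunc_mul, trunc_flip (show (l : ℕ) ≤ l from le_rfl), mul_one, Pi.mul_apply,
      flip_same]
    split_ifs <;> simp

lemma mdiff_signedLevel (l : Fin M) (η : Cube M → ℤˣ) (j : ℕ) :
    mdiff j (signedLevel l η) = if j = l then signedLevel l η else 0 := by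
  rw [signedLevel_eq_sum]
  simp only [map_sum, map_smul, mdiff_haarC]
  split_ifs <;> simp

/-- The properties of the norm of a Haar system space on step functions. -/
structure IsCubeNorm (ρ : Seminorm ℝ (Cube M → ℝ)) : Prop where
  perm : ∀ (π : Equiv.Perm (Cube M)) (f : Cube M → ℝ), ρ (fun s => f (π s)) = ρ f
  mono : ∀ f g : Cube M → ℝ, (∀ s, |f s| ≤ |g s|) → ρ f ≤ ρ g
  one : ρ 1 = 1

/-- The properties of the norm of a Haar system Hardy space that the factorization uses. -/
structure IsHardyNorm (ν : Seminorm ℝ (Cube M → ℝ)) : Prop where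
  pull_le : ∀ (θ : Fin M × Cube M → ℤˣ) (σ : Equiv.Perm (Fin M)) (k : ℕ), k ≤ M →
    (∀ i j : Fin M, i < j → (j : ℕ) < k → σ i < σ j) → ∀ f, condE k f = f →
      ν (pull θ σ f) ≤ ν f
  push_le : ∀ (θ : Fin M × Cube M → ℤˣ) (σ : Equiv.Perm (Fin M)) (k : ℕ), k ≤ M →
    (∀ i j : Fin M, i < j → (j : ℕ) < k → σ i < σ j) → ∀ f, ν (push θ σ k f) ≤ ν f
  condE_le : ∀ (k : ℕ) (f : Cube M → ℝ), ν (condE k f) ≤ ν f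
  signedLevel_le : ∀ (k : Fin M) (η : Cube M → ℤˣ), ν (signedLevel k η) ≤ 1
  dot_signedLevel_le : ∀ (k : Fin M) (η : Cube M → ℤˣ) (f : Cube M → ℝ),
    |dot (signedLevel k η) f| ≤ ν f
  -- Here `φ` bounds the norms of Haar functions of level at least `k`, and 2^(-k)/φ bounds their
  -- dual norms. The product of the two bounds is 2^(-k), whatever the space is.
  haarC_le : ∀ k : Fin M, ∃ φ : ℝ, 0 < φ ∧ ∀ (l : Fin M) (p : Cube M), k ≤ l →
    ν (haarC l p) ≤ φ ∧ ∀ f : Cube M → ℝ, φ * |dot (haarC l p) f| ≤ 1 / 2 ^ (k : ℕ) * ν f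

namespace IsCubeNorm

variable {ρ : Seminorm ℝ (Cube M → ℝ)} (hρ : IsCubeNorm ρ)
include hρ

/-- A conditional expectation is an average of rearrangements of `f`, each of which has the norm of
`f`. -/
lemma condE_le (k : ℕ) (f : Cube M → ℝ) : ρ (condE k f) ≤ ρ f := by
  refine (seminorm_expect_le ρ (fun t s => f (s * tail k t))).trans ?_
  refine expect_le univ_nonempty fun t _ => (hρ.perm (Equiv.mulRight (tail k t)) f).le

lemma eq_of_abs_eq {f g : Cube M → ℝ} (h : ∀ s, |f s| = |g s|) : ρ f = ρ g :=
  le_antisymm (hρ.mono _ _ fun s => (h s).le) (hρ.mono _ _ fun s => (h s).ge)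

/-- The average of `w * f` is a constant function of value `dot w f`; averaging is contractive and
constants have their absolute value as norm. -/
lemma dot_le {w : Cube M → ℝ} (hw : ∀ s, |w s| ≤ 1) (f : Cube M → ℝ) : |dot w f| ≤ ρ f := by
  have h1 : condE 0 (w * f) = dot w f • (1 : Cube M → ℝ) := by
    funext s
    simp [condE_zero, dot_apply]
  calc |dot w f| = ρ (condE 0 (w * f)) := by
        rw [h1, map_smul_eq_mul, hρ.one, mul_one, Real.norm_eq_abs]
    _ ≤ ρ (w * f) := hρ.condE_le 0 _
    _ ≤ ρ f := hρ.mono _ _ fun s => by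
        rw [Pi.mul_apply, abs_mul]
        exact mul_le_of_le_one_left (abs_nonneg _) (hw s)

lemma signedLevel_eq (k : Fin M) (η : Cube M → ℤˣ) : ρ (signedLevel k η) = 1 := by
  rw [← hρ.one]
  exact hρ.eq_of_abs_eq fun s => by rw [abs_signedLevel]; simp

lemma cell_eq (k : ℕ) (p : Cube M) :
    ρ (fun s => if trunc k s = trunc k p then 1 else 0) =
      ρ (fun s => if trunc k s = 1 then 1 else 0) := by
  rw [← hρ.perm (Equiv.mulRight p) (fun s => if trunc k s = 1 then 1 else 0)]
  congr 1
  funext s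
  have : trunc k s * trunc k p = 1 ↔ trunc k s = trunc k p := by
    rw [← mul_left_inj (trunc k p), mul_assoc, units_mul_self_cube, one_mul, mul_one]
  simp [trunc_mul, this]

lemma cell_pos (k : Fin M) : 0 < ρ (fun s => if trunc k s = 1 then 1 else 0) := by
  have h := hρ.dot_le (w := 1) (by simp) (fun s => if trunc k s = 1 then 1 else 0)
  rw [dot_apply] at h
  simp only [Pi.one_apply, one_mul] at h
  rw [expect_trunc_eq_one k.2.le, abs_of_pos (by positivity)] at h
  exact lt_of_lt_of_le (by positivity) h

lemma haarC_le {k l : Fin M} (h : k ≤ l) (p : Cube M) :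
    ρ (haarC l p) ≤ ρ (fun s => if trunc k s = 1 then 1 else 0) := by
  rw [← hρ.cell_eq k p]
  refine hρ.mono _ _ fun s => ?_
  simp only [haarC]
  by_cases hs : trunc l s = p
  · have : trunc k s = trunc k p := by rw [← hs, trunc_trunc h]
    simp [hs, this]
  · rw [if_neg hs, abs_zero]
    exact abs_nonneg _

/-- Averaging `haarC l p * f` over cells of level `k` gives a multiple of a cell indicator with
factor 2^k times the pairing, and neither operation increases the norm. -/
lemma cell_mul_dot_haarC_le {k l : Fin M} (h : k ≤ l) (p : Cube M) (f : Cube M → ℝ) :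
    ρ (fun s => if trunc k s = 1 then 1 else 0) * |dot (haarC l p) f| ≤
      1 / 2 ^ (k : ℕ) * ρ f := by
  have h1 : condE k (haarC l p * f) =
      (2 ^ (k : ℕ) * dot (haarC l p) f) •
        (fun s => if trunc k s = trunc k p then (1 : ℝ) else 0) := by
    funext s
    rw [condE_kernel k.2.le]
    simp only [Pi.smul_apply, smul_eq_mul, mul_assoc, dot_apply, expect_mul, Pi.mul_apply]
    congr 1
    refine expect_congr rfl fun t _ => ?_
    by_cases ht : trunc l t = p
    · have : trunc k t = trunc k p := by rw [← ht, trunc_trunc h]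
      simp [haarC, ht, this, eq_comm]
    · simp [haarC, ht]
  have h2 : ρ (condE k (haarC l p * f)) ≤ ρ f := by
    refine (hρ.condE_le k _).trans (hρ.mono _ _ fun s => ?_)
    rw [Pi.mul_apply, abs_mul]
    refine mul_le_of_le_one_left (abs_nonneg _) ?_
    simp only [haarC]
    split_ifs <;> simp
  rw [h1, map_smul_eq_mul, hρ.cell_eq, norm_mul, Real.norm_eq_abs, Real.norm_eq_abs,
    abs_of_pos (by positivity)] at h2
  rw [one_div_mul_eq_div, le_div_iff₀ (by positivity)]
  linarith

/-- The norm for the constant Rademacher family. -/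
lemma isHardyNorm : IsHardyNorm ρ where
  pull_le θ σ _ _ _ f _ := (hρ.perm (twistPerm θ σ) f).le
  push_le θ σ k _ _ f := (hρ.condE_le k _).trans (hρ.perm (twistPerm θ σ).symm f).le
  condE_le := hρ.condE_le
  signedLevel_le k η := (hρ.signedLevel_eq k η).le
  dot_signedLevel_le k η f := hρ.dot_le (fun s => (abs_signedLevel k η s).le) f
  haarC_le k := ⟨_, hρ.cell_pos k, fun _ p h =>
    ⟨hρ.haarC_le h p, hρ.cell_mul_dot_haarC_le h p⟩⟩

end IsCubeNorm

/-! ### The norm for the independent Rademacher family. -/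

lemma expect_sgn_mul_sgn {α : Type*} [Fintype α] [DecidableEq α] (k j : α) :
    𝔼 ε : α → ℤˣ, sgn (ε k) * sgn (ε j) = if j = k then 1 else 0 := by
  split_ifs with h
  · subst h; simp
  · refine expect_eq_zero_of_neg (Equiv.mulRight (Pi.mulSingle k (-1))) fun ε => ?_
    simp [h]

/-- The randomized absolute value of a function on the cube. -/
def randAbs (f : Cube M → ℝ) (s : Cube M) : ℝ :=
  𝔼 ε : Cube M, |levelMul (fun k => sgn (ε k)) f s|

lemma randAbs_nonneg (f : Cube M → ℝ) (s : Cube M) : 0 ≤ randAbs f s :=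
  expect_nonneg fun _ _ => abs_nonneg _

lemma randAbs_add_le (f g : Cube M → ℝ) (s : Cube M) :
    randAbs (f + g) s ≤ randAbs f s + randAbs g s := by
  simp only [randAbs, ← expect_add_distrib, map_add, Pi.add_apply]
  exact expect_le_expect fun ε _ => abs_add_le _ _

lemma randAbs_smul (c : ℝ) (f : Cube M → ℝ) : randAbs (c • f) = |c| • randAbs f := by
  funext s
  simp [randAbs, abs_mul, mul_expect]

namespace IsCubeNorm

variable {ρ : Seminorm ℝ (Cube M → ℝ)} (hρ : IsCubeNorm ρ)

/-- The norm for the independent Rademacher family. -/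
def randNorm : Seminorm ℝ (Cube M → ℝ) :=
  Seminorm.of (fun f => ρ (randAbs f))
    (fun f g => (hρ.mono _ (randAbs f + randAbs g) fun s => by
      rw [abs_of_nonneg (randAbs_nonneg _ _), Pi.add_apply,
        abs_of_nonneg (add_nonneg (randAbs_nonneg _ _) (randAbs_nonneg _ _))]
      exact randAbs_add_le f g s).trans (map_add_le_add ρ _ _))
    (fun c f => by rw [randAbs_smul, map_smul_eq_mul]; simp)

lemma randNorm_apply (f : Cube M → ℝ) : hρ.randNorm f = ρ (randAbs f) := rfl

/-- On one level the random sign is a global factor, so the randomized absolute value is just the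
absolute value. -/
lemma randNorm_of_level {l : Fin M} {f : Cube M → ℝ}
    (h : ∀ j : ℕ, mdiff j f = if j = l then f else 0) : hρ.randNorm f = ρ f := by
  rw [randNorm_apply]
  refine hρ.eq_of_abs_eq fun s => ?_
  simp [randAbs, levelMul_of_level h, abs_mul]

lemma expect_sgn_mul_levelMul (k : Fin M) (f : Cube M → ℝ) (s : Cube M) :
    𝔼 ε : Cube M, sgn (ε k) * levelMul (fun j => sgn (ε j)) f s = mdiff k f s := by
  simp only [levelMul_apply, Finset.sum_apply, Pi.smul_apply, smul_eq_mul, mul_sum, ← mul_assoc]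
  rw [expect_sum_comm]
  simp only [← expect_mul, expect_sgn_mul_sgn]
  simp

/-- A martingale difference is the correlation of the randomized function with one of its signs, so
it is dominated pointwise by the average of the absolute values. -/
lemma mdiff_le_randNorm (k : Fin M) (f : Cube M → ℝ) : ρ (mdiff k f) ≤ hρ.randNorm f := by
  rw [randNorm_apply]
  refine hρ.mono _ _ fun s => ?_
  rw [abs_of_nonneg (randAbs_nonneg _ _), ← expect_sgn_mul_levelMul]
  refine (abs_expect_le _ _).trans (le_of_eq ?_)
  simp [randAbs, abs_mul]

lemma dot_of_level {l : Fin M} {w : Cube M → ℝ}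
    (h : ∀ j : ℕ, mdiff j w = if j = l then w else 0) (f : Cube M → ℝ) :
    dot w f = dot w (mdiff l f) := by
  rw [← dot_mdiff, h, if_pos rfl]

/-- If level multipliers pass through the map `f ↦ g` up to relabelling the levels, then the
triangle inequality inside the conditional expectation bounds `randAbs g` by a conditional
expectation of a rearrangement of `randAbs f`. Relabelling is harmless because the signs are
identically distributed. -/
lemma randAbs_comp_le (hρ : IsCubeNorm ρ) (f g : Cube M → ℝ) (σ : Equiv.Perm (Fin M))
    (π : Equiv.Perm (Cube M))
    (k : ℕ)
    (h : ∀ γ : Fin M → ℝ, levelMul (fun i => γ (σ i)) g =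
      condE k (fun s => levelMul γ f (π s))) :
    ρ (randAbs g) ≤ ρ (randAbs f) := by
  have h1 : ∀ s, |randAbs g s| ≤ |condE k (fun s => randAbs f (π s)) s| := by
    intro s
    have e1 : randAbs g s = 𝔼 ε : Cube M, |levelMul (fun i => sgn (ε (σ i))) g s| :=
      (expect_equiv_self (σ.symm.arrowCongr (Equiv.refl ℤˣ))
        (fun ε : Cube M => |levelMul (fun k => sgn (ε k)) g s|)).symm
    have e2 : condE k (fun s => randAbs f (π s)) s = 𝔼 ε : Cube M, 𝔼 t,
        |levelMul (fun k => sgn (ε k)) f (π (s * tail k t))| := by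
      simp only [condE_apply, randAbs]
      exact expect_comm _ _ _
    rw [abs_of_nonneg (randAbs_nonneg _ _)]
    refine le_trans ?_ (le_abs_self _)
    rw [e1, e2]
    refine expect_le_expect fun ε _ => ?_
    rw [h fun i => sgn (ε i)]
    exact abs_expect_le _ _
  exact (hρ.mono _ _ h1).trans ((hρ.condE_le k _).trans (hρ.perm π _).le)

lemma levelMul_condE (γ : Fin M → ℝ) (k : ℕ) (f : Cube M → ℝ) :
    levelMul γ (condE k f) = condE k (levelMul γ f) := by
  simp only [levelMul_apply, map_sum, map_smul, mdiff_apply, map_sub]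
  simp only [condE_comm _ k]

lemma isHardyNorm_randNorm : IsHardyNorm hρ.randNorm where
  pull_le θ σ k hk hσ f hf := by
    -- No conditional expectation is involved here: at level `M` it is the identity. The levels are
    -- relabelled by the inverse of σ.
    refine hρ.randAbs_comp_le _ _ σ.symm (twistPerm θ σ) M fun γ => ?_
    rw [condE_of_le le_rfl, levelMul_pull θ σ hσ hk _ hf]
    simp only [Equiv.symm_apply_apply]
    rfl
  push_le θ σ k hk hσ f :=
    hρ.randAbs_comp_le _ _ σ (twistPerm θ σ).symm k fun γ => levelMul_push θ σ hσ hk γ f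
  condE_le k f :=
    hρ.randAbs_comp_le _ _ 1 1 k fun γ => levelMul_condE γ k f
  signedLevel_le k η := by
    rw [randNorm_of_level hρ (mdiff_signedLevel k η), hρ.signedLevel_eq]
  dot_signedLevel_le k η f := by
    rw [dot_of_level (mdiff_signedLevel k η)]
    exact (hρ.dot_le (fun s => (abs_signedLevel k η s).le) _).trans (hρ.mdiff_le_randNorm k f)
  haarC_le k := ⟨_, hρ.cell_pos k, fun l p h => ⟨by
    rw [randNorm_of_level hρ (mdiff_haarC l p)]
    exact hρ.haarC_le h p, fun f => by
      rw [dot_of_level (mdiff_haarC l p)]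
      exact (hρ.cell_mul_dot_haarC_le h p _).trans
        (mul_le_mul_of_nonneg_left (hρ.mdiff_le_randNorm l f) (by positivity))⟩⟩

end IsCubeNorm

end CubeNorm

section SecondMoments

variable {M : ℕ}

/-! ### Second moments of random matrix entries -/

lemma expect_sq_sum {Θ ι : Type*} [Fintype Θ] [Fintype ι] (Z : ι → Θ → ℝ) (b : ι → ℝ) :
    𝔼 θ, (∑ q, b q * Z q θ) ^ 2 = ∑ q, ∑ q', b q * b q' * 𝔼 θ, Z q θ * Z q' θ := by
  simp only [sq, sum_mul_sum, expect_sum_comm, mul_expect]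
  refine sum_congr rfl fun q _ => sum_congr rfl fun q' _ => expect_congr rfl fun θ _ => ?_
  ring

lemma expect_sq_sum_sgn {ι : Type*} [Fintype ι] [DecidableEq ι] (b : ι → ℝ) :
    𝔼 η : ι → ℤˣ, (∑ q, sgn (η q) * b q) ^ 2 = ∑ q, b q ^ 2 := by
  have := expect_sq_sum (fun q (η : ι → ℤˣ) => sgn (η q)) b
  simp only [expect_sgn_mul_sgn] at this
  simp only [mul_comm (sgn _), this]
  simp [sq]

/-- A second moment estimate for variables that are orthogonal up to an involution. -/
lemma expect_sq_sum_le {Θ ι : Type*} [Fintype Θ] [Nonempty Θ] [Fintype ι] [DecidableEq ι]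
    (Z : ι → Θ → ℝ) (b : ι → ℝ) (τ : Equiv.Perm ι) (hZ : ∀ q θ, |Z q θ| ≤ 1)
    (horth : ∀ q q', q' ≠ q → q' ≠ τ q → 𝔼 θ, Z q θ * Z q' θ = 0) :
    𝔼 θ, (∑ q, b q * Z q θ) ^ 2 ≤ 2 * ∑ q, b q ^ 2 := by
  have h1 : ∀ q q', b q * b q' * 𝔼 θ, Z q θ * Z q' θ ≤
      (if q' = q then b q ^ 2 else 0) + if q' = τ q then (b q ^ 2 + b q' ^ 2) / 2 else 0 := by
    intro q q'
    have hE : |𝔼 θ, Z q θ * Z q' θ| ≤ 1 := abs_expect_le_of_forall fun θ => by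
      rw [abs_mul]; exact mul_le_one₀ (hZ _ _) (abs_nonneg _) (hZ _ _)
    have hb : b q * b q' * 𝔼 θ, Z q θ * Z q' θ ≤ |b q * b q'| := by
      refine (le_abs_self _).trans ?_
      rw [abs_mul]
      exact mul_le_of_le_one_right (abs_nonneg _) hE
    by_cases h : q' = q
    · subst h
      rw [if_pos rfl]
      refine hb.trans ?_
      rw [abs_mul_self, ← sq]
      exact le_add_of_nonneg_right (by split_ifs <;> positivity)
    · rw [if_neg h, zero_add]
      by_cases h' : q' = τ q
      · rw [if_pos h']
        refine hb.trans ?_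
        rw [abs_mul, ← sq_abs (b q), ← sq_abs (b q')]
        nlinarith [sq_nonneg (|b q| - |b q'|)]
      · rw [if_neg h', horth q q' h h', mul_zero]
  rw [expect_sq_sum]
  calc _ ≤ ∑ q, ∑ q', ((if q' = q then b q ^ 2 else 0) +
        if q' = τ q then (b q ^ 2 + b q' ^ 2) / 2 else 0) :=
        sum_le_sum fun q _ => sum_le_sum fun q' _ => h1 q q'
    _ = ∑ q, (b q ^ 2 + (b q ^ 2 + b (τ q) ^ 2) / 2) := by
        simp [sum_add_distrib]
    _ = _ := by
        rw [sum_add_distrib, ← sum_div, sum_add_distrib, Equiv.sum_comp τ fun q => b q ^ 2]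
        ring

/-- Only the top factor varies within a cell of level `a`, so a twisted Walsh function is a signed
sum of Haar functions of that level. This turns its matrix entries into random sums of Haar matrix
entries. -/
lemma walsh_eq_sum (θ : Fin M × Cube M → ℤˣ) {A : Finset (Fin M)} {a : Fin M} (ha : a ∈ A)
    (hlt : ∀ i ∈ A.erase a, i < a) :
    walsh θ A = ∑ p, (sgn (θ (a, p)) * walsh θ (A.erase a) p) • haarC a p := by
  funext s
  simp only [Finset.sum_apply, Pi.smul_apply, smul_eq_mul, haarC, mul_ite, mul_zero]
  rw [Finset.sum_ite_eq, if_pos (Finset.mem_univ _),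
    walsh_congr θ (k := a) (t := s) hlt (trunc_trunc le_rfl s),
    walsh, ← mul_prod_erase A _ ha, walsh]
  simp only [twist, sgn_mul]
  ring

/-- Change the sign of `θ x`. -/
def flipAt (x : Fin M × Cube M) : Equiv.Perm (Fin M × Cube M → ℤˣ) :=
  Equiv.mulRight (Pi.mulSingle x (-1))

lemma flipAt_same (x : Fin M × Cube M) (θ : Fin M × Cube M → ℤˣ) : flipAt x θ x = -θ x := by
  simp [flipAt]

lemma flipAt_of_ne {x y : Fin M × Cube M} (h : y ≠ x) (θ : Fin M × Cube M → ℤˣ) :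
    flipAt x θ y = θ y := by
  simp [flipAt, h]

lemma walsh_flipAt_of_ne {x : Fin M × Cube M} {A : Finset (Fin M)} {p : Cube M}
    (h : ∀ i ∈ A, (i, trunc i p) ≠ x) (θ : Fin M × Cube M → ℤˣ) :
    walsh (flipAt x θ) A p = walsh θ A p :=
  prod_congr rfl fun i hi => by simp only [twist]; rw [flipAt_of_ne (h i hi)]

lemma walsh_flipAt_same {j : Fin M} {A : Finset (Fin M)} (hj : j ∈ A) (p : Cube M)
    (θ : Fin M × Cube M → ℤˣ) :
    walsh (flipAt (j, trunc j p) θ) A p = -walsh θ A p := by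
  have h := @walsh_flipAt_of_ne M (j, trunc j p) (A.erase j) p
    (fun i hi h => (mem_erase.1 hi).1 (congrArg Prod.fst h)) θ
  simp only [walsh] at h ⊢
  rw [← mul_prod_erase A _ hj, h, ← mul_prod_erase A _ hj]
  simp only [twist, flipAt_same]
  simp

/-- The coefficient of `haarC a p` in a twisted Walsh function with top level `a`. -/
def walshCoeff (A : Finset (Fin M)) (a : Fin M) (p : Cube M) (θ : Fin M × Cube M → ℤˣ) : ℝ :=
  sgn (θ (a, p)) * walsh θ (A.erase a) p

section

variable {A B : Finset (Fin M)} {a b : Fin M}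

lemma abs_walshCoeff (p : Cube M) (θ : Fin M × Cube M → ℤˣ) : |walshCoeff A a p θ| = 1 := by
  simp [walshCoeff, abs_mul, abs_walsh]

lemma walshCoeff_mul_self (p : Cube M) (θ : Fin M × Cube M → ℤˣ) :
    walshCoeff A a p θ * walshCoeff A a p θ = 1 := by
  rw [← abs_mul_abs_self, abs_walshCoeff, one_mul]

lemma walshCoeff_flipAt_same (hlt : ∀ i ∈ A.erase a, i < a) (p : Cube M)
    (θ : Fin M × Cube M → ℤˣ) :
    walshCoeff A a p (flipAt (a, p) θ) = -walshCoeff A a p θ := by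
  rw [walshCoeff, flipAt_same, walsh_flipAt_of_ne, walshCoeff]
  · simp
  · intro i hi h
    exact (hlt i hi).ne (congrArg Prod.fst h)

lemma walshCoeff_flipAt_of_ne (hlt : ∀ i ∈ A.erase a, i < a) {x : Fin M × Cube M} {p : Cube M}
    (h1 : a ≤ x.1) (h2 : (a, p) ≠ x) (θ : Fin M × Cube M → ℤˣ) :
    walshCoeff A a p (flipAt x θ) = walshCoeff A a p θ := by
  rw [walshCoeff, flipAt_of_ne h2, walsh_flipAt_of_ne, walshCoeff]
  intro i hi h
  have := hlt i hi
  rw [← h] at h1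
  exact absurd h1 (not_le.2 this)

variable (hA : ∀ i ∈ A.erase a, i < a) (hB : ∀ i ∈ B.erase b, i < b)
include hA

lemma expect_walshCoeff_mul_of_ne {p p' : Cube M} (h : p' ≠ p) :
    𝔼 θ, walshCoeff A a p θ * walshCoeff A a p' θ = 0 := by
  refine expect_eq_zero_of_neg (flipAt (a, p)) fun θ => ?_
  rw [walshCoeff_flipAt_same hA, walshCoeff_flipAt_of_ne hA le_rfl (by simpa using h)]
  ring

include hB

/-- If the level-`b` cells differ, the sign `θ (b, q)` occurs exactly once, since the level-`a`
coefficients see no signs above `a`. If they coincide, the `B` factors square to 1 and the sign `θ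
(a, p)` occurs once. -/
lemma expect_walshCoeff_of_lt (hab : a < b) {p p' q q' : Cube M} (h : (p', q') ≠ (p, q)) :
    𝔼 θ, (walshCoeff A a p θ * walshCoeff B b q θ) *
      (walshCoeff A a p' θ * walshCoeff B b q' θ) = 0 := by
  by_cases hq : q' = q
  · subst hq
    rw [← expect_walshCoeff_mul_of_ne hA (p := p) (p' := p') (fun hp => h (by rw [hp]))]
    refine expect_congr rfl fun θ _ => ?_
    linear_combination walshCoeff A a p θ * walshCoeff A a p' θ *
      walshCoeff_mul_self (A := B) (a := b) q' θ
  · refine expect_eq_zero_of_neg (flipAt (b, q)) fun θ => ?_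
    rw [walshCoeff_flipAt_same hB, walshCoeff_flipAt_of_ne hB le_rfl (by simpa using hq),
      walshCoeff_flipAt_of_ne hA hab.le (fun h => hab.ne (congrArg Prod.fst h)),
      walshCoeff_flipAt_of_ne hA hab.le (fun h => hab.ne (congrArg Prod.fst h))]
    ring

/-- One of `p`, `q` is not in {`p'`, `q'`}, and its sign on level `a` then occurs exactly once. The
transposed pair has to be excluded; it is the reason for an involution in `expect_sq_sum_le`. -/
lemma expect_walshCoeff_of_eq (hab : a = b) {p p' q q' : Cube M} (hpq : p ≠ q)
    (h1 : (p', q') ≠ (p, q)) (h2 : (p', q') ≠ (q, p)) (hpq' : p' ≠ q') :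
    𝔼 θ, (walshCoeff A a p θ * walshCoeff B b q θ) *
      (walshCoeff A a p' θ * walshCoeff B b q' θ) = 0 := by
  subst hab
  by_cases hp : p = p' ∨ p = q'
  · have hq1 : q ≠ p' := by
      rintro rfl
      rcases hp with rfl | rfl
      · exact hpq rfl
      · exact h2 rfl
    have hq2 : q ≠ q' := by
      rintro rfl
      rcases hp with rfl | rfl
      · exact h1 rfl
      · exact hpq rfl
    refine expect_eq_zero_of_neg (flipAt (a, q)) fun θ => ?_
    rw [walshCoeff_flipAt_same hB, walshCoeff_flipAt_of_ne hB le_rfl (by simpa using hq2.symm),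
      walshCoeff_flipAt_of_ne hA le_rfl (by simpa using hpq),
      walshCoeff_flipAt_of_ne hA le_rfl (by simpa using hq1.symm)]
    ring
  · push Not at hp
    refine expect_eq_zero_of_neg (flipAt (a, p)) fun θ => ?_
    rw [walshCoeff_flipAt_same hA, walshCoeff_flipAt_of_ne hB le_rfl (by simpa using hpq.symm),
      walshCoeff_flipAt_of_ne hA le_rfl (by simpa using hp.1.symm),
      walshCoeff_flipAt_of_ne hB le_rfl (by simpa using hp.2.symm)]
    ring

end

/-- Diagonal coefficients with different Walsh sets are orthogonal on different cells. -/
lemma expect_walsh_diag {A B : Finset (Fin M)} {j : Fin M} (hjA : j ∈ A) (hjB : j ∉ B)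
    {p p' : Cube M} (h : trunc j p' ≠ trunc j p) :
    𝔼 θ, (walsh θ A p * walsh θ B p) * (walsh θ A p' * walsh θ B p') = 0 := by
  refine expect_eq_zero_of_neg (flipAt (j, trunc j p)) fun θ => ?_
  have hB : ∀ s : Cube M, walsh (flipAt (j, trunc j p) θ) B s = walsh θ B s := fun s =>
    walsh_flipAt_of_ne (x := (j, trunc j p)) (p := s) (fun i hi hx => by
      obtain ⟨rfl, _⟩ := Prod.mk.inj hx
      exact hjB hi) θ
  have hA : walsh (flipAt (j, trunc j p) θ) A p' = walsh θ A p' := by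
    refine walsh_flipAt_of_ne (fun i _ hx => ?_) θ
    obtain ⟨rfl, h2⟩ := Prod.mk.inj hx
    exact h h2
  rw [walsh_flipAt_same hjA, hB, hB, hA]
  ring

/-! ### Matrix entries of an operator on twisted Walsh functions. -/

section Operator

variable {ν : Seminorm ℝ (Cube M → ℝ)} (hν : IsHardyNorm ν)
  {T : (Cube M → ℝ) →ₗ[ℝ] (Cube M → ℝ)} {Γ : ℝ} (hΓ : 0 ≤ Γ)
  (hT : ∀ f, condE 0 f = 0 → ν (T f) ≤ Γ * ν f)

lemma condE_zero_haarC (k : Fin M) (p : Cube M) : condE 0 (haarC k p) = 0 := by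
  refine condE_eq_zero_of_flip (m := k) (Nat.zero_le _) fun s => ?_
  simp only [haarC, trunc_mul, trunc_flip (show (k : ℕ) ≤ k from le_rfl), mul_one, Pi.mul_apply,
    flip_same]
  split_ifs <;> simp

lemma condE_zero_signedLevel (k : Fin M) (η : Cube M → ℤˣ) : condE 0 (signedLevel k η) = 0 := by
  simp [signedLevel_eq_sum, condE_zero_haarC]

/-- The sum of the diagonal matrix entries of level `k`. -/
def levelTrace (T : (Cube M → ℝ) →ₗ[ℝ] (Cube M → ℝ)) (k : Fin M) : ℝ :=
  ∑ p, dot (haarC k p) (T (haarC k p))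

include hν in
-- Choosing the signs of a signed level to match those of the pairings turns the sum of absolute
-- values into one pairing.
lemma sum_abs_dot_haarC_le (k : Fin M) (f : Cube M → ℝ) : ∑ p, |dot (haarC k p) f| ≤ ν f := by
  choose η hη using fun p => exists_sgn_mul_eq_abs (dot (haarC k p) f)
  refine le_trans (le_of_eq ?_) ((le_abs_self _).trans (hν.dot_signedLevel_le k η f))
  simp [signedLevel_eq_sum, hη]

include hν hΓ hT

/-- Averaging over signs reduces the Hilbert-Schmidt sum to the squared ℓ² norm of one vector,
bounded by its ℓ^∞ norm times its ℓ¹ norm. The ℓ¹ norm is at most Γ. The ℓ^∞ norm is at most Γ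
2^(-k₀/2) when the averaging is over rows or over columns, according to the size of the cell norm φ.
-/
lemma sum_sq_matrix_le {k₀ k l : Fin M} (hk : k₀ ≤ k) (hl : k₀ ≤ l) :
    ∑ x : Cube M × Cube M, dot (haarC k x.1) (T (haarC l x.2)) ^ 2 ≤
      Γ ^ 2 * √(1 / 2 ^ (k₀ : ℕ)) := by
  obtain ⟨φ, hφ, h⟩ := hν.haarC_le k₀
  have hTs : ∀ l η, ν (T (signedLevel l η)) ≤ Γ := fun l η =>
    (hT _ (condE_zero_signedLevel l η)).trans
      (mul_le_of_le_one_right hΓ (hν.signedLevel_le l η))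
  have sq_sum_le : ∀ (c : ℝ) (x : Cube M → ℝ), (∀ p, |x p| ≤ c * Γ) → ∑ p, |x p| ≤ Γ → 0 ≤ c →
      ∑ p, x p ^ 2 ≤ Γ ^ 2 * c := by
    intro c x h1 h2 hc
    calc ∑ p, x p ^ 2 ≤ ∑ p, c * Γ * |x p| := sum_le_sum fun p _ => by
          rw [← sq_abs, sq]
          exact mul_le_mul_of_nonneg_right (h1 p) (abs_nonneg _)
      _ = c * Γ * ∑ p, |x p| := by rw [mul_sum]
      _ ≤ c * Γ * Γ := mul_le_mul_of_nonneg_left h2 (mul_nonneg hc hΓ)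
      _ = _ := by ring
  set t : ℝ := √(1 / 2 ^ (k₀ : ℕ)) with ht
  have ht2 : t * t = 1 / 2 ^ (k₀ : ℕ) := Real.mul_self_sqrt (by positivity)
  have ht0 : 0 < t := Real.sqrt_pos.2 (by positivity)
  rw [Fintype.sum_prod_type]
  -- With t² = 2^(-k₀), either φ or the dual bound t²/φ is at most t.
  rcases le_total φ t with hφt | hφt
  · -- average over the signs of the rows
    rw [sum_comm]
    have h1 : ∀ η, ∑ q, dot (signedLevel k η) (T (haarC l q)) ^ 2 ≤ Γ ^ 2 * t := by
      intro η
      refine sq_sum_le t _ (fun q => ?_) ?_ ht0.le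
      · refine (hν.dot_signedLevel_le k η _).trans ((hT _ (condE_zero_haarC l q)).trans ?_)
        rw [mul_comm]
        exact mul_le_mul_of_nonneg_right (((h l q hl).1).trans hφt) hΓ
      · choose η' hη' using fun q => exists_sgn_mul_eq_abs (dot (signedLevel k η) (T (haarC l q)))
        have e : ∑ q, |dot (signedLevel k η) (T (haarC l q))| =
            dot (signedLevel k η) (T (signedLevel l η')) := by
          simp [signedLevel_eq_sum l, hη']
        rw [e]
        exact (le_abs_self _).trans ((hν.dot_signedLevel_le k η _).trans (hTs l η'))
    have h2 : ∑ q, ∑ p, dot (haarC k p) (T (haarC l q)) ^ 2 =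
        𝔼 η, ∑ q, dot (signedLevel k η) (T (haarC l q)) ^ 2 := by
      rw [expect_sum_comm]
      refine sum_congr rfl fun q _ => ?_
      rw [← expect_sq_sum_sgn]
      simp [signedLevel_eq_sum]
    rw [h2]
    exact expect_le univ_nonempty fun η _ => h1 η
  · -- average over the signs of the columns
    have h1 : ∀ η, ∑ p, dot (haarC k p) (T (signedLevel l η)) ^ 2 ≤ Γ ^ 2 * t := by
      intro η
      refine sq_sum_le t _ (fun p => ?_)
        ((sum_abs_dot_haarC_le hν k _).trans (hTs l η)) ht0.le
      have h3 := (h k p hk).2 (T (signedLevel l η))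
      rw [← ht2] at h3
      have h4 : t * |dot (haarC k p) (T (signedLevel l η))| ≤ t * t * Γ :=
        (mul_le_mul_of_nonneg_right hφt (abs_nonneg _)).trans
          (h3.trans (mul_le_mul_of_nonneg_left (hTs l η) (by positivity)))
      rw [mul_assoc] at h4
      exact le_of_mul_le_mul_left h4 ht0
    have h2 : ∑ p, ∑ q, dot (haarC k p) (T (haarC l q)) ^ 2 =
        𝔼 η, ∑ p, dot (haarC k p) (T (signedLevel l η)) ^ 2 := by
      rw [expect_sum_comm]
      refine sum_congr rfl fun p _ => ?_
      rw [← expect_sq_sum_sgn]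
      simp [signedLevel_eq_sum]
    rw [h2]
    exact expect_le univ_nonempty fun η _ => h1 η

/-- The average of the quadratic form over all signed sums of level `k` kills the off-diagonal
entries and leaves the trace. -/
lemma abs_levelTrace_le (k : Fin M) : |levelTrace T k| ≤ Γ := by
  have h : levelTrace T k = 𝔼 η, dot (signedLevel k η) (T (signedLevel k η)) := by
    have h1 : ∀ η : Cube M → ℤˣ, dot (signedLevel k η) (T (signedLevel k η)) =
        ∑ q, ∑ p, dot (haarC k p) (T (haarC k q)) * (sgn (η p) * sgn (η q)) := by
      intro η
      simp only [signedLevel_eq_sum, map_sum, map_smul, LinearMap.sum_apply, LinearMap.smul_apply,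
        smul_eq_mul, mul_sum]
      exact sum_congr rfl fun q _ => sum_congr rfl fun p _ => by ring
    simp only [h1, expect_sum_comm, ← mul_expect, expect_sgn_mul_sgn, levelTrace]
    simp
  rw [h]
  refine abs_expect_le_of_forall fun η => (hν.dot_signedLevel_le k η _).trans ?_
  exact (hT _ (condE_zero_signedLevel k η)).trans
    (mul_le_of_le_one_right hΓ (hν.signedLevel_le k η))

/-- The norm of a Haar function and its dual bound enter once each, so φ cancels. The right side is
the cell measure; if `p` is not a truncated vector, the Haar function is zero. -/
lemma abs_diag_le (k : Fin M) (p : Cube M) :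
    |dot (haarC k p) (T (haarC k p))| ≤ Γ * 𝔼 s : Cube M, if trunc k s = p then 1 else 0 := by
  by_cases hp : trunc k p = p
  · obtain ⟨φ, hφ, h⟩ := hν.haarC_le k
    have h1 := (h k p le_rfl).2 (T (haarC k p))
    have h2 : ν (T (haarC k p)) ≤ Γ * φ := (hT _ (condE_zero_haarC k p)).trans
      (mul_le_mul_of_nonneg_left (h k p le_rfl).1 hΓ)
    have h3 := expect_trunc_eq k.2.le p
    rw [hp] at h3
    rw [h3]
    refine le_of_mul_le_mul_left (h1.trans ?_) hφ
    calc _ ≤ 1 / 2 ^ (k : ℕ) * (Γ * φ) := mul_le_mul_of_nonneg_left h2 (by positivity)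
      _ = _ := by ring
  · have : haarC k p = 0 := by
      funext s
      simp only [haarC]
      rw [if_neg]
      · rfl
      · rintro rfl
        exact hp (trunc_trunc le_rfl s)
    rw [this]
    simp only [map_zero, abs_zero]
    exact mul_nonneg hΓ (expect_nonneg fun s _ => by split_ifs <;> norm_num)

/-- Terms in different cells of level `j` are orthogonal, by the random sign at level `j` that only
`A` sees. Each diagonal entry is at most Γ times a cell measure, so what remains is Γ² times the
probability that two independent points share a cell of level `j`. -/
lemma expect_sq_diag_le {A B : Finset (Fin M)} {j : Fin M} (hjA : j ∈ A) (hjB : j ∉ B)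
    (k : Fin M) (hjk : j ≤ k) :
    𝔼 θ, (∑ p, dot (haarC k p) (T (haarC k p)) * (walsh θ A p * walsh θ B p)) ^ 2 ≤
      Γ ^ 2 * (1 / 2 ^ (j : ℕ)) := by
  set μ : Cube M → ℝ := fun p => 𝔼 s : Cube M, if trunc k s = p then 1 else 0 with hμ
  have hd := abs_diag_le hν hΓ hT k
  have hμ0 : ∀ p, 0 ≤ μ p := fun p => expect_nonneg fun s _ => by split_ifs <;> norm_num
  rw [expect_sq_sum (fun p θ => walsh θ A p * walsh θ B p)]
  have h1 : ∀ p p', dot (haarC k p) (T (haarC k p)) * dot (haarC k p') (T (haarC k p')) *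
      𝔼 θ, (walsh θ A p * walsh θ B p) * (walsh θ A p' * walsh θ B p') ≤
      Γ ^ 2 * (μ p * (μ p' * if trunc j p' = trunc j p then 1 else 0)) := by
    intro p p'
    by_cases h : trunc j p' = trunc j p
    · rw [if_pos h, mul_one]
      refine (le_abs_self _).trans ?_
      rw [abs_mul, abs_mul]
      have : |𝔼 θ, (walsh θ A p * walsh θ B p) * (walsh θ A p' * walsh θ B p')| ≤ 1 :=
        abs_expect_le_of_forall fun θ => by simp [abs_mul, abs_walsh]
      calc _ ≤ |dot (haarC k p) (T (haarC k p))| * |dot (haarC k p') (T (haarC k p'))| :=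
            mul_le_of_le_one_right (by positivity) this
        _ ≤ (Γ * μ p) * (Γ * μ p') := mul_le_mul (hd p) (hd p') (abs_nonneg _)
            (mul_nonneg hΓ (hμ0 p))
        _ = _ := by ring
    · rw [expect_walsh_diag hjA hjB h, if_neg h]
      simp
  refine (sum_le_sum fun p _ => sum_le_sum fun p' _ => h1 p p').trans (le_of_eq ?_)
  have h2 : ∀ g : Cube M → ℝ, ∑ p, μ p * g p = 𝔼 s : Cube M, g (trunc k s) := by
    intro g
    simp only [hμ, expect_mul]
    rw [← expect_sum_comm]
    simp
  simp only [← mul_sum, h2]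
  congr 1
  simp only [trunc_trunc (show (j : ℕ) ≤ k from hjk), expect_trunc_eq j.2.le]
  simp

/-- For different top levels all terms are orthogonal. For equal ones the off-diagonal terms are
orthogonal up to transposition, while the diagonal part equals the trace if `A = B` and is otherwise
small by a level in the symmetric difference. The factor 6 is 2 · 2 + 2, from (x + y)² ≤ 2x² + 2y².
-/
lemma expect_sq_entry_le {k₀ : Fin M} {A B : Finset (Fin M)} (hA : A.Nonempty) (hB : B.Nonempty)
    (hkA : ∀ i ∈ A, k₀ ≤ i) (hkB : ∀ i ∈ B, k₀ ≤ i) :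
    𝔼 θ, (dot (walsh θ A) (T (walsh θ B)) - if A = B then atMax (levelTrace T) A else 0) ^ 2 ≤
      6 * (Γ ^ 2 * √(1 / 2 ^ (k₀ : ℕ))) := by
  set a := A.max' hA with ha
  set b := B.max' hB with hb
  have haA : a ∈ A := A.max'_mem hA
  have hbB : b ∈ B := B.max'_mem hB
  have hltA : ∀ i ∈ A.erase a, i < a := fun i hi => A.lt_max'_of_mem_erase_max' hA hi
  have hltB : ∀ i ∈ B.erase b, i < b := fun i hi => B.lt_max'_of_mem_erase_max' hB hi
  set β : Cube M × Cube M → ℝ := fun x => dot (haarC a x.1) (T (haarC b x.2)) with hβ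
  have hβsum : ∑ x, β x ^ 2 ≤ Γ ^ 2 * √(1 / 2 ^ (k₀ : ℕ)) :=
    sum_sq_matrix_le hν hΓ hT (hkA a haA) (hkB b hbB)
  have hC : 0 ≤ Γ ^ 2 * √(1 / 2 ^ (k₀ : ℕ)) := by positivity
  have hX : ∀ θ, dot (walsh θ A) (T (walsh θ B)) =
      ∑ x, β x * (walshCoeff A a x.1 θ * walshCoeff B b x.2 θ) := by
    intro θ
    rw [walsh_eq_sum θ haA hltA, walsh_eq_sum θ hbB hltB, Fintype.sum_prod_type]
    simp only [map_sum, map_smul, LinearMap.sum_apply, LinearMap.smul_apply, smul_eq_mul, mul_sum,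
      hβ, walshCoeff]
    rw [sum_comm]
    exact sum_congr rfl fun p _ => sum_congr rfl fun q _ => by ring
  have habs : ∀ (x : Cube M × Cube M) θ, |walshCoeff A a x.1 θ * walshCoeff B b x.2 θ| ≤ 1 :=
    fun x θ => by rw [abs_mul, abs_walshCoeff, abs_walshCoeff, one_mul]
  by_cases hab : a = b
  · -- equal top levels: split into diagonal and off-diagonal part
    set Z : Cube M × Cube M → (Fin M × Cube M → ℤˣ) → ℝ := fun x θ =>
      if x.1 = x.2 then 0 else walshCoeff A a x.1 θ * walshCoeff B b x.2 θ with hZ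
    have hoff : 𝔼 θ, (∑ x, β x * Z x θ) ^ 2 ≤ 2 * ∑ x, β x ^ 2 := by
      refine expect_sq_sum_le Z β (Equiv.prodComm _ _) (fun x θ => ?_) fun x x' h1 h2 => ?_
      · simp only [hZ]
        split_ifs
        · simp
        · exact habs x θ
      · simp only [hZ]
        by_cases hx : x.1 = x.2
        · simp [hx]
        by_cases hx' : x'.1 = x'.2
        · simp [hx']
        simp only [if_neg hx, if_neg hx']
        exact expect_walshCoeff_of_eq hltA hltB hab hx h1 h2 hx'
    set D : (Fin M × Cube M → ℤˣ) → ℝ := fun θ =>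
      ∑ p, dot (haarC a p) (T (haarC a p)) * (walsh θ (A.erase a) p * walsh θ (B.erase a) p)
      with hD
    have hsplit : ∀ θ, dot (walsh θ A) (T (walsh θ B)) = ∑ x, β x * Z x θ + D θ := by
      intro θ
      have h1 : D θ = ∑ x : Cube M × Cube M, if x.1 = x.2 then
          β x * (walshCoeff A a x.1 θ * walshCoeff B b x.2 θ) else 0 := by
        rw [Fintype.sum_prod_type]
        simp only [Finset.sum_ite_eq, Finset.mem_univ, if_true, hD, hβ, ← hab, walshCoeff]
        refine sum_congr rfl fun p _ => ?_
        linear_combination -(dot (haarC a p) (T (haarC a p)) *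
          (walsh θ (A.erase a) p * walsh θ (B.erase a) p)) * sgn_mul_self (θ (a, p))
      rw [hX, h1, ← sum_add_distrib]
      refine sum_congr rfl fun x _ => ?_
      simp only [hZ]
      split_ifs <;> simp
    have hDiag : 𝔼 θ, (D θ - if A = B then atMax (levelTrace T) A else 0) ^ 2 ≤
        Γ ^ 2 * √(1 / 2 ^ (k₀ : ℕ)) := by
      -- The diagonal bound 2^(-j) is stronger than needed; it is weakened to the square root that
      -- the off-diagonal bound forces.
      have hsq : ∀ j : Fin M, k₀ ≤ j → Γ ^ 2 * (1 / 2 ^ (j : ℕ)) ≤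
          Γ ^ 2 * √(1 / 2 ^ (k₀ : ℕ)) := by
        intro j hj
        refine mul_le_mul_of_nonneg_left ?_ (sq_nonneg _)
        have h1 : (1 : ℝ) / 2 ^ (j : ℕ) ≤ 1 / 2 ^ (k₀ : ℕ) :=
          one_div_le_one_div_of_le (by positivity) (pow_le_pow_right₀ (by norm_num) hj)
        refine h1.trans (Real.le_sqrt_of_sq_le ?_)
        have h2 : (1 : ℝ) / 2 ^ (k₀ : ℕ) ≤ 1 := by
          rw [div_le_one (by positivity)]; exact one_le_pow₀ (by norm_num)
        rw [sq]
        exact mul_le_of_le_one_left (by positivity) h2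
      by_cases hAB : A = B
      · have : ∀ θ, D θ - (if A = B then atMax (levelTrace T) A else 0) = 0 := by
          intro θ
          rw [if_pos hAB, atMax_of_nonempty _ hA, ← ha, sub_eq_zero]
          simp only [hD, levelTrace]
          subst hAB
          simp [walsh_mul_self]
        simpa [this] using hC
      · simp only [if_neg hAB, sub_zero]
        have hne : A.erase a ≠ B.erase a := by
          intro h
          apply hAB
          rw [← insert_erase haA, h, hab, insert_erase hbB]
        obtain ⟨j, hj⟩ : ∃ j, ¬ (j ∈ A.erase a ↔ j ∈ B.erase a) := by
          by_contra hcon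
          push Not at hcon
          exact hne (Finset.ext hcon)
        by_cases hjA : j ∈ A.erase a
        · have hjB : j ∉ B.erase a := fun h => hj ⟨fun _ => h, fun _ => hjA⟩
          exact (expect_sq_diag_le hν hΓ hT hjA hjB a (hltA j hjA).le).trans
            (hsq j (hkA j (mem_of_mem_erase hjA)))
        · have hjB : j ∈ B.erase a := by
            by_contra h
            exact hj ⟨fun h' => absurd h' hjA, fun h' => absurd h' h⟩
          have h1 := expect_sq_diag_le hν hΓ hT hjB hjA a
            (by rw [hab] at hjB ⊢; exact (hltB j hjB).le)
          simp only [mul_comm (walsh _ (B.erase a) _)] at h1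
          exact h1.trans (hsq j (hkB j (mem_of_mem_erase hjB)))
    calc _ ≤ 𝔼 θ, (2 * (∑ x, β x * Z x θ) ^ 2 +
          2 * (D θ - if A = B then atMax (levelTrace T) A else 0) ^ 2) := by
          refine expect_le_expect fun θ _ => ?_
          rw [hsplit]
          nlinarith [sq_nonneg ((∑ x, β x * Z x θ) -
            (D θ - if A = B then atMax (levelTrace T) A else 0))]
      _ ≤ _ := by
          rw [expect_add_distrib, ← mul_expect, ← mul_expect]
          linarith
  · have hAB : A ≠ B := by
      intro h
      apply hab
      subst h
      rfl
    clear_value a b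
    simp only [if_neg hAB, sub_zero, hX]
    suffices h2 : ∀ x x' : Cube M × Cube M, x' ≠ x →
        𝔼 θ, (walshCoeff A a x.1 θ * walshCoeff B b x.2 θ) *
          (walshCoeff A a x'.1 θ * walshCoeff B b x'.2 θ) = 0 by
      have h3 := expect_sq_sum_le (fun x θ => walshCoeff A a x.1 θ * walshCoeff B b x.2 θ) β
        (Equiv.refl _) habs
      have h4 := h3 (fun x x' h1 _ => h2 x x' h1)
      refine h4.trans ?_
      linarith
    intro x x' h1
    rcases lt_or_gt_of_ne hab with h | h
    · exact expect_walshCoeff_of_lt hltA hltB h h1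
    · refine (expect_congr rfl fun θ _ => ?_).trans
        (expect_walshCoeff_of_lt hltB hltA h (p := x.2) (q := x.1) (p' := x'.2) (q' := x'.1)
          fun h => h1 (Prod.ext (congrArg Prod.snd h) (congrArg Prod.fst h)))
      ring

end Operator

end SecondMoments

section Compression

variable {M : ℕ}

/-! ### Almost scalar compressions on the cube -/

lemma sgn_prod {ι : Type*} (s : Finset ι) (x : ι → ℤˣ) :
    sgn (∏ i ∈ s, x i) = ∏ i ∈ s, sgn (x i) := by
  simp [sgn, Units.coe_prod]

/-- On the top level of `A` the remaining factors are signs constant on cells, so the bounds for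
signed levels apply to Walsh functions and their functionals. -/
lemma exists_walsh_eq_signedLevel {A : Finset (Fin M)} (hA : A.Nonempty) :
    ∃ k η, walsh 1 A = signedLevel k η := by
  refine ⟨A.max' hA, fun p => ∏ j ∈ A.erase (A.max' hA), p j, ?_⟩
  have hlt : ∀ i ∈ A.erase (A.max' hA), i < A.max' hA := fun i hi =>
    A.lt_max'_of_mem_erase_max' hA hi
  rw [walsh_eq_sum 1 (A.max'_mem hA) hlt, signedLevel_eq_sum]
  refine sum_congr rfl fun p _ => ?_
  congr 1
  simp [walsh, twist_one, sgn_prod]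

section Operator

variable {ν : Seminorm ℝ (Cube M → ℝ)} (hν : IsHardyNorm ν)

include hν in
lemma walsh_le {A : Finset (Fin M)} (hA : A.Nonempty) : ν (walsh 1 A) ≤ 1 := by
  obtain ⟨k, η, h⟩ := exists_walsh_eq_signedLevel hA
  rw [h]; exact hν.signedLevel_le k η

include hν in
lemma dot_walsh_le {A : Finset (Fin M)} (hA : A.Nonempty) (f : Cube M → ℝ) :
    |dot (walsh 1 A) f| ≤ ν f := by
  obtain ⟨k, η, h⟩ := exists_walsh_eq_signedLevel hA
  rw [h]; exact hν.dot_signedLevel_le k η f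

lemma dot_one_eq_zero {f : Cube M → ℝ} (hf : condE 0 f = 0) : dot 1 f = 0 := by
  have := congrFun hf 1
  rw [condE_zero] at this
  simpa [dot_apply] using this

lemma sum_erase_empty (k : ℕ) (F : Finset (Fin M) → Cube M → ℝ) (h : F ∅ = 0) :
    ∑ A ∈ initialSets M k, F A = ∑ A ∈ (initialSets M k).erase ∅, F A :=
  (sum_erase _ h).symm

lemma seminorm_sum_le {ι : Type*} (s : Finset ι) (F : ι → Cube M → ℝ) :
    ν (∑ i ∈ s, F i) ≤ ∑ i ∈ s, ν (F i) :=
  Finset.le_sum_of_subadditive ν (map_zero ν).le (fun a b => map_add_le_add ν a b) s F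

variable {T : (Cube M → ℝ) →ₗ[ℝ] (Cube M → ℝ)} {Γ : ℝ} (hΓ : 0 ≤ Γ)
  (hT : ∀ f, condE 0 f = 0 → ν (T f) ≤ Γ * ν f) (hT0 : ∀ f, condE 0 (T f) = 0)

include hν hΓ hT hT0

/-- For some twist, the compression of `T` is close to a multiplier that depends on levels only. -/
lemma exists_twist_near_levelMul {k₀ : Fin M} {m : ℕ} (hm : m ≤ M) {σ : Equiv.Perm (Fin M)}
    (hσ : ∀ i j : Fin M, i < j → (j : ℕ) < m → σ i < σ j)
    (hk₀ : ∀ i : Fin M, (i : ℕ) < m → k₀ ≤ σ i) {e : ℝ} (he : 0 ≤ e)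
    (hbound : (2 ^ m) ^ 4 * (6 * (Γ ^ 2 * √(1 / 2 ^ (k₀ : ℕ)))) ≤ e ^ 2) :
    ∃ θ, ∀ f, condE m f = f → condE 0 f = 0 →
      ν (push θ σ m (T (pull θ σ f)) - levelMul (fun i => levelTrace T (σ i)) f) ≤ e * ν f := by
  set S := (initialSets M m).erase ∅ with hS
  set C : ℝ := 6 * (Γ ^ 2 * √(1 / 2 ^ (k₀ : ℕ))) with hC
  have hC0 : 0 ≤ C := by positivity
  have hcard : (S.card : ℝ) ≤ 2 ^ m := by
    have : S.card ≤ 2 ^ m := (card_erase_le).trans (card_initialSets hm).le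
    exact_mod_cast this
  have hSne : ∀ A ∈ S, A.Nonempty := fun A hA => nonempty_iff_ne_empty.2 (ne_of_mem_erase hA)
  have hSin : ∀ A ∈ S, A ∈ initialSets M m := fun A hA => mem_of_mem_erase hA
  let X : Finset (Fin M) × Finset (Fin M) → (Fin M × Cube M → ℤˣ) → ℝ := fun x θ =>
    dot (walsh θ (x.1.map σ.toEmbedding)) (T (walsh θ (x.2.map σ.toEmbedding))) -
      if x.1 = x.2 then atMax (levelTrace T) (x.1.map σ.toEmbedding) else 0
  have hX : ∀ x ∈ S ×ˢ S, 𝔼 θ, X x θ ^ 2 ≤ C := by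
    intro x hx
    obtain ⟨h1, h2⟩ := mem_product.1 hx
    have hle : ∀ A ∈ S, ∀ i ∈ A.map σ.toEmbedding, k₀ ≤ i := by
      intro A hA i hi
      obtain ⟨j, hj, rfl⟩ := mem_map.1 hi
      exact hk₀ j (mem_initialSets.1 (hSin A hA) j hj)
    have := expect_sq_entry_le hν hΓ hT ((hSne _ h1).map (f := σ.toEmbedding))
      ((hSne _ h2).map (f := σ.toEmbedding)) (hle _ h1) (hle _ h2)
    simpa only [X, map_inj] using this
  -- The average over θ of the sum of all squared errors is at most the number of entries times `C`,
  -- so some θ does no worse than the average.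
  obtain ⟨θ, -, hθ⟩ : ∃ θ ∈ (univ : Finset (Fin M × Cube M → ℤˣ)),
      ∑ x ∈ S ×ˢ S, X x θ ^ 2 ≤ (S ×ˢ S).card * C := by
    refine exists_le_of_expect_le univ_nonempty ?_
    rw [expect_sum_comm]
    refine (sum_le_sum hX).trans ?_
    rw [sum_const, nsmul_eq_mul]
  -- Cauchy-Schwarz over at most 4^m entries contributes a second factor 4^m, whence the fourth
  -- power of 2^m.
  have hsum : ∑ x ∈ S ×ˢ S, |X x θ| ≤ e := by
    refine abs_le_of_sq_le_sq' ?_ he |>.2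
    calc (∑ x ∈ S ×ˢ S, |X x θ|) ^ 2 ≤ (S ×ˢ S).card * ∑ x ∈ S ×ˢ S, |X x θ| ^ 2 :=
          sq_sum_le_card_mul_sum_sq
      _ ≤ (S ×ˢ S).card * ((S ×ˢ S).card * C) := by
          simp only [sq_abs]
          exact mul_le_mul_of_nonneg_left hθ (by positivity)
      _ = (S.card : ℝ) ^ 4 * C := by rw [card_product]; push_cast; ring
      _ ≤ (2 ^ m) ^ 4 * C := by gcongr
      _ ≤ e ^ 2 := hbound
  refine ⟨θ, fun f hf hf0 => ?_⟩
  have hfexp : f = ∑ B ∈ S, dot (walsh 1 B) f • walsh 1 B := by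
    conv_lhs => rw [← hf, condE_eq_sum_walsh hm]
    exact sum_erase_empty m _ (by rw [walsh_empty, dot_one_eq_zero hf0, zero_smul])
  have h1 : push θ σ m (T (pull θ σ f)) = ∑ A ∈ S, ∑ B ∈ S,
      (dot (walsh 1 B) f * dot (walsh θ (A.map σ.toEmbedding))
        (T (walsh θ (B.map σ.toEmbedding)))) • walsh 1 A := by
    rw [push_eq_sum θ σ hm, sum_erase_empty m _ (by
      rw [Finset.map_empty, walsh_empty, dot_one_eq_zero (hT0 _), zero_smul])]
    refine sum_congr rfl fun A _ => ?_
    rw [← sum_smul]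
    congr 1
    conv_lhs => rw [hfexp]
    simp only [map_sum, map_smul, pull_walsh, smul_eq_mul]
  have h2 : levelMul (fun i => levelTrace T (σ i)) f = ∑ A ∈ S, ∑ B ∈ S,
      (dot (walsh 1 B) f * if A = B then atMax (levelTrace T) (A.map σ.toEmbedding) else 0) •
        walsh 1 A := by
    conv_lhs => rw [hfexp]
    simp only [map_sum, map_smul, levelMul_walsh]
    refine sum_congr rfl fun A hA => ?_
    rw [← sum_smul]
    simp only [mul_ite, mul_zero]
    rw [Finset.sum_ite_eq, if_pos hA, atMax_map_initial σ hσ _ (hSin A hA), smul_smul]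
  have h3 : push θ σ m (T (pull θ σ f)) - levelMul (fun i => levelTrace T (σ i)) f =
      ∑ x ∈ S ×ˢ S, (dot (walsh 1 x.2) f * X x θ) • walsh 1 x.1 := by
    rw [h1, h2, sum_product, ← sum_sub_distrib]
    refine sum_congr rfl fun A _ => ?_
    rw [← sum_sub_distrib]
    refine sum_congr rfl fun B _ => ?_
    rw [← sub_smul, ← mul_sub]
  rw [h3]
  refine (seminorm_sum_le _ _).trans ?_
  -- Each Walsh function and each Walsh functional has norm at most 1, so the operator norm of the
  -- error is bounded by the ℓ¹ norm of its matrix.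
  calc _ ≤ ∑ x ∈ S ×ˢ S, |X x θ| * ν f := by
        refine sum_le_sum fun x hx => ?_
        obtain ⟨hx1, hx2⟩ := mem_product.1 hx
        rw [map_smul_eq_mul, Real.norm_eq_abs, abs_mul]
        refine (mul_le_of_le_one_right (by positivity) (walsh_le hν (hSne _ hx1))).trans ?_
        rw [mul_comm]
        exact mul_le_mul_of_nonneg_left (dot_walsh_le hν (hSne _ hx2) f) (abs_nonneg _)
    _ = (∑ x ∈ S ×ˢ S, |X x θ|) * ν f := by rw [sum_mul]
    _ ≤ e * ν f := mul_le_mul_of_nonneg_right hsum (apply_nonneg ν f)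

end Operator

/-! ### Level multipliers and the choice of levels. -/

/-- `L` bounds the norms of the multipliers on the first `m` levels. -/
def LevelMulBound (ν : Seminorm ℝ (Cube M → ℝ)) (m : ℕ) (L : ℝ) : Prop :=
  ∀ (γ : Fin M → ℝ) (f : Cube M → ℝ), (∀ k, |γ k| ≤ 1) → condE m f = f → condE 0 f = 0 →
    ν (levelMul γ f) ≤ L * ν f

lemma mdiff_eq_zero_of_le {k m : ℕ} (h : m ≤ k) {f : Cube M → ℝ} (hf : condE m f = f) :
    mdiff k f = 0 := by
  rw [mdiff_apply, ← hf, condE_condE_of_ge h, condE_condE_of_ge (by omega), sub_self]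

lemma mdiff_mdiff (j k : ℕ) (f : Cube M → ℝ) :
    mdiff j (mdiff k f) = if j = k then mdiff k f else 0 := by
  rcases lt_trichotomy j k with h | rfl | h
  · rw [if_neg h.ne, mdiff_apply k, map_sub, mdiff_apply, mdiff_apply,
      condE_condE_of_le (by omega), condE_condE_of_le (by omega), condE_condE_of_le (by omega),
      condE_condE_of_le h.le, sub_self]
  · rw [if_pos rfl, mdiff_apply j (mdiff j f), mdiff_apply j f, map_sub, map_sub,
      condE_condE_of_ge le_rfl, condE_condE_of_le (Nat.le_succ j),
      condE_condE_of_ge (Nat.le_succ j), condE_condE_of_ge le_rfl, sub_self, sub_zero]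
  · rw [if_neg h.ne', mdiff_eq_zero_of_le (m := k + 1) h]
    rw [mdiff_apply, map_sub, condE_condE_of_ge le_rfl, condE_condE_of_ge (Nat.le_succ k)]

lemma sum_fin_mdiff {f : Cube M → ℝ} (hf : condE 0 f = 0) : ∑ k : Fin M, mdiff k f = f := by
  rw [Fin.sum_univ_eq_sum_range (fun k => mdiff k f) M, sum_mdiff, hf, sub_zero,
    condE_of_le le_rfl]

/-- The difference is β times a multiplier with coefficients in [-1, 1]. Coefficients beyond level
`m` do not act on `f` and are set to zero. -/
lemma levelMul_sub_smul_le {ν : Seminorm ℝ (Cube M → ℝ)} {m : ℕ} {L : ℝ}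
    (hL : LevelMulBound ν m L) {γ : Fin M → ℝ} {c β : ℝ} (hβ : 0 < β)
    (h : ∀ k : Fin M, (k : ℕ) < m → |γ k - c| ≤ β) {f : Cube M → ℝ} (hf : condE m f = f)
    (hf0 : condE 0 f = 0) : ν (levelMul γ f - c • f) ≤ L * β * ν f := by
  have h1 : levelMul γ f - c • f =
      β • levelMul (fun k => if (k : ℕ) < m then (γ k - c) / β else 0) f := by
    conv_lhs => rw [← sum_fin_mdiff hf0]
    rw [map_sum, smul_sum, ← sum_sub_distrib, levelMul_apply, smul_sum]
    refine sum_congr rfl fun k _ => ?_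
    have h2 : levelMul γ (mdiff k f) = γ k • mdiff k f :=
      levelMul_of_level (fun j => mdiff_mdiff j k f) γ
    rw [h2, smul_smul]
    split_ifs with hk
    · rw [mul_div_cancel₀ _ hβ.ne', sub_smul]
    · rw [mdiff_eq_zero_of_le (not_lt.1 hk) hf]
      simp
  rw [h1, map_smul_eq_mul, Real.norm_of_nonneg hβ.le, mul_comm L, mul_assoc]
  refine mul_le_mul_of_nonneg_left (hL _ f (fun k => ?_) hf hf0) hβ.le
  split_ifs with hk
  · rw [abs_div, abs_of_pos hβ, div_le_one hβ]
    exact h k hk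
  · simp

/-- Level multipliers on `m` levels are bounded by `2 * m`. -/
lemma IsHardyNorm.levelMulBound {ν : Seminorm ℝ (Cube M → ℝ)} (hν : IsHardyNorm ν) {m : ℕ}
    (hm : m ≤ M) : LevelMulBound ν m (2 * m) := by
  intro γ f hγ hf _
  rw [levelMul_apply]
  refine (seminorm_sum_le _ _).trans ?_
  calc _ ≤ ∑ k : Fin M, if (k : ℕ) < m then 2 * ν f else 0 := by
        refine sum_le_sum fun k _ => ?_
        split_ifs with hk
        · rw [map_smul_eq_mul, Real.norm_eq_abs, mdiff_apply]
          refine (mul_le_of_le_one_left (apply_nonneg ν _) (hγ k)).trans ?_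
          refine (map_sub_le_add ν _ _).trans ?_
          linarith [hν.condE_le (k + 1) f, hν.condE_le k f]
        · rw [mdiff_eq_zero_of_le (not_lt.1 hk) hf]
          simp
    _ = _ := by
        rw [← sum_filter, sum_const, card_filter_lt hm, nsmul_eq_mul]
        ring

/-- Many values in `[-Γ, Γ]` cluster around one of `q` centers. -/
lemma exists_cluster {ι : Type*} (s : Finset ι) {Γ : ℝ} (hΓ : 0 < Γ) (x : ι → ℝ)
    (hx : ∀ i ∈ s, |x i| ≤ Γ) {n q : ℕ} (hq : 0 < q) (hs : n * q < s.card) :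
    ∃ c : ℝ, ∃ t ⊆ s, n < t.card ∧ ∀ i ∈ t, |x i - c| ≤ Γ / q := by
  classical
  let y : ι → ℝ := fun i => (x i + Γ) * q / (2 * Γ)
  -- The minimum puts the endpoint `x i = Γ`, where `y i = q`, into the last bin.
  let bin : ι → ℕ := fun i => min ⌊y i⌋₊ (q - 1)
  have hq' : (0 : ℝ) < q := by exact_mod_cast hq
  obtain ⟨j, -, hj⟩ := exists_lt_card_fiber_of_mul_lt_card_of_maps_to (s := s) (t := range q)
    (f := bin) (n := n) (fun i _ => by
      rw [Finset.mem_range]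
      exact lt_of_le_of_lt (min_le_right _ _) (by omega)) (by rw [card_range, mul_comm]; exact hs)
  -- The center is the midpoint of bin j, an interval of length 2Γ/q.
  refine ⟨-Γ + (2 * j + 1) * Γ / q, _, filter_subset _ _, hj, fun i hi => ?_⟩
  obtain ⟨his, hij⟩ := mem_filter.1 hi
  have h := abs_le.1 (hx i his)
  have hy0 : 0 ≤ y i := div_nonneg (mul_nonneg (by linarith) hq'.le) (by linarith)
  have hyq : y i ≤ q := by
    rw [div_le_iff₀ (by linarith)]
    nlinarith
  have hj1 : (j : ℝ) ≤ y i := by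
    rw [← hij]
    exact (Nat.cast_le.2 (min_le_left _ _)).trans (Nat.floor_le hy0)
  have hj2 : y i ≤ j + 1 := by
    rw [← hij]
    rcases min_cases ⌊y i⌋₊ (q - 1) with ⟨h1, _⟩ | ⟨h1, _⟩
    · simp only [bin, h1]
      exact (Nat.lt_floor_add_one _).le
    · simp only [bin, h1]
      rw [Nat.cast_sub hq]
      simpa using hyq
  have hxy : x i = -Γ + 2 * Γ * y i / q := by
    simp only [y]
    field_simp
    ring
  rw [hxy, show -Γ + 2 * Γ * y i / q - (-Γ + (2 * j + 1) * Γ / q) =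
    (2 * y i - 2 * j - 1) * (Γ / q) by ring, abs_mul, abs_of_pos (div_pos hΓ hq')]
  refine mul_le_of_le_one_left (div_pos hΓ hq').le (abs_le.2 ⟨?_, ?_⟩) <;> linarith

/-- The increasing enumeration of m elements of `s` is extended arbitrarily to a permutation, so
that the twisted map stays a measure-preserving bijection of the whole cube. -/
lemma exists_perm_of_card_le {s : Finset (Fin M)} {m : ℕ} (hs : m ≤ s.card) :
    ∃ σ : Equiv.Perm (Fin M), (∀ i j : Fin M, i < j → (j : ℕ) < m → σ i < σ j) ∧
      ∀ i : Fin M, (i : ℕ) < m → σ i ∈ s := by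
  let κ := s.orderEmbOfCardLe hs
  obtain ⟨g, hg⟩ := Finset.exists_equiv_extend_of_card_eq (α := Fin M)
    (t := (univ : Finset (Fin M)))
    (by simp) (s := univ.filter fun i : Fin M => (i : ℕ) < m)
    (f := fun i : Fin M => if h : (i : ℕ) < m then κ ⟨i, h⟩ else i) (Finset.subset_univ _) (by
      intro i hi j hj hij
      simp only [coe_filter, Finset.mem_univ, true_and, Set.mem_ofPred_eq] at hi hj
      simp only [hi, hj, dif_pos] at hij
      have := κ.injective hij
      exact Fin.ext (by simpa using this))
  have hg' : ∀ i : Fin M, ∀ h : (i : ℕ) < m, (g i : Fin M) = κ ⟨i, h⟩ := by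
    intro i h
    rw [hg i (by simpa using h), dif_pos h]
  refine ⟨g.trans (Equiv.subtypeUnivEquiv fun x => Finset.mem_univ x), fun i j hij hj => ?_,
    fun i hi => ?_⟩
  · change (g i : Fin M) < (g j : Fin M)
    have hij' : (i : ℕ) < j := hij
    rw [hg' i (by omega), hg' j hj]
    exact κ.strictMono hij'
  · change (g i : Fin M) ∈ s
    rw [hg' i hi]
    exact s.orderEmbOfCardLe_mem hs _

/-- The compression of `T` to a suitable copy of the first `n + 1` levels is almost scalar. -/
theorem exists_compression {ν : Seminorm ℝ (Cube M → ℝ)} (hν : IsHardyNorm ν)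
    {T : (Cube M → ℝ) →ₗ[ℝ] (Cube M → ℝ)} {Γ : ℝ} (hΓ : 0 < Γ)
    (hT : ∀ f, condE 0 f = 0 → ν (T f) ≤ Γ * ν f) (hT0 : ∀ f, condE 0 (T f) = 0)
    {n q k₀ : ℕ} (hq : 0 < q) (hM : k₀ + n * q < M) (hn : n + 1 ≤ M) {L : ℝ}
    (hL : LevelMulBound ν (n + 1) L)
    {e : ℝ} (he : 0 ≤ e) (hbound : (2 ^ (n + 1)) ^ 4 * (6 * (Γ ^ 2 * √(1 / 2 ^ k₀))) ≤ e ^ 2) :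
    ∃ θ σ, (∀ i j : Fin M, i < j → (j : ℕ) < n + 1 → σ i < σ j) ∧ ∃ c : ℝ,
      (∃ k, |levelTrace T k - c| ≤ Γ / q) ∧ ∀ f, condE (n + 1) f = f → condE 0 f = 0 →
        ν (push θ σ (n + 1) (T (pull θ σ f)) - c • f) ≤ (L * (Γ / q) + e) * ν f := by
  have hq' : (0 : ℝ) < q := by exact_mod_cast hq
  let k₁ : Fin M := ⟨k₀, by omega⟩
  -- There are M - k₀ > nq levels from k₀ on, so some bin contains at least n + 1 of them.
  obtain ⟨c, t, hts, htc, ht⟩ := exists_cluster (Finset.Ici k₁) hΓ (levelTrace T)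
    (fun i _ => abs_levelTrace_le hν hΓ.le hT i) (n := n) hq (by
      rw [Fin.card_Ici]
      simp only [k₁]
      omega)
  obtain ⟨σ, hσ, hσt⟩ := exists_perm_of_card_le (s := t) (m := n + 1) htc
  obtain ⟨θ, hθ⟩ := exists_twist_near_levelMul hν hΓ.le hT hT0 (k₀ := k₁) hn hσ
    (fun i hi => Finset.mem_Ici.1 (hts (hσt i hi))) he hbound
  refine ⟨θ, σ, hσ, c, ⟨σ ⟨0, by omega⟩, ht _ (hσt _ (by simp))⟩, fun f hf hf0 => ?_⟩
  have h1 := hθ f hf hf0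
  have h2 := levelMul_sub_smul_le hL (div_pos hΓ hq') (γ := fun i => levelTrace T (σ i))
    (fun k hk => ht _ (hσt k hk)) hf hf0
  have h3 := map_add_le_add ν (push θ σ (n + 1) (T (pull θ σ f)) -
    levelMul (fun i => levelTrace T (σ i)) f) (levelMul (fun i => levelTrace T (σ i)) f - c • f)
  rw [sub_add_sub_cancel] at h3
  linarith

end Compression

section Dyadic

/-! ### Binary digits -/

section Digits

variable (M : ℕ)

/-- The binary digits of `i`, as signs, most significant digit first. -/
def digits (i : Fin (2 ^ M)) : Cube M := fun k => (-1) ^ ((i : ℕ) / 2 ^ (M - 1 - k))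

variable {M}

lemma neg_one_pow_eq_iff (x y : ℕ) : ((-1 : ℤˣ) ^ x = (-1) ^ y) ↔ x % 2 = y % 2 := by
  rcases Nat.even_or_odd x with hx | hx <;> rcases Nat.even_or_odd y with hy | hy <;>
    simp only [hx.neg_one_pow, hy.neg_one_pow, true_iff] <;>
    simp only [Nat.even_iff, Nat.odd_iff] at hx hy <;>
      simp [hx, hy, (by decide : (1 : ℤˣ) ≠ -1), (by decide : (-1 : ℤˣ) ≠ 1)]

lemma div_pow_succ (i : ℕ) {k : ℕ} (hk : k < M) :
    i / 2 ^ (M - k) = i / 2 ^ (M - 1 - k) / 2 := by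
  rw [Nat.div_div_eq_div_mul, ← pow_succ]
  congr 2
  omega

lemma trunc_digits_eq_iff (i j : Fin (2 ^ M)) {k : ℕ} (hk : k ≤ M) :
    trunc k (digits M i) = trunc k (digits M j) ↔
      (i : ℕ) / 2 ^ (M - k) = (j : ℕ) / 2 ^ (M - k) := by
  induction k with
  | zero =>
    simp [trunc_zero, Nat.div_eq_of_lt i.2, Nat.div_eq_of_lt j.2]
  | succ k ih =>
    have e : trunc (k + 1) (digits M i) = trunc (k + 1) (digits M j) ↔
        trunc k (digits M i) = trunc k (digits M j) ∧
          digits M i ⟨k, hk⟩ = digits M j ⟨k, hk⟩ := by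
      simp only [trunc_eq_trunc_iff]
      constructor
      · intro h
        exact ⟨fun l hl => h l (by omega), h ⟨k, hk⟩ (Nat.lt_succ_self k)⟩
      · rintro ⟨h, h'⟩ l hl
        rcases Nat.lt_succ_iff_lt_or_eq.1 hl with hl | hl
        · exact h l hl
        · have : l = ⟨k, hk⟩ := Fin.ext hl
          rwa [this]
    rw [e, ih (by omega), digits, digits, neg_one_pow_eq_iff, div_pow_succ _ hk, div_pow_succ _ hk]
    simp only
    rw [show M - (k + 1) = M - 1 - k by omega]
    omega

lemma digits_injective : Function.Injective (digits M) := by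
  intro i j h
  have := (trunc_digits_eq_iff i j le_rfl).1 (by rw [h])
  simpa [Fin.ext_iff] using this

variable (M) in
/-- The binary digits as a bijection between cells and signs. -/
def cellEquiv : Fin (2 ^ M) ≃ Cube M :=
  Equiv.ofBijective (digits M)
    ((Fintype.bijective_iff_injective_and_card _).2 ⟨digits_injective, by simp⟩)

lemma cellEquiv_apply (i : Fin (2 ^ M)) : cellEquiv M i = digits M i := rfl

/-- The left endpoint of the dyadic interval of level `M` with index `i`. -/
def cellPt (i : Fin (2 ^ M)) : ℝ := (i : ℝ) / 2 ^ M

lemma floor_cellPt (i : Fin (2 ^ M)) {k : ℕ} (hk : k ≤ M) :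
    ⌊cellPt i * 2 ^ k⌋ = (((i : ℕ) / 2 ^ (M - k) : ℕ) : ℤ) := by
  have h : cellPt i * 2 ^ k = ((i : ℕ) : ℝ) / ((2 ^ (M - k) : ℕ) : ℝ) := by
    have hpow : (2 : ℝ) ^ M = 2 ^ k * 2 ^ (M - k) := by
      rw [← pow_add, Nat.add_sub_cancel' hk]
    rw [cellPt, hpow]
    push_cast
    field_simp
  rw [h, ← Int.natCast_floor_eq_floor (by positivity), Nat.floor_div_eq_div]

lemma floor_cellPt_self (i : Fin (2 ^ M)) : ⌊cellPt i * 2 ^ M⌋ = ((i : ℕ) : ℤ) := by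
  simpa using floor_cellPt i le_rfl

lemma cellPt_mem (i : Fin (2 ^ M)) : cellPt i ∈ (⟨M, i⟩ : DyadicInterval).toSet :=
  (mem_toSet_iff _ _).2 (floor_cellPt_self i)

lemma chi_cellPt (i : Fin (2 ^ M)) (I : DyadicInterval) (hI : I.level ≤ M) :
    chi I (cellPt i) = if (i : ℕ) / 2 ^ (M - I.level) = I.index then 1 else 0 := by
  classical
  simp only [chi, indicator_apply, mem_toSet_iff, floor_cellPt i hI, Pi.one_apply, Nat.cast_inj]

/-- An even digit means the left half, where the Haar function is +1; this fixes the sign convention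
of `digits`. -/
lemma haar_cellPt (i : Fin (2 ^ M)) {k : ℕ} (hk : k < M) (j : Fin (2 ^ k)) :
    haar ⟨k, j⟩ (cellPt i) =
      if (i : ℕ) / 2 ^ (M - k) = j then sgn (digits M i ⟨k, hk⟩) else 0 := by
  have e : M - (k + 1) = M - 1 - k := by omega
  have hl : chi (DyadicInterval.left ⟨k, j⟩) (cellPt i) =
      if (i : ℕ) / 2 ^ (M - 1 - k) = 2 * (j : ℕ) then 1 else 0 := by
    rw [chi_cellPt i _ (show k + 1 ≤ M from hk), ← e]
    rfl
  have hr : chi (DyadicInterval.right ⟨k, j⟩) (cellPt i) =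
      if (i : ℕ) / 2 ^ (M - 1 - k) = 2 * (j : ℕ) + 1 then 1 else 0 := by
    rw [chi_cellPt i _ (show k + 1 ≤ M from hk), ← e]
    rfl
  rw [haar, Pi.sub_apply, hl, hr, div_pow_succ _ hk, digits]
  generalize (i : ℕ) / 2 ^ (M - 1 - k) = x
  rcases Nat.even_or_odd' x with ⟨y, rfl | rfl⟩
  · rw [(even_two_mul y).neg_one_pow, if_neg (show ¬ (2 * y = 2 * (j : ℕ) + 1) by omega)]
    simp
  · rw [(odd_two_mul_add_one y).neg_one_pow, if_neg (show ¬ (2 * y + 1 = 2 * (j : ℕ)) by omega),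
      show (2 * y + 1) / 2 = y by omega]
    simp only [Nat.add_right_cancel_iff, Nat.mul_left_cancel_iff two_pos]
    split_ifs <;> simp

lemma exists_cell {t : ℝ} (ht : t ∈ Ico (0 : ℝ) 1) :
    ∃ i : Fin (2 ^ M), ⌊t * 2 ^ M⌋ = ⌊cellPt i * 2 ^ M⌋ := by
  have h2 : (0 : ℝ) < 2 ^ M := by positivity
  have h0 : 0 ≤ ⌊t * 2 ^ M⌋ := Int.floor_nonneg.2 (mul_nonneg ht.1 h2.le)
  obtain ⟨k, hk⟩ := Int.eq_ofNat_of_zero_le h0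
  have hlt : k < 2 ^ M := by
    have : ⌊t * 2 ^ M⌋ < ((2 ^ M : ℕ) : ℤ) := by
      rw [Int.floor_lt]
      push_cast
      nlinarith [ht.2]
    rw [hk] at this
    exact_mod_cast this
  exact ⟨⟨k, hlt⟩, by rw [floor_cellPt_self, hk]⟩

lemma rademacher_cellPt (i : Fin (2 ^ M)) {k : ℕ} (hk : k < M) :
    rademacher k (cellPt i) = sgn (digits M i ⟨k, hk⟩) := by
  have hlt : (i : ℕ) / 2 ^ (M - k) < 2 ^ k := by
    rw [Nat.div_lt_iff_lt_mul (by positivity), ← pow_add]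
    simp [show k + (M - k) = M by omega]
  rw [rademacher, Finset.sum_apply, sum_eq_single ⟨_, hlt⟩]
  · simp [haar_cellPt i hk]
  · intro j _ hj
    rw [haar_cellPt i hk, if_neg]
    intro h
    exact hj (Fin.ext h.symm)
  · simp

end Digits

/-! ### Step functions on the cube -/

section Step

variable {M : ℕ}

/-- The values of a function on the cells of level `M`. -/
def sample (M : ℕ) (f : ℝ → ℝ) : Cube M → ℝ := fun s => f (cellPt ((cellEquiv M).symm s))

lemma sample_cellEquiv (f : ℝ → ℝ) (i : Fin (2 ^ M)) :
    sample M f (cellEquiv M i) = f (cellPt i) := by simp [sample]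

/-- The step function with given values on the cells of level `M`. -/
def stepOf (M : ℕ) : (Cube M → ℝ) →ₗ[ℝ] haarSpan where
  toFun F := ∑ i, F (cellEquiv M i) • ⟨chi ⟨M, i⟩, chi_mem _⟩
  map_add' F G := by simp only [Pi.add_apply, add_smul, sum_add_distrib]
  map_smul' c F := by
    simp only [Pi.smul_apply, smul_eq_mul, mul_smul, smul_sum, RingHom.id_apply]

lemma coe_stepOf (F : Cube M → ℝ) :
    (stepOf M F : ℝ → ℝ) = ∑ i, F (cellEquiv M i) • chi ⟨M, i⟩ := by
  simp [stepOf]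

lemma isStep_stepOf (F : Cube M → ℝ) : IsStep M (stepOf M F : ℝ → ℝ) := by
  rw [coe_stepOf]
  have h : ∀ s : Finset (Fin (2 ^ M)), IsStep M (∑ i ∈ s, F (cellEquiv M i) • chi ⟨M, i⟩) := by
    intro s
    induction s using Finset.cons_induction with
    | empty => exact ⟨fun _ _ => rfl, fun _ _ _ => rfl⟩
    | cons a s ha ih =>
      rw [sum_cons]
      exact ((isStep_chi _).smul _).add ih
  exact h univ

lemma stepOf_cellPt (F : Cube M → ℝ) (i : Fin (2 ^ M)) :
    (stepOf M F : ℝ → ℝ) (cellPt i) = F (cellEquiv M i) := by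
  rw [coe_stepOf, Finset.sum_apply]
  simp only [Pi.smul_apply, smul_eq_mul, chi_cellPt i ⟨M, _⟩ le_rfl]
  rw [sum_eq_single i]
  · simp
  · intro j _ hj
    rw [if_neg, mul_zero]
    intro h
    exact hj (Fin.ext (by simpa using h.symm))
  · simp

lemma IsStep.ext_cellPt {f g : ℝ → ℝ} (hf : IsStep M f) (hg : IsStep M g)
    (h : ∀ i : Fin (2 ^ M), f (cellPt i) = g (cellPt i)) : f = g := by
  funext t
  by_cases ht : t ∈ Ico (0 : ℝ) 1
  · obtain ⟨i, hi⟩ := exists_cell (M := M) ht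
    rw [hf.2 t _ hi, hg.2 t _ hi, h]
  · rw [hf.1 t ht, hg.1 t ht]

lemma IsStep.eq_stepOf {f : ℝ → ℝ} (hf : IsStep M f) : f = stepOf M (sample M f) :=
  hf.ext_cellPt (isStep_stepOf _) fun i => by rw [stepOf_cellPt, sample_cellEquiv]

lemma measurableSet_toSet (I : DyadicInterval) : MeasurableSet I.toSet := measurableSet_Ico

lemma unitMeasure_toSet (I : DyadicInterval) :
    unitMeasure I.toSet = ENNReal.ofReal (1 / 2 ^ I.level) := by
  rw [unitMeasure, Measure.restrict_apply (measurableSet_toSet I),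
    inter_eq_left.2 (toSet_subset I), DyadicInterval.toSet, Real.volume_Ico]
  congr 1
  ring

lemma integral_chi (I : DyadicInterval) : ∫ s, chi I s ∂unitMeasure = 1 / 2 ^ I.level := by
  rw [chi, integral_indicator_one (measurableSet_toSet I), Measure.real, unitMeasure_toSet,
    ENNReal.toReal_ofReal (by positivity)]

lemma integrable_chi (I : DyadicInterval) : Integrable (chi I) unitMeasure := by
  refine (integrable_indicator_iff (measurableSet_toSet I)).2 (integrableOn_const (C := (1 : ℝ)) ?_)
  rw [unitMeasure_toSet]
  exact ENNReal.ofReal_ne_top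

/-- The integral of a step function is the average of its values. -/
lemma IsStep.integral_eq {f : ℝ → ℝ} (hf : IsStep M f) :
    ∫ s, f s ∂unitMeasure = 𝔼 s, sample M f s := by
  conv_lhs => rw [hf.eq_stepOf, coe_stepOf]
  simp only [Finset.sum_apply, Pi.smul_apply, smul_eq_mul]
  rw [integral_finsetSum]
  · simp only [integral_const_mul, integral_chi]
    rw [← expect_cellEquiv, Fintype.expect_eq_sum_div_card]
    simp [div_eq_mul_inv, sum_mul]
  · exact fun i _ => (integrable_chi _).const_mul _
where
  expect_cellEquiv (F : Cube M → ℝ) : 𝔼 i, F (cellEquiv M i) = 𝔼 s, F s :=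
    Fintype.expect_equiv (cellEquiv M) _ _ fun _ => rfl

lemma toSet_disjoint {i j : Fin (2 ^ M)} (h : i ≠ j) :
    Disjoint (⟨M, i⟩ : DyadicInterval).toSet (⟨M, j⟩ : DyadicInterval).toSet := by
  rw [Set.disjoint_left]
  intro t hi hj
  rw [mem_toSet_iff] at hi hj
  rw [hi] at hj
  exact h (Fin.ext (by exact_mod_cast hj))

open Classical in
lemma unitMeasure_stepOf_preimage (F : Cube M → ℝ) {S : Set ℝ} (hS : MeasurableSet S) :
    unitMeasure ((fun s => |(stepOf M F : ℝ → ℝ) s|) ⁻¹' S) =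
      ∑ s : Cube M, if |F s| ∈ S then ENNReal.ofReal (1 / 2 ^ M) else 0 := by
  classical
  set A := (fun s => |(stepOf M F : ℝ → ℝ) s|) ⁻¹' S with hA
  have hAm : MeasurableSet A := (measurable_of_mem (stepOf M F).2).abs hS
  have h1 : A ∩ Ico 0 1 = ⋃ i ∈ (univ : Finset (Fin (2 ^ M))),
      if |F (cellEquiv M i)| ∈ S then (⟨M, i⟩ : DyadicInterval).toSet else ∅ := by
    ext t
    simp only [mem_inter_iff, Finset.mem_univ, iUnion_true, mem_iUnion]
    have hval : ∀ i : Fin (2 ^ M), t ∈ (⟨M, i⟩ : DyadicInterval).toSet →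
        (stepOf M F : ℝ → ℝ) t = F (cellEquiv M i) := by
      intro i hi
      rw [(isStep_stepOf F).2 t (cellPt i) (by
        rw [floor_cellPt_self]; exact (mem_toSet_iff _ _).1 hi), stepOf_cellPt]
    constructor
    · rintro ⟨ht, ht01⟩
      obtain ⟨i, hi⟩ := exists_cell (M := M) ht01
      have hti : t ∈ (⟨M, i⟩ : DyadicInterval).toSet := by
        rw [mem_toSet_iff]
        simpa [floor_cellPt_self] using hi
      refine ⟨i, ?_⟩
      have : |F (cellEquiv M i)| ∈ S := by rw [← hval i hti]; exact ht
      rwa [if_pos this]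
    · rintro ⟨i, hi⟩
      split_ifs at hi with h
      · refine ⟨?_, toSet_subset _ hi⟩
        rw [hA, Set.mem_preimage, hval i hi]
        exact h
      · exact absurd hi (Set.notMem_empty t)
  have h2 : unitMeasure A = unitMeasure (A ∩ Ico 0 1) := by
    simp only [unitMeasure]
    rw [Measure.restrict_apply hAm, Measure.restrict_apply (hAm.inter measurableSet_Ico),
      Set.inter_assoc, Set.inter_self]
  rw [h2, h1, measure_biUnion_finset]
  · rw [← Equiv.sum_comp (cellEquiv M)]
    refine sum_congr rfl fun i _ => ?_
    split_ifs
    · exact unitMeasure_toSet _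
    · simp
  · intro i _ j _ hij
    simp only [Function.onFun]
    split_ifs
    · exact toSet_disjoint hij
    · exact disjoint_bot_right
    · exact disjoint_bot_left
    · exact disjoint_bot_left
  · intro i _
    split_ifs
    · exact measurableSet_toSet _
    · exact MeasurableSet.empty

/-- The norm of a Haar system space on step functions of level `M`. -/
def stepNorm (X : HaarSystemSpace) (M : ℕ) : Seminorm ℝ (Cube M → ℝ) := X.norm.comp (stepOf M)

lemma stepNorm_sample (X : HaarSystemSpace) {f : ℝ → ℝ} (hf : f ∈ haarSpan) (h : IsStep M f) :
    X.norm ⟨f, hf⟩ = stepNorm X M (sample M f) := by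
  rw [stepNorm, Seminorm.comp_apply]
  congr 1
  exact Subtype.ext h.eq_stepOf

/-- Permuting cells of equal measure preserves the distribution of the absolute value; this is where
rearrangement invariance of X enters. -/
lemma isCubeNorm_stepNorm (X : HaarSystemSpace) : IsCubeNorm (stepNorm X M) where
  perm π F := by
    classical
    refine X.norm_eq_of_identDistrib _ _ ⟨(measurable_of_mem (stepOf M _).2).abs.aemeasurable,
      (measurable_of_mem (stepOf M _).2).abs.aemeasurable, ?_⟩
    ext S hS
    rw [Measure.map_apply (measurable_of_mem (stepOf M _).2).abs hS,
      Measure.map_apply (measurable_of_mem (stepOf M _).2).abs hS,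
      unitMeasure_stepOf_preimage _ hS, unitMeasure_stepOf_preimage _ hS]
    exact Equiv.sum_comp π fun s => if |F s| ∈ S then ENNReal.ofReal (1 / 2 ^ M) else 0
  mono F G h := by
    refine X.norm_mono _ _ fun t => ?_
    by_cases ht : t ∈ Ico (0 : ℝ) 1
    · obtain ⟨i, hi⟩ := exists_cell (M := M) ht
      rw [(isStep_stepOf F).2 t _ hi, (isStep_stepOf G).2 t _ hi, stepOf_cellPt, stepOf_cellPt]
      exact h _
    · rw [(isStep_stepOf F).1 t ht, (isStep_stepOf G).1 t ht]
  one := by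
    rw [stepNorm, Seminorm.comp_apply, ← X.norm_one01]
    congr 1
    refine Subtype.ext (IsStep.ext_cellPt (M := M) (isStep_stepOf _)
      ((isStep_haarPlus none).mono (Nat.zero_le _)) fun i => ?_)
    rw [stepOf_cellPt]
    have : cellPt i ∈ Ico (0 : ℝ) 1 := toSet_subset _ (cellPt_mem i)
    simp [one01, haarPlus, this]

lemma isStep_rademacher {k : ℕ} (hk : k < M) : IsStep M (rademacher k) := by
  have h : ∀ s : Finset (Fin (2 ^ k)), IsStep M (∑ i ∈ s, haar ⟨k, i⟩) := by
    intro s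
    induction s using Finset.cons_induction with
    | empty => exact ⟨fun _ _ => rfl, fun _ _ _ => rfl⟩
    | cons a s ha ih =>
      rw [sum_cons]
      exact ((isStep_haar _).mono hk).add ih
  exact h univ

lemma sample_rademacher {k : ℕ} (hk : k < M) (s : Cube M) :
    sample M (rademacher k) s = sgn (s ⟨k, hk⟩) := by
  rw [sample, rademacher_cellPt _ hk, ← cellEquiv_apply, Equiv.apply_symm_apply]

/-- Restricting uniform signs along an injection gives uniform signs: the left side is invariant
under multiplication by any ε, so it may be averaged over ε. -/
lemma expect_comp_injective {α β : Type*} [Fintype α] [Fintype β] [DecidableEq α] [DecidableEq β]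
    {m : α → β} (hm : Function.Injective m) (G : (α → ℤˣ) → ℝ) :
    𝔼 t : β → ℤˣ, G (fun a => t (m a)) = 𝔼 ε, G ε := by
  have h1 : ∀ ε : α → ℤˣ, 𝔼 t : β → ℤˣ, G (fun a => t (m a)) =
      𝔼 t : β → ℤˣ, G ((fun a => t (m a)) * ε) := by
    intro ε
    rw [← expect_equiv_self (Equiv.mulRight (Function.extend m ε 1))]
    refine expect_congr rfl fun t _ => ?_
    congr 1
    funext a
    simp [hm.extend_apply]
  have h2 : 𝔼 t : β → ℤˣ, G (fun a => t (m a)) =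
      𝔼 ε : α → ℤˣ, 𝔼 t : β → ℤˣ, G ((fun a => t (m a)) * ε) := by
    rw [← Fintype.expect_const (ι := α → ℤˣ) (𝔼 t : β → ℤˣ, G (fun a => t (m a)))]
    exact expect_congr rfl fun ε _ => h1 ε
  rw [h2, expect_comm]
  have h3 : ∀ t : β → ℤˣ, 𝔼 ε : α → ℤˣ, G ((fun a => t (m a)) * ε) = 𝔼 ε, G ε := fun t =>
    expect_equiv_self (Equiv.mulLeft fun a => t (m a)) G
  simp only [h3, Fintype.expect_const]

/-- Rademacher functions with different indices are independent signs. -/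
lemma integral_rademacher {α : Type*} [Fintype α] [DecidableEq α] {m : α → ℕ}
    (hm : Function.Injective m) (G : (α → ℝ) → ℝ) (hG : G 0 = 0) :
    ∫ u, G (fun a => rademacher (m a) u) ∂unitMeasure = 𝔼 ε : α → ℤˣ, G (fun a => sgn (ε a)) := by
  obtain ⟨L, hL⟩ : ∃ L, ∀ a, m a < L :=
    ⟨(univ.sup m) + 1, fun a => Nat.lt_succ_of_le (le_sup (f := m) (Finset.mem_univ a))⟩
  -- The hypothesis `G 0 = 0` is needed because the Rademacher functions vanish outside [0,1).
  have hstep : IsStep L fun u => G (fun a => rademacher (m a) u) := by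
    refine ⟨fun u hu => ?_, fun u v huv => ?_⟩
    · have : (fun a => rademacher (m a) u) = 0 := by
        funext a
        exact (isStep_rademacher (hL a)).1 u hu
      simp only [this, hG]
    · have : (fun a => rademacher (m a) u) = fun a => rademacher (m a) v := by
        funext a
        exact (isStep_rademacher (hL a)).2 u v huv
      simp only [this]
  rw [hstep.integral_eq, ← expect_comp_injective (m := fun a => (⟨m a, hL a⟩ : Fin L))
    (fun a b h => hm (by simpa using h)) (fun ε => G fun a => sgn (ε a))]
  refine expect_congr rfl fun s _ => ?_
  simp only [sample]
  congr 1
  funext a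
  exact sample_rademacher (hL a) s

end Step

end Dyadic

section HaarCoefficients

/-! ### Haar coefficients on the cube -/

variable {M : ℕ}

lemma iota_injective : Function.Injective iota := by
  have key : ∀ {k l i j : ℕ}, i < 2 ^ k → 2 ^ k + i = 2 ^ l + j → l ≤ k := by
    intro k l i j hi h
    by_contra hkl
    have : 2 ^ (k + 1) ≤ 2 ^ l := Nat.pow_le_pow_right two_pos (by omega)
    rw [pow_succ] at this
    omega
  intro I J h
  rcases I with _ | ⟨k, i⟩ <;> rcases J with _ | ⟨l, j⟩
  · rfl
  · simp only [iota] at h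
    have : 0 < 2 ^ l := by positivity
    omega
  · simp only [iota] at h
    have : 0 < 2 ^ k := by positivity
    omega
  · simp only [iota] at h
    obtain rfl : k = l := le_antisymm (key j.2 h.symm) (key i.2 h)
    have : i = j := Fin.ext (by omega)
    rw [this]

/-- The index of the dyadic interval of level `k` that contains the cell `i`. -/
def ancestor (i : Fin (2 ^ M)) {k : ℕ} (hk : k ≤ M) : Fin (2 ^ k) :=
  ⟨(i : ℕ) / 2 ^ (M - k), by
    rw [Nat.div_lt_iff_lt_mul (by positivity), ← pow_add]
    simp [Nat.add_sub_cancel' hk]⟩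

lemma haar_cellPt_of_ne (i : Fin (2 ^ M)) {k : ℕ} (hk : k < M) {j : Fin (2 ^ k)}
    (hj : j ≠ ancestor i hk.le) : haar ⟨k, j⟩ (cellPt i) = 0 := by
  rw [haar_cellPt i hk, if_neg]
  intro h
  exact hj (Fin.ext h.symm)

lemma haar_ancestor_cellPt (i : Fin (2 ^ M)) {k : ℕ} (hk : k < M) :
    haar ⟨k, ancestor i hk.le⟩ (cellPt i) = sgn (digits M i ⟨k, hk⟩) := by
  rw [haar_cellPt i hk, if_pos]
  rfl

lemma sample_haar_ancestor (i : Fin (2 ^ M)) {k : ℕ} (hk : k < M) :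
    sample M (haar ⟨k, ancestor i hk.le⟩) = haarC ⟨k, hk⟩ (trunc k (cellEquiv M i)) := by
  funext s
  obtain ⟨i', rfl⟩ := (cellEquiv M).surjective s
  rw [sample_cellEquiv, haar_cellPt i' hk, haarC]
  exact if_congr (trunc_digits_eq_iff i' i hk.le).symm rfl rfl

lemma exists_sample_haar_eq {k : ℕ} (hk : k < M) (j : Fin (2 ^ k)) :
    ∃ p : Cube M, trunc k p = p ∧ sample M (haar ⟨k, j⟩) = haarC ⟨k, hk⟩ p := by
  have hlt : (j : ℕ) * 2 ^ (M - k) < 2 ^ M := by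
    calc (j : ℕ) * 2 ^ (M - k) < 2 ^ k * 2 ^ (M - k) :=
          Nat.mul_lt_mul_of_pos_right j.2 (by positivity)
      _ = 2 ^ M := by rw [← pow_add, Nat.add_sub_cancel' hk.le]
  have h : j = ancestor (⟨_, hlt⟩ : Fin (2 ^ M)) hk.le :=
    Fin.ext (Nat.mul_div_cancel _ (by positivity)).symm
  refine ⟨trunc k (cellEquiv M ⟨_, hlt⟩), trunc_trunc le_rfl _, ?_⟩
  rw [← sample_haar_ancestor _ hk, ← h]

/-- The Haar coefficient of a function on the cube. -/
def haarCoeff (M : ℕ) (I : DyadicInterval) : (Cube M → ℝ) →ₗ[ℝ] ℝ :=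
  (2 : ℝ) ^ I.level • dot (sample M (haar I))

lemma haarCoeff_apply (I : DyadicInterval) (f : Cube M → ℝ) :
    haarCoeff M I f = 2 ^ I.level * dot (sample M (haar I)) f := rfl

lemma mdiff_cellEquiv (f : Cube M → ℝ) (i : Fin (2 ^ M)) {k : ℕ} (hk : k < M) :
    haarCoeff M ⟨k, ancestor i hk.le⟩ f * haar ⟨k, ancestor i hk.le⟩ (cellPt i) =
      mdiff k f (cellEquiv M i) := by
  rw [haar_ancestor_cellPt i hk, haarCoeff_apply, sample_haar_ancestor i hk]
  exact (mdiff_eq ⟨k, hk⟩ f (cellEquiv M i)).symm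

lemma haarCoeff_mdiff (f : Cube M → ℝ) {k : ℕ} (hk : k < M) (j : Fin (2 ^ k)) (l : ℕ) :
    haarCoeff M ⟨k, j⟩ (mdiff l f) = if l = k then haarCoeff M ⟨k, j⟩ f else 0 := by
  obtain ⟨p, -, hp⟩ := exists_sample_haar_eq hk j
  rw [haarCoeff_apply, haarCoeff_apply, hp, ← dot_mdiff, mdiff_haarC]
  simp only
  split_ifs <;> simp

lemma haarCoeff_levelMul (γ : Fin M → ℝ) (f : Cube M → ℝ) {k : ℕ} (hk : k < M)
    (j : Fin (2 ^ k)) :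
    haarCoeff M ⟨k, j⟩ (levelMul γ f) = γ ⟨k, hk⟩ * haarCoeff M ⟨k, j⟩ f := by
  obtain ⟨p, -, hp⟩ := exists_sample_haar_eq hk j
  rw [haarCoeff_apply, haarCoeff_apply, hp, ← dot_levelMul,
    levelMul_of_level (mdiff_haarC ⟨k, hk⟩ p)]
  simp
  ring

open Classical in
lemma haarCoeff_sample_haar {k l : ℕ} (hk : k < M) (hl : l < M) (j : Fin (2 ^ k))
    (j' : Fin (2 ^ l)) : haarCoeff M ⟨k, j⟩ (sample M (haar ⟨l, j'⟩)) =
      if (⟨k, j⟩ : DyadicInterval) = ⟨l, j'⟩ then 1 else 0 := by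
  obtain ⟨p, hp1, hp⟩ := exists_sample_haar_eq hk j
  obtain ⟨p', -, hp'⟩ := exists_sample_haar_eq hl j'
  split_ifs with h
  · obtain ⟨rfl, h⟩ := DyadicInterval.mk.inj h
    obtain rfl := eq_of_heq h
    rw [haarCoeff_apply, hp, dot_apply]
    have h1 : ∀ s, haarC ⟨k, hk⟩ p s * haarC ⟨k, hk⟩ p s =
        if trunc k s = trunc k p then 1 else 0 := by
      intro s
      rw [hp1, haarC]
      simp only
      split_ifs <;> simp
    simp only [h1, expect_trunc_eq hk.le p]
    simp
  · by_cases hkl : k = l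
    · subst hkl
      have hj : j ≠ j' := fun hj => h (by rw [hj])
      rw [haarCoeff_apply, dot_apply, expect_eq_zero, mul_zero]
      intro s _
      obtain ⟨i, rfl⟩ := (cellEquiv M).surjective s
      rw [sample_cellEquiv, sample_cellEquiv]
      by_cases hi : j = ancestor i hk.le
      · rw [haar_cellPt_of_ne i hk (j := j') (fun h' => hj (hi.trans h'.symm)), mul_zero]
      · rw [haar_cellPt_of_ne i hk hi, zero_mul]
    · have : sample M (haar ⟨l, j'⟩) = mdiff l (sample M (haar ⟨l, j'⟩)) := by
        rw [hp', mdiff_haarC]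
        simp
      rw [this, haarCoeff_mdiff _ hk, if_neg (Ne.symm hkl)]

/-- The Haar coefficients of levels at most `n`. -/
def coeffs (n : ℕ) (f : Cube M → ℝ) : DyadicPlus →₀ ℝ :=
  ∑ k : Fin (n + 1), ∑ j : Fin (2 ^ (k : ℕ)), Finsupp.single (some ⟨k, j⟩) (haarCoeff M ⟨k, j⟩ f)

lemma linearCombination_coeffs {E : Type*} [AddCommGroup E] [Module ℝ E] (w : DyadicPlus → E)
    (n : ℕ) (f : Cube M → ℝ) :
    Finsupp.linearCombination ℝ w (coeffs n f) =
      ∑ k : Fin (n + 1), ∑ j : Fin (2 ^ (k : ℕ)), haarCoeff M ⟨k, j⟩ f • w (some ⟨k, j⟩) := by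
  simp [coeffs, Finsupp.linearCombination_single]

lemma sum_coeffs_cellPt {n : ℕ} (hn : n + 1 ≤ M) (f : Cube M → ℝ) (v : DyadicPlus → ℝ)
    (i : Fin (2 ^ M)) :
    Finsupp.linearCombination ℝ (fun I => v I * haarPlus I (cellPt i)) (coeffs n f) =
      ∑ k : Fin (n + 1), v (some ⟨k, ancestor i (by omega)⟩) * mdiff k f (cellEquiv M i) := by
  rw [linearCombination_coeffs]
  refine sum_congr rfl fun k _ => ?_
  have hk : (k : ℕ) < M := by omega
  rw [sum_eq_single (ancestor i hk.le)]
  · rw [← mdiff_cellEquiv f i hk, smul_eq_mul, haarPlus]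
    ring
  · intro j _ hj
    rw [haarPlus, haar_cellPt_of_ne i hk hj]
    simp
  · simp

lemma sum_fin_mdiff_eq (n : ℕ) (f : Cube M → ℝ) :
    ∑ k : Fin (n + 1), mdiff k f = condE (n + 1) f - condE 0 f := by
  rw [Fin.sum_univ_eq_sum_range (fun k => mdiff k f) (n + 1), sum_mdiff]

/-! ### The Hardy norm in cube coordinates. -/

section Hardy

variable (X : HaarSystemSpace) (r : rademacherFamilies)

lemma haarSum_eq (a : DyadicPlus →₀ ℝ) (s : ℝ) :
    haarSum a s = Finsupp.linearCombination ℝ (fun I => haarPlus I s) a := by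
  simp [haarSum, Finsupp.linearCombination_apply]

lemma randomizedAverage_eq (a : DyadicPlus →₀ ℝ) (s : ℝ) :
    randomizedAverage r a s =
      ∫ u, |Finsupp.linearCombination ℝ (fun I => r.1 I u * haarPlus I s) a| ∂unitMeasure := by
  simp only [randomizedAverage, Finsupp.linearCombination_apply, smul_eq_mul]
  congr 1
  funext u
  congr 2
  funext I c
  ring

lemma isStep_randomizedAverage {n : ℕ} (hn : n + 1 ≤ M) (f : Cube M → ℝ) :
    IsStep M (randomizedAverage r (coeffs n f)) := by
  have h : ∀ (k : Fin (n + 1)) (j : Fin (2 ^ (k : ℕ))), IsStep M (haar ⟨k, j⟩) := fun k j =>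
    (isStep_haar _).mono (show (k : ℕ) + 1 ≤ M by omega)
  refine ⟨fun s hs => ?_, fun s t hst => ?_⟩
  · simp [randomizedAverage_eq, linearCombination_coeffs, haarPlus, fun k j => (h k j).1 s hs]
  · simp only [randomizedAverage_eq, linearCombination_coeffs, haarPlus,
      fun k j => (h k j).2 s t hst]

lemma hardyNorm_coeffs {n : ℕ} (hn : n + 1 ≤ M) (f : Cube M → ℝ) :
    hardyNorm X r (coeffs n f) = stepNorm X M (sample M (randomizedAverage r (coeffs n f))) :=
  stepNorm_sample X (randomizedAverage_mem r _) (isStep_randomizedAverage r hn f)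

lemma randomizedAverage_coeffs_cellPt {n : ℕ} (hn : n + 1 ≤ M) (f : Cube M → ℝ)
    (i : Fin (2 ^ M)) : randomizedAverage r (coeffs n f) (cellPt i) =
      ∫ u, |∑ k : Fin (n + 1), r.1 (some ⟨k, ancestor i (by omega)⟩) u *
        mdiff k f (cellEquiv M i)| ∂unitMeasure := by
  rw [randomizedAverage_eq]
  congr 1
  funext u
  rw [sum_coeffs_cellPt hn f (fun I => r.1 I u) i]

lemma integral_abs_rademacher_zero_mul (c : ℝ) :
    ∫ u, |rademacher 0 u * c| ∂unitMeasure = |c| := by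
  have := integral_rademacher (α := Unit) (m := fun _ => 0)
    (fun _ _ _ => rfl) (fun x => |x () * c|) (by simp)
  simpa [abs_mul] using this

/-- With one common Rademacher factor of modulus 1, the inner integral is just the absolute value.
-/
lemma hardyNorm_coeffs_const (hr : r.1 = fun _ => rademacher 0) {n : ℕ} (hn : n + 1 ≤ M)
    (f : Cube M → ℝ) :
    hardyNorm X r (coeffs n f) = stepNorm X M (condE (n + 1) f - condE 0 f) := by
  rw [hardyNorm_coeffs X r hn]
  refine (isCubeNorm_stepNorm X).eq_of_abs_eq fun s => ?_
  obtain ⟨i, rfl⟩ := (cellEquiv M).surjective s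
  rw [sample_cellEquiv, randomizedAverage_coeffs_cellPt r hn, hr]
  simp only [← mul_sum, integral_abs_rademacher_zero_mul]
  rw [abs_abs, ← sum_fin_mdiff_eq, Finset.sum_apply]

lemma levelMul_condE_sub {n : ℕ} (hn : n + 1 ≤ M) (γ : Fin M → ℝ) (f : Cube M → ℝ) :
    levelMul γ (condE (n + 1) f - condE 0 f) =
      ∑ k : Fin (n + 1), γ (Fin.castLE hn k) • mdiff k f := by
  rw [← sum_fin_mdiff_eq, map_sum]
  exact sum_congr rfl fun k _ =>
    levelMul_of_level (l := Fin.castLE hn k) (fun j => mdiff_mdiff j k f) γ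

/-- At a given point only one interval of each level is seen, and these have different indices ι. So
independent signs per interval may be replaced by independent signs per level. -/
lemma hardyNorm_coeffs_indep (hr : r.1 = fun I => rademacher (iota I)) {n : ℕ} (hn : n + 1 ≤ M)
    (f : Cube M → ℝ) :
    hardyNorm X r (coeffs n f) =
      (isCubeNorm_stepNorm X).randNorm (condE (n + 1) f - condE 0 f) := by
  rw [hardyNorm_coeffs X r hn, IsCubeNorm.randNorm_apply]
  congr 1
  funext s
  obtain ⟨i, rfl⟩ := (cellEquiv M).surjective s
  rw [sample_cellEquiv, randomizedAverage_coeffs_cellPt r hn, hr]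
  have hm : Function.Injective fun k : Fin (n + 1) =>
      iota (some ⟨k, ancestor i (show (k : ℕ) ≤ M by omega)⟩) := by
    intro k l h
    have := iota_injective h
    simp only [Option.some.injEq, DyadicInterval.mk.injEq] at this
    exact Fin.ext this.1
  rw [integral_rademacher hm (fun x => |∑ k, x k * mdiff k f (cellEquiv M i)|) (by simp), randAbs]
  rw [← expect_comp_injective (Fin.castLE_injective hn)
    (fun ε => |∑ k, sgn (ε k) * mdiff k f (cellEquiv M i)|)]
  refine expect_congr rfl fun ε _ => ?_
  rw [levelMul_condE_sub hn]
  simp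

/-- The norm of `Y` on the cube. -/
lemma exists_isHardyNorm (M : ℕ) : ∃ ν : Seminorm ℝ (Cube M → ℝ), IsHardyNorm ν ∧
    ∀ n, n + 1 ≤ M → ∀ f : Cube M → ℝ,
      hardyNorm X r (coeffs n f) = ν (condE (n + 1) f - condE 0 f) := by
  rcases r.2 with hr | hr
  · exact ⟨_, (isCubeNorm_stepNorm X).isHardyNorm_randNorm, fun n hn f =>
      hardyNorm_coeffs_indep X r hr hn f⟩
  · exact ⟨_, (isCubeNorm_stepNorm X).isHardyNorm, fun n hn f =>
      hardyNorm_coeffs_const X r hr hn f⟩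

/-- Makes the function representing an element of the completion unique, which gives the diagonal
entries a meaning independent of the representative. -/
lemma haarSum_eq_zero {a : DyadicPlus →₀ ℝ} (h : hardyNorm X r a = 0) (s : ℝ) :
    haarSum a s = 0 := by
  have h1 : randomizedAverage r a s = 0 := by
    have := X.eq_zero_of_norm_eq_zero _ h
    exact congrFun (congrArg Subtype.val this) s
  rw [randomizedAverage_eq] at h1
  rw [haarSum_eq, Finsupp.linearCombination_apply]
  rcases r.2 with hr | hr
  · classical
    rw [hr] at h1
    simp only [Finsupp.linearCombination_apply, Finsupp.sum, smul_eq_mul] at h1 ⊢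
    have h2 := integral_rademacher (α := a.support) (m := fun I => iota I)
      (fun I J h => Subtype.ext (iota_injective h))
      (fun x : a.support → ℝ => |∑ I : a.support, a I * (x I * haarPlus I s)|) (by simp)
    have h4 : ∀ u, ∑ I : a.support, a I * (rademacher (iota I) u * haarPlus I s) =
        ∑ I ∈ a.support, a I * (rademacher (iota I) u * haarPlus I s) := fun u =>
      Finset.sum_coe_sort a.support fun I => a I * (rademacher (iota I) u * haarPlus I s)
    simp only [h4] at h2
    rw [h1, eq_comm, Fintype.expect_eq_zero_iff_of_nonneg (fun _ => abs_nonneg _)] at h2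
    -- A vanishing average of absolute values vanishes for every choice of signs, in particular for
    -- all signs +1.
    have h3 := congrFun h2 1
    simp only [Pi.one_apply, sgn_one, one_mul, Pi.zero_apply, abs_eq_zero] at h3
    rw [← h3]
    exact (Finset.sum_coe_sort a.support fun I => a I * haarPlus I s).symm
  · rw [mem_singleton_iff] at hr
    rw [hr] at h1
    simp only [Finsupp.linearCombination_apply, Finsupp.sum, smul_eq_mul] at h1 ⊢
    have h2 : ∀ u, ∑ I ∈ a.support, a I * (rademacher 0 u * haarPlus I s) =
        rademacher 0 u * ∑ I ∈ a.support, a I * haarPlus I s := by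
      intro u
      rw [mul_sum]
      exact sum_congr rfl fun I _ => by ring
    simp only [h2, integral_abs_rademacher_zero_mul, abs_eq_zero] at h1
    exact h1

/-! ### The level spaces on the cube -/

/-- `toHardySpace` as a linear map. -/
def toHardyLinear : (DyadicPlus →₀ ℝ) →ₗ[ℝ] HardySpace X r where
  toFun := toHardySpace X r
  map_add' a b :=
    (UniformSpace.Completion.toComplₗᵢ (𝕜 := ℝ) (E := HaarPolynomial X r)).map_add a b
  map_smul' c a :=
    (UniformSpace.Completion.toComplₗᵢ (𝕜 := ℝ) (E := HaarPolynomial X r)).map_smul c a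

lemma toHardyLinear_apply (a : DyadicPlus →₀ ℝ) : toHardyLinear X r a = toHardySpace X r a := rfl

lemma norm_toHardySpace (a : DyadicPlus →₀ ℝ) : ‖toHardySpace X r a‖ = hardyNorm X r a :=
  (UniformSpace.Completion.toComplₗᵢ (𝕜 := ℝ) (E := HaarPolynomial X r)).norm_map a

/-- The element of `Y_n` with the Haar coefficients of a function on the cube. -/
def synth (M n : ℕ) : (Cube M → ℝ) →ₗ[ℝ] levelSpace X r n :=
  ∑ k : Fin (n + 1), ∑ j : Fin (2 ^ (k : ℕ)),
    (haarCoeff M ⟨k, j⟩).smulRight (levelHaarVec X r n ⟨k, j⟩ (Nat.le_of_lt_succ k.2))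

lemma synth_apply (n : ℕ) (f : Cube M → ℝ) :
    synth X r M n f = ∑ k : Fin (n + 1), ∑ j : Fin (2 ^ (k : ℕ)), haarCoeff M ⟨k, j⟩ f •
      levelHaarVec X r n ⟨k, j⟩ (Nat.le_of_lt_succ k.2) := by
  simp [synth]

lemma coe_synth (n : ℕ) (f : Cube M → ℝ) :
    ((synth X r M n f : hardySpaceZero X r) : HardySpace X r) =
      toHardySpace X r (coeffs n f) := by
  rw [synth_apply, ← toHardyLinear_apply, coeffs]
  simp only [map_sum, AddSubmonoidClass.coe_finsetSum, Submodule.coe_smul]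
  refine sum_congr rfl fun k _ => sum_congr rfl fun j _ => ?_
  rw [← mul_one (haarCoeff M ⟨k, j⟩ f), ← smul_eq_mul, ← Finsupp.smul_single, map_smul,
    smul_eq_mul, mul_one]
  rfl

lemma norm_synth (n : ℕ) (f : Cube M → ℝ) : ‖synth X r M n f‖ = hardyNorm X r (coeffs n f) := by
  rw [← norm_toHardySpace, ← coe_synth]
  rfl

lemma synth_sample_haar {n : ℕ} (hn : n + 1 ≤ M) (I : DyadicInterval) (hI : I.level ≤ n) :
    synth X r M n (sample M (haar I)) = levelHaarVec X r n I hI := by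
  obtain ⟨l, j'⟩ := I
  simp only at hI
  rw [synth_apply, sum_eq_single ⟨l, Nat.lt_succ_of_le hI⟩, sum_eq_single j']
  · rw [haarCoeff_sample_haar (by omega) (by omega), if_pos rfl, one_smul]
  · intro j _ hj
    rw [haarCoeff_sample_haar (show l < M by omega) (by omega), if_neg (by simpa using hj),
      zero_smul]
  · simp
  · intro k _ hk
    refine sum_eq_zero fun j _ => ?_
    rw [haarCoeff_sample_haar (by omega) (by omega), if_neg, zero_smul]
    intro h
    exact hk (Fin.ext (DyadicInterval.mk.inj h).1)
  · simp

lemma synth_surjective {n : ℕ} (hn : n + 1 ≤ M) : Function.Surjective (synth X r M n) := by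
  rintro ⟨y, hy⟩
  suffices h : y ∈ Submodule.map (levelSpace X r n).subtype (LinearMap.range (synth X r M n)) by
    obtain ⟨z, ⟨f, rfl⟩, hz⟩ := h
    exact ⟨f, Subtype.ext hz⟩
  refine (Submodule.span_le.2 ?_ : levelSpace X r n ≤ _) hy
  rintro _ ⟨I, hI, rfl⟩
  exact ⟨_, ⟨_, synth_sample_haar X r hn I hI⟩, rfl⟩

lemma synth_condE_sub {n : ℕ} (hn : n + 1 ≤ M) (f : Cube M → ℝ) :
    synth X r M n (condE (n + 1) f - condE 0 f) = synth X r M n f := by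
  rw [synth_apply, synth_apply]
  refine sum_congr rfl fun k _ => sum_congr rfl fun j _ => ?_
  congr 1
  rw [← sum_fin_mdiff_eq, map_sum, sum_eq_single k]
  · rw [haarCoeff_mdiff f (by omega), if_pos rfl]
  · intro l _ hl
    rw [haarCoeff_mdiff f (by omega), if_neg (fun h => hl (Fin.ext h))]
  · simp

/-- All Haar pairings are bounded by the norm, and a mean-zero function is the sum of its Haar
terms. -/
lemma eq_zero_of_isHardyNorm {ν : Seminorm ℝ (Cube M → ℝ)} (hν : IsHardyNorm ν)
    {f : Cube M → ℝ} (hf : condE 0 f = 0) (h : ν f = 0) : f = 0 := by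
  rw [← sum_fin_mdiff hf]
  refine sum_eq_zero fun k _ => ?_
  funext s
  have h1 := sum_abs_dot_haarC_le hν k f
  rw [h] at h1
  have h2 : |dot (haarC k (trunc k s)) f| ≤ 0 := (single_le_sum (f := fun p => |dot (haarC k p) f|)
    (fun p _ => abs_nonneg _) (Finset.mem_univ _)).trans h1
  rw [mdiff_eq, abs_nonpos_iff.1 h2]
  simp

/-- The isometric coordinates of `Y_n` on the cube. -/
lemma exists_analysis {ν : Seminorm ℝ (Cube M → ℝ)} (hν : IsHardyNorm ν) {n : ℕ}
    (hn : n + 1 ≤ M)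
    (h : ∀ f : Cube M → ℝ, hardyNorm X r (coeffs n f) = ν (condE (n + 1) f - condE 0 f)) :
    ∃ Φ : levelSpace X r n →ₗ[ℝ] (Cube M → ℝ), (∀ y, synth X r M n (Φ y) = y) ∧
      (∀ y, ν (Φ y) = ‖y‖) ∧ (∀ f, Φ (synth X r M n f) = condE (n + 1) f - condE 0 f) ∧
      (∀ y, condE (n + 1) (Φ y) = Φ y) ∧ ∀ y, condE 0 (Φ y) = 0 := by
  obtain ⟨g, hg⟩ := (synth X r M n).exists_rightInverse_of_surjective
    (LinearMap.range_eq_top.2 (synth_surjective X r hn))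
  have hg' : ∀ y, synth X r M n (g y) = y := fun y => LinearMap.congr_fun hg y
  have e0 : ∀ f : Cube M → ℝ, condE 0 (condE (n + 1) f - condE 0 f) = 0 := fun f => by
    rw [map_sub, condE_condE_of_le (Nat.zero_le _), condE_condE_of_le le_rfl, sub_self]
  have e1 : ∀ f : Cube M → ℝ, condE (n + 1) (condE (n + 1) f - condE 0 f) =
      condE (n + 1) f - condE 0 f := fun f => by
    rw [map_sub, condE_condE_of_le le_rfl, condE_condE_of_ge (Nat.zero_le _)]
  -- Any linear right inverse of `synth` will do: removing the mean and the levels above `n`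
  -- eliminates its ambiguity, because the norm is definite on mean-zero functions.
  refine ⟨(condE (n + 1) - condE 0) ∘ₗ g, fun y => ?_, fun y => ?_, fun f => ?_, fun y => ?_,
    fun y => ?_⟩
  · exact (synth_condE_sub X r hn _).trans (hg' y)
  · exact (h (g y)).symm.trans ((norm_synth X r n (g y)).symm.trans (by rw [hg']))
  · have h1 : synth X r M n (g (synth X r M n f) - f) = 0 := by rw [map_sub, hg', sub_self]
    have h2 := norm_synth X r n (g (synth X r M n f) - f)
    rw [h1, norm_zero, h] at h2
    have h3 := eq_zero_of_isHardyNorm hν (e0 _) h2.symm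
    rw [map_sub, map_sub, sub_sub_sub_comm, sub_eq_zero] at h3
    exact h3
  · exact e1 _
  · exact e0 _

end Hardy

end HaarCoefficients

section Factorization

/-! ### Factorization -/

/-- The compression S = ATB satisfies ‖Sy‖ ≥ (|c| - β)‖y‖ ≥ ‖y‖/C. An injective endomorphism of a
finite-dimensional space is invertible, and its inverse, of norm at most C, is absorbed into `A`. -/
lemma factorsThrough_of_near_smul {E F : Type} [NormedAddCommGroup E] [NormedSpace ℝ E]
    [NormedAddCommGroup F] [NormedSpace ℝ F] [FiniteDimensional ℝ E] {B : E →L[ℝ] F}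
    {A : F →L[ℝ] E} (hB : ‖B‖ ≤ 1) (hA : ‖A‖ ≤ 1) (T : F →L[ℝ] F) {c β C : ℝ} (hC : 0 < C)
    (h : 1 / C ≤ |c| - β) (hS : ∀ y, ‖A (T (B y)) - c • y‖ ≤ β * ‖y‖) :
    FactorsThrough (ContinuousLinearMap.id ℝ E) T C := by
  let S : E →ₗ[ℝ] E := (A.comp (T.comp B) : E →L[ℝ] E)
  have hlow : ∀ y, ‖y‖ ≤ C * ‖S y‖ := by
    intro y
    have h1 : ‖c • y‖ ≤ ‖S y‖ + ‖A (T (B y)) - c • y‖ := by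
      have := norm_sub_le (S y) (A (T (B y)) - c • y)
      rwa [show S y = A (T (B y)) from rfl, sub_sub_cancel] at this
    rw [norm_smul, Real.norm_eq_abs] at h1
    have h2 : 1 / C * ‖y‖ ≤ ‖S y‖ := by
      have := mul_le_mul_of_nonneg_right h (norm_nonneg y)
      linarith [hS y]
    rw [one_div_mul_eq_div, div_le_iff₀ hC] at h2
    linarith
  have hinj : Function.Injective S := by
    refine (injective_iff_map_eq_zero S).2 fun y hy => ?_
    have := hlow y
    rw [hy, norm_zero, mul_zero] at this
    exact norm_le_zero_iff.1 this
  let e := LinearEquiv.ofInjectiveEndo S hinj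
  have he : ∀ y, S (e.symm y) = y := fun y => e.apply_symm_apply y
  let R : E →L[ℝ] E := LinearMap.mkContinuous (e.symm : E →ₗ[ℝ] E) C fun y => by
    simpa [he] using hlow (e.symm y)
  have hR : ‖R‖ ≤ C := LinearMap.mkContinuous_norm_le _ hC.le _
  refine ⟨B, R.comp A, ?_, ?_⟩
  · calc ‖R.comp A‖ * ‖B‖ ≤ (‖R‖ * ‖A‖) * ‖B‖ :=
          mul_le_mul_of_nonneg_right (R.opNorm_comp_le A) (norm_nonneg _)
      _ ≤ (C * 1) * 1 := by gcongr
      _ = C := by ring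
  · ext y
    exact (e.symm_apply_apply y).symm

variable (X : HaarSystemSpace) (r : rademacherFamilies) {M n N : ℕ}

lemma finiteDimensional_levelSpace (n : ℕ) : FiniteDimensional ℝ (levelSpace X r n) :=
  Module.Finite.of_surjective (synth X r (n + 1) n) (synth_surjective X r le_rfl)

lemma condE_zero_pull (θ : Fin M × Cube M → ℤˣ) (σ : Equiv.Perm (Fin M)) {f : Cube M → ℝ}
    (hf : condE 0 f = 0) : condE 0 (pull θ σ f) = 0 := by
  have h : ∀ g : Cube M → ℝ, condE 0 g = 0 ↔ 𝔼 s, g s = 0 := fun g =>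
    ⟨fun h => by rw [← condE_zero g 1, h]; rfl, fun h => funext fun s => by
      rw [condE_zero, h]; rfl⟩
  rw [h] at hf ⊢
  rw [← hf]
  exact expect_equiv_self (twistPerm θ σ) f

lemma condE_zero_push (θ : Fin M × Cube M → ℤˣ) (σ : Equiv.Perm (Fin M)) (k : ℕ)
    {f : Cube M → ℝ} (hf : condE 0 f = 0) : condE 0 (push θ σ k f) = 0 := by
  rw [push_apply, condE_condE_of_le (Nat.zero_le _)]
  funext s
  rw [condE_zero, expect_equiv_self (twistPerm θ σ).symm f, ← condE_zero f s, hf]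

lemma norm_synth_of_condE {ν : Seminorm ℝ (Cube M → ℝ)} {n : ℕ}
    (h : ∀ f : Cube M → ℝ, hardyNorm X r (coeffs n f) = ν (condE (n + 1) f - condE 0 f))
    {f : Cube M → ℝ} (h1 : condE (n + 1) f = f) (h0 : condE 0 f = 0) :
    ‖synth X r M n f‖ = ν f := by
  rw [norm_synth, h, h1, h0, sub_zero]

section Factor

variable {ν : Seminorm ℝ (Cube (N + 1) → ℝ)} (hν : IsHardyNorm ν)
  (hnorm : ∀ n, n + 1 ≤ N + 1 → ∀ f : Cube (N + 1) → ℝ,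
    hardyNorm X r (coeffs n f) = ν (condE (n + 1) f - condE 0 f))
  (hn : n ≤ N)
  {Φ : levelSpace X r n →ₗ[ℝ] (Cube (N + 1) → ℝ)}
  {Ψ : levelSpace X r N →ₗ[ℝ] (Cube (N + 1) → ℝ)}

include hν hnorm hn

/-- The operators that are induced by a twist. -/
lemma exists_embedding
    (hΦs : ∀ y, synth X r (N + 1) n (Φ y) = y) (hΦn : ∀ y, ν (Φ y) = ‖y‖)
    (hΦ1 : ∀ y, condE (n + 1) (Φ y) = Φ y) (hΦ0 : ∀ y, condE 0 (Φ y) = 0)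
    (hΨn : ∀ y, ν (Ψ y) = ‖y‖)
    (hΨ : ∀ f, Ψ (synth X r (N + 1) N f) = condE (N + 1) f - condE 0 f)
    (hΨ0 : ∀ y, condE 0 (Ψ y) = 0)
    (θ : Fin (N + 1) × Cube (N + 1) → ℤˣ) (σ : Equiv.Perm (Fin (N + 1)))
    (hσ : ∀ i j : Fin (N + 1), i < j → (j : ℕ) < n + 1 → σ i < σ j) :
    ∃ (B : levelSpace X r n →L[ℝ] levelSpace X r N) (A : levelSpace X r N →L[ℝ] levelSpace X r n),
      ‖B‖ ≤ 1 ∧ ‖A‖ ≤ 1 ∧ (∀ y, B y = synth X r (N + 1) N (pull θ σ (Φ y))) ∧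
        (∀ z, A z = synth X r (N + 1) n (push θ σ (n + 1) (Ψ z))) ∧ ∀ y, A (B y) = y := by
  have hn' : n + 1 ≤ N + 1 := by omega
  have hB : ∀ y, ‖synth X r (N + 1) N (pull θ σ (Φ y))‖ ≤ 1 * ‖y‖ := by
    intro y
    rw [norm_synth_of_condE X r (hnorm N le_rfl) (condE_of_le le_rfl _)
      (condE_zero_pull θ σ (hΦ0 y)), one_mul, ← hΦn y]
    exact hν.pull_le θ σ (n + 1) hn' hσ _ (hΦ1 y)
  have hA : ∀ z, ‖synth X r (N + 1) n (push θ σ (n + 1) (Ψ z))‖ ≤ 1 * ‖z‖ := by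
    intro z
    rw [norm_synth_of_condE X r (hnorm n hn') (by rw [push_apply, condE_condE_of_le le_rfl])
      (condE_zero_push θ σ _ (hΨ0 z)), one_mul, ← hΨn z]
    exact hν.push_le θ σ (n + 1) hn' hσ _
  refine ⟨LinearMap.mkContinuous (synth X r (N + 1) N ∘ₗ pull θ σ ∘ₗ Φ) 1 hB,
    LinearMap.mkContinuous (synth X r (N + 1) n ∘ₗ push θ σ (n + 1) ∘ₗ Ψ) 1 hA,
    LinearMap.mkContinuous_norm_le _ zero_le_one _, LinearMap.mkContinuous_norm_le _ zero_le_one _,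
    fun _ => rfl, fun _ => rfl, fun y => ?_⟩
  change synth X r (N + 1) n (push θ σ (n + 1) (Ψ (synth X r (N + 1) N (pull θ σ (Φ y))))) = y
  rw [hΨ, condE_of_le le_rfl, condE_zero_pull θ σ (hΦ0 y), sub_zero, push_pull, hΦ1, hΦs]

end Factor

/-! ### Diagonal entries and unconditionality in cube coordinates. -/

lemma isStep_haarSum_coeffs {n : ℕ} (hn : n + 1 ≤ M) (f : Cube M → ℝ) :
    IsStep M (haarSum (coeffs n f)) := by
  have h : ∀ (k : Fin (n + 1)) (j : Fin (2 ^ (k : ℕ))), IsStep M (haar ⟨k, j⟩) := fun k j =>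
    (isStep_haar _).mono (show (k : ℕ) + 1 ≤ M by omega)
  refine ⟨fun s hs => ?_, fun s t hst => ?_⟩
  · simp [haarSum_eq, linearCombination_coeffs, haarPlus, fun k j => (h k j).1 s hs]
  · simp only [haarSum_eq, linearCombination_coeffs, haarPlus, fun k j => (h k j).2 s t hst]

lemma sample_haarSum_coeffs {n : ℕ} (hn : n + 1 ≤ M) (f : Cube M → ℝ) :
    sample M (haarSum (coeffs n f)) = condE (n + 1) f - condE 0 f := by
  funext s
  obtain ⟨i, rfl⟩ := (cellEquiv M).surjective s
  have := sum_coeffs_cellPt hn f (fun _ => 1) i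
  simp only [one_mul] at this
  rw [sample_cellEquiv, haarSum_eq, this, ← sum_fin_mdiff_eq, Finset.sum_apply]

lemma integral_haar_mul_haarSum (I : DyadicInterval) (hI : I.level ≤ N)
    {f : Cube (N + 1) → ℝ} (hf : condE 0 f = 0) {a : DyadicPlus →₀ ℝ}
    (ha : ((synth X r (N + 1) N f : hardySpaceZero X r) : HardySpace X r) = toHardySpace X r a) :
    ∫ s, haar I s * haarSum a s ∂unitMeasure = dot (sample (N + 1) (haar I)) f := by
  have h1 : ∀ s, haarSum a s = haarSum (coeffs N f) s := by
    intro s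
    have h2 : hardyNorm X r (a - coeffs N f) = 0 := by
      rw [← norm_toHardySpace, ← toHardyLinear_apply, map_sub, toHardyLinear_apply,
        toHardyLinear_apply, ← ha, coe_synth, sub_self, norm_zero]
    have h3 := haarSum_eq_zero X r h2 s
    rw [haarSum_eq, map_sub, sub_eq_zero] at h3
    rw [haarSum_eq, haarSum_eq, h3]
  have hh : IsStep (N + 1) (haar I) := (isStep_haar I).mono (by omega)
  have hs := isStep_haarSum_coeffs (M := N + 1) le_rfl f
  simp only [h1]
  rw [IsStep.integral_eq (M := N + 1) (f := fun s => haar I s * haarSum (coeffs N f) s)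
    ⟨fun s hs' => by simp [hh.1 s hs'], fun s t hst => by simp only [hh.2 s t hst, hs.2 s t hst]⟩,
    dot_apply]
  refine expect_congr rfl fun s _ => ?_
  have h4 := congrFun (sample_haarSum_coeffs (M := N + 1) le_rfl f) s
  rw [hf, condE_of_le le_rfl, sub_zero] at h4
  rw [← h4]
  rfl

/-- A large diagonal has large averages on all levels. -/
lemma le_levelTrace {δ : ℝ} {T : levelSpace X r N →L[ℝ] levelSpace X r N}
    (hT : HasLargePositiveDiagonal X r δ T)
    {Ψ : levelSpace X r N →ₗ[ℝ] (Cube (N + 1) → ℝ)}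
    (hΨs : ∀ y, synth X r (N + 1) N (Ψ y) = y) (hΨ0 : ∀ y, condE 0 (Ψ y) = 0)
    (k : Fin (N + 1)) :
    δ ≤ levelTrace (Ψ ∘ₗ (T : levelSpace X r N →ₗ[ℝ] levelSpace X r N) ∘ₗ
      synth X r (N + 1) N) k := by
  set T' := Ψ ∘ₗ (T : levelSpace X r N →ₗ[ℝ] levelSpace X r N) ∘ₗ synth X r (N + 1) N with hT'
  have h1 : ∀ p, δ * (𝔼 s : Cube (N + 1), if trunc k s = p then (1 : ℝ) else 0) ≤
      dot (haarC k p) (T' (haarC k p)) := by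
    intro p
    by_cases hp : trunc k p = p
    · obtain ⟨i, rfl⟩ := (cellEquiv (N + 1)).surjective p
      have h2 := sample_haar_ancestor i k.2
      simp only [hp, Fin.eta] at h2
      set I : DyadicInterval := ⟨k, ancestor i k.2.le⟩ with hI
      obtain ⟨a, ha, hle⟩ := hT I (Nat.le_of_lt_succ k.2)
      have h3 : T' (haarC k (cellEquiv (N + 1) i)) =
          Ψ (T (levelHaarVec X r N I (Nat.le_of_lt_succ k.2))) := by
        rw [← h2, ← synth_sample_haar X r (M := N + 1) le_rfl I (Nat.le_of_lt_succ k.2)]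
        rfl
      have h4 := integral_haar_mul_haarSum X r I (Nat.le_of_lt_succ k.2)
        (f := Ψ (T (levelHaarVec X r N I (Nat.le_of_lt_succ k.2)))) (hΨ0 _) (a := a)
        (by rw [hΨs]; exact ha)
      rw [h4, h2] at hle
      rw [h3]
      refine le_trans (le_of_eq ?_) hle
      have h5 := expect_trunc_eq k.2.le (cellEquiv (N + 1) i)
      rw [hp] at h5
      rw [h5]
      rfl
    · have h2 : ∀ s : Cube (N + 1), trunc k s ≠ p := by
        rintro s rfl
        exact hp (trunc_trunc le_rfl s)
      have h3 : haarC k p = 0 := by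
        funext s
        exact if_neg (h2 s)
      simp [h3, h2]
  -- The cells of level k have total measure 1.
  calc δ = ∑ p, δ * (𝔼 s : Cube (N + 1), if trunc k s = p then (1 : ℝ) else 0) := by
        rw [← mul_sum, ← expect_sum_comm]
        simp
    _ ≤ _ := sum_le_sum fun p _ => h1 p

/-- Bounded multipliers are dominated by sign multipliers. -/
lemma exists_sign_levelMul_le (ν : Seminorm ℝ (Cube M → ℝ)) (f : Cube M → ℝ) (γ : Fin M → ℝ)
    (hγ : ∀ k, |γ k| ≤ 1) :
    ∃ ε : Cube M, ν (levelMul γ f) ≤ ν (levelMul (fun k => sgn (ε k)) f) := by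
  let G : (Fin M → ℝ) →ₗ[ℝ] (Cube M → ℝ) :=
    ∑ k : Fin M, (LinearMap.proj k : (Fin M → ℝ) →ₗ[ℝ] ℝ).smulRight (mdiff k f)
  have hG : ∀ γ, G γ = levelMul γ f := fun γ => by simp [G, levelMul_apply]
  have hconv : ConvexOn ℝ univ (ν.comp G) := (ν.comp G).convexOn
  -- The norm is a convex function of the coefficients, so it is dominated at some vertex of the
  -- cube [-1, 1]^M.
  have hmem : γ ∈ convexHull ℝ (Set.pi univ fun _ : Fin M => ({-1, 1} : Set ℝ)) := by
    rw [convexHull_pi]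
    intro k _
    rw [convexHull_pair, segment_eq_Icc (by norm_num)]
    exact abs_le.1 (hγ k)
  obtain ⟨y, hy, hle⟩ := hconv.exists_ge_of_mem_convexHull (Set.subset_univ _) hmem
  have : ∀ k, ∃ e : ℤˣ, sgn e = y k := by
    intro k
    rcases hy k (Set.mem_univ k) with h | h
    · exact ⟨-1, by simp [h]⟩
    · exact ⟨1, by simpa using (Set.mem_singleton_iff.1 h).symm⟩
  choose ε hε using this
  refine ⟨ε, ?_⟩
  simpa only [Seminorm.comp_apply, hG, ← funext hε] using hle

lemma IsUnconditional.levelMulBound {K : ℝ} (hK : IsUnconditional X r K)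
    {ν : Seminorm ℝ (Cube (N + 1) → ℝ)}
    (hnorm : ∀ f : Cube (N + 1) → ℝ,
      hardyNorm X r (coeffs N f) = ν (condE (N + 1) f - condE 0 f)) (m : ℕ) :
    LevelMulBound ν m K := by
  intro γ f hγ _ hf0
  obtain ⟨ε, hε⟩ := exists_sign_levelMul_le ν f γ hγ
  refine hε.trans ?_
  have hmul0 : condE 0 (levelMul (fun k => sgn (ε k)) f) = 0 := by
    rw [← IsCubeNorm.levelMul_condE, hf0, map_zero]
  rw [← norm_synth_of_condE X r hnorm (condE_of_le le_rfl f) hf0,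
    ← norm_synth_of_condE X r hnorm (condE_of_le le_rfl _) hmul0]
  let a : DyadicInterval →₀ ℝ := ∑ k : Fin (N + 1), ∑ j : Fin (2 ^ (k : ℕ)),
    Finsupp.single ⟨k, j⟩ (haarCoeff (N + 1) ⟨k, j⟩ f)
  -- Signs that depend on the level only; the value 1 above level `N` is irrelevant since no
  -- coefficients live there.
  let σ : DyadicInterval → ℝ := fun I => if h : I.level < N + 1 then sgn (ε ⟨I.level, h⟩) else 1
  have hσ : ∀ I, σ I = 1 ∨ σ I = -1 := by
    intro I
    simp only [σ]
    split_ifs with h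
    · rcases Int.units_eq_one_or (ε ⟨I.level, h⟩) with h' | h' <;> simp [h']
    · exact Or.inl rfl
  have hsum : ∀ w : DyadicInterval → ℝ, (a.sum fun I c => (w I * c) • haarVec X r I) =
      ∑ k : Fin (N + 1), ∑ j : Fin (2 ^ (k : ℕ)),
        (w ⟨k, j⟩ * haarCoeff (N + 1) ⟨k, j⟩ f) • haarVec X r ⟨k, j⟩ := by
    intro w
    have h1 : (a.sum fun I c => (w I * c) • haarVec X r I) =
        Finsupp.linearCombination ℝ (fun I => w I • haarVec X r I) a := by
      rw [Finsupp.linearCombination_apply]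
      congr 1
      funext I c
      rw [smul_smul, mul_comm]
    rw [h1]
    simp only [a, map_sum, Finsupp.linearCombination_single, smul_smul]
    simp only [mul_comm]
  have h1 := hK a σ hσ
  have h2 := hsum fun _ => 1
  simp only [one_mul] at h2
  rw [hsum σ, h2] at h1
  have coe_sum : ∀ c : (k : Fin (N + 1)) → Fin (2 ^ (k : ℕ)) → ℝ,
      ‖∑ k : Fin (N + 1), ∑ j : Fin (2 ^ (k : ℕ)), c k j •
        levelHaarVec X r N ⟨k, j⟩ (Nat.le_of_lt_succ k.2)‖ =
      ‖∑ k : Fin (N + 1), ∑ j : Fin (2 ^ (k : ℕ)), c k j • haarVec X r ⟨k, j⟩‖ := by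
    intro c
    change ‖((_ : levelSpace X r N) : hardySpaceZero X r)‖ = _
    simp only [AddSubmonoidClass.coe_finsetSum, Submodule.coe_smul]
    rfl
  rw [synth_apply, synth_apply, coe_sum, coe_sum]
  refine le_trans (le_of_eq ?_) h1
  congr 1
  refine sum_congr rfl fun k _ => sum_congr rfl fun j _ => ?_
  rw [haarCoeff_levelMul _ _ k.2]
  congr 2
  simp only [σ]
  rw [dif_pos k.2]

/-- Verifies the arithmetic of the hypothesis on N. After nq levels are reserved for the pigeonhole
principle, k₀ = N - nq is still so large that 2^(-k₀/2) beats the number of matrix entries and the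
factor x². -/
lemma card_bound {x : ℝ} (hx : 1 ≤ x) {n q N : ℕ} (hq : 0 < q)
    (h : 42 * (n : ℤ) * q + 42 + ⌊4 * Real.logb 2 x⌋ ≤ N) :
    n * q + n ≤ N ∧
      (2 ^ (n + 1)) ^ 4 * (6 * (x ^ 2 * √(1 / 2 ^ (N - n * q)))) ≤ (1 : ℝ) := by
  have hlog : 0 ≤ Real.logb 2 x := Real.logb_nonneg (by norm_num) hx
  have hfl : 0 ≤ ⌊4 * Real.logb 2 x⌋ := Int.floor_nonneg.2 (by linarith)
  have hnq : n ≤ n * q := Nat.le_mul_of_pos_right n hq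
  have h1 : n * q + n ≤ N := by
    have : (n : ℤ) ≤ n * q := by exact_mod_cast hnq
    have : ((n * q + n : ℕ) : ℤ) ≤ N := by push_cast; nlinarith
    exact_mod_cast this
  refine ⟨h1, ?_⟩
  set k := N - n * q with hk
  -- One of the 42 copies of nq is spent on the cluster, and one unit of the constant 42 on the
  -- floor.
  have hkr : (41 : ℝ) * n + 41 + 4 * Real.logb 2 x ≤ k := by
    have e1 : (k : ℝ) = N - n * q := by
      rw [hk, Nat.cast_sub (by omega)]
      push_cast
      ring
    have e2 : (42 : ℝ) * n * q + 42 + (⌊4 * Real.logb 2 x⌋ : ℝ) ≤ N := by exact_mod_cast h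
    have e3 : 4 * Real.logb 2 x < ⌊4 * Real.logb 2 x⌋ + 1 := Int.lt_floor_add_one _
    have e4 : (n : ℝ) ≤ n * q := by exact_mod_cast hnq
    nlinarith
  have hpow : (2 : ℝ) ^ (41 * n + 41) * x ^ 4 ≤ 2 ^ k := by
    have e1 : (2 : ℝ) ^ (4 * Real.logb 2 x) = x ^ 4 := by
      rw [mul_comm, Real.rpow_mul (by norm_num), Real.rpow_logb (by norm_num) (by norm_num)
        (by linarith)]
      norm_cast
    rw [← e1, ← Real.rpow_natCast, ← Real.rpow_natCast, ← Real.rpow_add (by norm_num)]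
    refine Real.rpow_le_rpow_of_exponent_le (by norm_num) ?_
    push_cast
    linarith
  have hx0 : 0 < x := by linarith
  have hsq : √(1 / 2 ^ k) ≤ 1 / (6 * (2 ^ (n + 1)) ^ 4 * x ^ 2) := by
    refine Real.sqrt_le_iff.2 ⟨by positivity, ?_⟩
    rw [div_pow, one_pow]
    refine one_div_le_one_div_of_le (by positivity) (le_trans ?_ hpow)
    have e1 : (6 * ((2 : ℝ) ^ (n + 1)) ^ 4 * x ^ 2) ^ 2 = (36 * 2 ^ (8 * n + 8)) * x ^ 4 := by
      rw [← pow_mul]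
      ring
    rw [e1]
    refine mul_le_mul_of_nonneg_right ?_ (by positivity)
    -- Only the exponent 8n + 14 is required; the constants in the hypothesis leave ample room.
    calc (36 : ℝ) * 2 ^ (8 * n + 8) ≤ 2 ^ 6 * 2 ^ (8 * n + 8) := by
          gcongr; norm_num
      _ = 2 ^ (8 * n + 14) := by rw [← pow_add]; congr 1; omega
      _ ≤ 2 ^ (41 * n + 41) := pow_le_pow_right₀ (by norm_num) (by omega)
  calc _ = (6 * (2 ^ (n + 1)) ^ 4 * x ^ 2) * √(1 / 2 ^ k) := by ring
    _ ≤ (6 * (2 ^ (n + 1)) ^ 4 * x ^ 2) * (1 / (6 * (2 ^ (n + 1)) ^ 4 * x ^ 2)) :=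
        mul_le_mul_of_nonneg_left hsq (by positivity)
    _ = 1 := by field_simp

/-- Almost scalar compressions of operators on `Y_N`. -/
theorem exists_almost_scalar {Γ τ : ℝ} (hΓ : 0 < Γ) (hτ : 0 < τ) (hx : 1 ≤ Γ / τ)
    (hN : (42 * (n : ℤ) * ((n : ℤ) + 1) * ⌈Γ / τ⌉ + 42 + ⌊4 * Real.logb 2 (Γ / τ)⌋ ≤ (N : ℤ)) ∨
      ∃ K : ℝ, 1 ≤ K ∧ IsUnconditional X r K ∧
        (42 * (n : ℤ) * ⌈K * Γ / τ⌉ + 42 + ⌊4 * Real.logb 2 (Γ / τ)⌋ ≤ (N : ℤ)))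
    (T : levelSpace X r N →L[ℝ] levelSpace X r N) (hT : ‖T‖ ≤ Γ) :
    ∃ (B : levelSpace X r n →L[ℝ] levelSpace X r N) (A : levelSpace X r N →L[ℝ] levelSpace X r n),
      ‖B‖ ≤ 1 ∧ ‖A‖ ≤ 1 ∧ (∀ y, A (B y) = y) ∧ ∃ c : ℝ,
        (∀ y, ‖A (T (B y)) - c • y‖ ≤ 3 * τ * ‖y‖) ∧
          ∀ δ, HasLargePositiveDiagonal X r δ T → δ - τ ≤ c := by
  obtain ⟨ν, hν, hnorm⟩ := exists_isHardyNorm X r (N + 1)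
  obtain ⟨q, L, hq, hL, hqN, hLq, hqτ⟩ : ∃ (q : ℕ) (L : ℝ), 0 < q ∧
      (n + 1 ≤ N + 1 → LevelMulBound ν (n + 1) L) ∧
      (42 * (n : ℤ) * q + 42 + ⌊4 * Real.logb 2 (Γ / τ)⌋ ≤ N) ∧ L * (Γ / q) ≤ 2 * τ ∧
      Γ / q ≤ τ := by
    have hceil : ∀ y : ℝ, 1 ≤ y → ∃ q : ℕ, 0 < q ∧ (q : ℤ) = ⌈y⌉ ∧ y ≤ q := fun y hy =>
      ⟨⌈y⌉₊, Nat.ceil_pos.2 (by linarith), Int.natCast_ceil_eq_ceil (by linarith), Nat.le_ceil y⟩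
    rcases hN with h | ⟨K, hK, hKu, h⟩
    · obtain ⟨q, hq, hqc, hqx⟩ := hceil _ hx
      have hq' : (0 : ℝ) < q := by exact_mod_cast hq
      have hqτ : Γ ≤ q * τ := (div_le_iff₀ hτ).1 hqx
      -- Without unconditionality, n + 1 times as many bins compensate for the multiplier bound 2(n
      -- + 1).
      refine ⟨(n + 1) * q, 2 * (n + 1), by positivity, fun hn => ?_, ?_, ?_, ?_⟩
      · have := hν.levelMulBound hn
        push_cast at this
        exact this
      · rw [← hqc] at h
        push_cast
        linarith
      · push_cast
        rw [show 2 * ((n : ℝ) + 1) * (Γ / ((n + 1) * q)) = 2 * (Γ / q) by field_simp]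
        have : Γ / q ≤ τ := by rw [div_le_iff₀ hq']; linarith
        linarith
      · push_cast
        rw [div_le_iff₀ (by positivity)]
        have : (q : ℝ) * τ ≤ τ * ((n + 1) * q) := by
          have : 0 ≤ (n : ℝ) * (q * τ) := by positivity
          linarith
        linarith
    · obtain ⟨q, hq, hqc, hqx⟩ := hceil (K * Γ / τ) (by
        rw [mul_div_assoc]
        nlinarith)
      have hq' : (0 : ℝ) < q := by exact_mod_cast hq
      have hqτ : K * Γ ≤ q * τ := (div_le_iff₀ hτ).1 hqx
      refine ⟨q, K, hq, fun _ => hKu.levelMulBound X r (hnorm N le_rfl) _, ?_, ?_, ?_⟩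
      · rw [← hqc] at h
        exact h
      · rw [← mul_div_assoc, div_le_iff₀ hq']
        nlinarith
      · rw [div_le_iff₀ hq']
        nlinarith
  obtain ⟨hnN, hbound⟩ := card_bound hx hq hqN
  have hn : n ≤ N := by omega
  have hn' : n + 1 ≤ N + 1 := by omega
  obtain ⟨Φ, hΦs, hΦn, -, hΦ1, hΦ0⟩ := exists_analysis X r hν hn' (hnorm n hn')
  obtain ⟨Ψ, hΨs, hΨn, hΨ, -, hΨ0⟩ := exists_analysis X r hν le_rfl (hnorm N le_rfl)
  set T' := Ψ ∘ₗ (T : levelSpace X r N →ₗ[ℝ] levelSpace X r N) ∘ₗ synth X r (N + 1) N with hT'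
  have hT'a : ∀ f, T' f = Ψ (T (synth X r (N + 1) N f)) := fun _ => rfl
  have hT'0 : ∀ f, condE 0 (T' f) = 0 := fun f => hΨ0 _
  have hT'n : ∀ f, condE 0 f = 0 → ν (T' f) ≤ Γ * ν f := by
    intro f hf
    rw [hT'a, hΨn, ← norm_synth_of_condE X r (hnorm N le_rfl) (condE_of_le le_rfl f) hf]
    exact (T.le_opNorm _).trans (mul_le_mul_of_nonneg_right hT (norm_nonneg _))
  -- The choice k₀ = N - nq leaves nq + 1 levels of the (N + 1)-dimensional cube. The allowed random
  -- error is τ, which together with the cluster error of at most 2τ gives 3τ.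
  obtain ⟨θ, σ, hσ, c, ⟨k, hk⟩, hc⟩ := exists_compression hν hΓ hT'n hT'0 hq
    (k₀ := N - n * q) (by omega) hn' (hL hn') hτ.le (by
      have h1 := mul_le_mul_of_nonneg_right hbound (sq_nonneg τ)
      rw [one_mul] at h1
      refine le_trans (le_of_eq ?_) h1
      field_simp)
  obtain ⟨B, A, hB, hA, hBy, hAz, hAB⟩ := exists_embedding X r hν hnorm hn hΦs hΦn hΦ1 hΦ0 hΨn hΨ
    hΨ0 θ σ hσ
  refine ⟨B, A, hB, hA, hAB, c, fun y => ?_, fun δ hdiag => ?_⟩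
  · have h1 : A (T (B y)) - c • y =
        synth X r (N + 1) n (push θ σ (n + 1) (T' (pull θ σ (Φ y))) - c • Φ y) := by
      rw [map_sub, map_smul, hΦs, hAz, hBy, hT'a]
    rw [h1, norm_synth_of_condE X r (hnorm n hn'), ← hΦn y]
    · refine (hc _ (hΦ1 y) (hΦ0 y)).trans ?_
      refine mul_le_mul_of_nonneg_right ?_ (apply_nonneg ν _)
      linarith
    · rw [map_sub, map_smul, hΦ1, push_apply, condE_condE_of_le le_rfl]
    · rw [map_sub, map_smul, hΦ0, condE_zero_push θ σ _ (hT'0 _), smul_zero, sub_zero]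
  -- The scalar is within Γ/q ≤ τ of the trace of one selected level, and that trace is at least δ.
  · have h1 := le_levelTrace X r hdiag hΨs hΨ0 k
    have h2 := (abs_le.1 hk).2
    rw [← hT'] at h1
    linarith

/-- The size of a large diagonal is bounded by the operator norm. -/
lemma le_of_hasLargePositiveDiagonal {Γ δ : ℝ} (hΓ : 0 ≤ Γ)
    {T : levelSpace X r N →L[ℝ] levelSpace X r N} (hT : ‖T‖ ≤ Γ)
    (hdiag : HasLargePositiveDiagonal X r δ T) : δ ≤ Γ := by
  obtain ⟨ν, hν, hnorm⟩ := exists_isHardyNorm X r (N + 1)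
  obtain ⟨Ψ, hΨs, hΨn, hΨ, -, hΨ0⟩ := exists_analysis X r hν le_rfl (hnorm N le_rfl)
  refine (le_levelTrace X r hdiag hΨs hΨ0 0).trans ((le_abs_self _).trans
    (abs_levelTrace_le hν hΓ (fun f hf => ?_) 0))
  rw [← norm_synth_of_condE X r (hnorm N le_rfl) (condE_of_le le_rfl f) hf]
  exact (hΨn _).le.trans ((T.le_opNorm _).trans (mul_le_mul_of_nonneg_right hT (norm_nonneg _)))

/-- `Y_n` is a contractively complemented subspace of `Y_N`. -/
lemma exists_contractions (hn : n ≤ N) :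
    ∃ (B : levelSpace X r n →L[ℝ] levelSpace X r N) (A : levelSpace X r N →L[ℝ] levelSpace X r n),
      ‖B‖ ≤ 1 ∧ ‖A‖ ≤ 1 ∧ ∀ y, A (B y) = y := by
  obtain ⟨ν, hν, hnorm⟩ := exists_isHardyNorm X r (N + 1)
  have hn' : n + 1 ≤ N + 1 := by omega
  obtain ⟨Φ, hΦs, hΦn, -, hΦ1, hΦ0⟩ := exists_analysis X r hν hn' (hnorm n hn')
  obtain ⟨Ψ, -, hΨn, hΨ, -, hΨ0⟩ := exists_analysis X r hν le_rfl (hnorm N le_rfl)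
  obtain ⟨B, A, hB, hA, -, -, hAB⟩ := exists_embedding X r hν hnorm hn hΦs hΦn hΦ1 hΦ0 hΨn hΨ
    hΨ0 1 1 (fun i j h _ => h)
  exact ⟨B, A, hB, hA, hAB⟩

lemma apply_id_sub_apply {E F : Type} [NormedAddCommGroup E] [NormedSpace ℝ E]
    [NormedAddCommGroup F] [NormedSpace ℝ F] {B : E →L[ℝ] F} {A : F →L[ℝ] E}
    (hAB : ∀ y, A (B y) = y) (T : F →L[ℝ] F) (c : ℝ) (y : E) :
    A ((ContinuousLinearMap.id ℝ F - T) (B y)) - (1 - c) • y = -(A (T (B y)) - c • y) := by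
  simp only [sub_apply, ContinuousLinearMap.id_apply, map_sub, hAB, sub_smul, one_smul]
  abel

lemma norm_comp_apply_le {E F : Type} [NormedAddCommGroup E] [NormedSpace ℝ E]
    [NormedAddCommGroup F] [NormedSpace ℝ F] {B : E →L[ℝ] F} {A : F →L[ℝ] E} (hB : ‖B‖ ≤ 1)
    (hA : ‖A‖ ≤ 1) {T : F →L[ℝ] F} {Γ : ℝ} (hT : ‖T‖ ≤ Γ) (y : E) :
    ‖A (T (B y))‖ ≤ Γ * ‖y‖ := by
  have h1 := A.le_of_opNorm_le hA (T (B y))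
  have h2 := T.le_of_opNorm_le hT (B y)
  have h3 := B.le_of_opNorm_le hB y
  have h4 : 0 ≤ Γ := (norm_nonneg T).trans hT
  have h5 := mul_le_mul_of_nonneg_left h3 h4
  linarith

end Factorization

end HaarHardy

end

theorem theorem1p1 (X : HaarHardy.HaarSystemSpace) (r : HaarHardy.rademacherFamilies)
    (Γ δ ε η : ℝ) (hΓ : 0 < Γ) (hδ : 0 < δ) (hε : 0 < ε) (hη : η = ε / (6 * (1 + ε)))
    (n N : ℕ)
    (hN :
      (42 * (n : ℤ) * ((n : ℤ) + 1) * ⌈Γ / (η * δ)⌉ + 42 + ⌊4 * Real.logb 2 (Γ / (η * δ))⌋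
          ≤ (N : ℤ)) ∨
      ∃ K : ℝ, 1 ≤ K ∧ HaarHardy.IsUnconditional X r K ∧
        (42 * (n : ℤ) * ⌈K * Γ / (η * δ)⌉ + 42 + ⌊4 * Real.logb 2 (Γ / (η * δ))⌋ ≤ (N : ℤ)))
    (T : HaarHardy.levelSpace X r N →L[ℝ] HaarHardy.levelSpace X r N) (hT : ‖T‖ ≤ Γ) :
    (δ = 1 → n ≤ N →
      HaarHardy.FactorsThrough (ContinuousLinearMap.id ℝ (HaarHardy.levelSpace X r n)) T
          (2 * (1 + ε)) ∨
        HaarHardy.FactorsThrough (ContinuousLinearMap.id ℝ (HaarHardy.levelSpace X r n))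
          (ContinuousLinearMap.id ℝ (HaarHardy.levelSpace X r N) - T) (2 * (1 + ε))) ∧
    (HaarHardy.HasLargePositiveDiagonal X r δ T →
      HaarHardy.FactorsThrough (ContinuousLinearMap.id ℝ (HaarHardy.levelSpace X r n)) T
        ((1 + ε) / δ)) := by
  have := HaarHardy.finiteDimensional_levelSpace X r n
  have hη0 : 0 < η := by rw [hη]; positivity
  have hη1 : 1 - 6 * η = 1 / (1 + ε) := by rw [hη]; field_simp; ring
  have hη2 : 6 * η ≤ 1 := by
    have : 0 < 1 / (1 + ε) := by positivity
    linarith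
  have hτ : 0 < η * δ := mul_pos hη0 hδ
  constructor
  · rintro rfl hn
    have hC : 1 / (2 * (1 + ε)) = 1 / 2 - 3 * η := by
      rw [show (1 : ℝ) / 2 - 3 * η = (1 - 6 * η) / 2 by ring, hη1]; field_simp
    have hC0 : 0 < 2 * (1 + ε) := by positivity
    -- For Γ < 1/2 the ratio Γ/η may be below 1. Then no clustering is needed: the compression of I
    -- - T is within Γ < 1/2 of the identity.
    rcases lt_or_ge Γ (1 / 2) with hsmall | hlarge
    · obtain ⟨B, A, hB, hA, hAB⟩ := HaarHardy.exists_contractions X r hn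
      refine Or.inr (HaarHardy.factorsThrough_of_near_smul hB hA _ (c := 1) (β := Γ) hC0 ?_
        fun y => ?_)
      · rw [hC, abs_one]
        linarith
      · have e : A ((ContinuousLinearMap.id ℝ (HaarHardy.levelSpace X r N) - T) (B y)) -
            (1 : ℝ) • y = -A (T (B y)) := by
          simp [hAB]
        rw [e, norm_neg]
        exact HaarHardy.norm_comp_apply_le hB hA hT y
    · obtain ⟨B, A, hB, hA, hAB, c, hc, -⟩ := HaarHardy.exists_almost_scalar X r hΓ hτ
        (by rw [le_div_iff₀ hτ]; linarith) hN T hT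
      -- Either |c| or |1 - c| is at least 1/2, and 1/2 - 3η is the reciprocal of 2(1 + ε).
      rcases le_total (1 / 2) |c| with h | h
      · refine Or.inl (HaarHardy.factorsThrough_of_near_smul hB hA T (c := c)
          (β := 3 * (η * 1)) hC0 ?_ hc)
        rw [hC]
        linarith
      · refine Or.inr (HaarHardy.factorsThrough_of_near_smul hB hA _ (c := 1 - c)
          (β := 3 * (η * 1)) hC0 ?_ fun y => ?_)
        · have : 1 / 2 ≤ |1 - c| := by
            have := le_abs_self (1 - c)
            have := le_abs_self c
            linarith
          rw [hC]
          linarith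
        · rw [HaarHardy.apply_id_sub_apply hAB, norm_neg]
          exact hc y
  · intro hdiag
    -- Since δ ≤ Γ and η ≤ 1/6, the ratio Γ/(ηδ) is at least 1, as required for the almost scalar
    -- compression.
    have hδΓ := HaarHardy.le_of_hasLargePositiveDiagonal X r hΓ.le hT hdiag
    obtain ⟨B, A, hB, hA, -, c, hc, hcδ⟩ := HaarHardy.exists_almost_scalar X r hΓ hτ
      (by rw [le_div_iff₀ hτ]; nlinarith) hN T hT
    refine HaarHardy.factorsThrough_of_near_smul hB hA T (c := c) (β := 3 * (η * δ))
      (by positivity) ?_ hc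
    have h1 := hcδ δ hdiag
    have h2 : 1 / ((1 + ε) / δ) = δ * (1 - 6 * η) := by
      rw [hη1]; field_simp
    rw [h2]
    -- The bounds give |c| - 3ηδ ≥ δ - 4ηδ, which exceeds δ(1 - 6η) = δ/(1 + ε).
    nlinarith [le_abs_self c]
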